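/- Let $G$ be a $3$-dimensional Lie group with a left-invariant semi-Riemannian metric of diagonalizable type: there are a left-invariant frame $\{E_1,E_2,E_3\}$, signs $\epsilon_i\in\{-1,1\}$ and constants $c_1,c_2,c_3\in\mathbb R$ with $\langle E_i,E_j\rangle=\epsilon_i\delta_{ij}$ and $[E_1,E_2]=c_3E_3$, $[E_2,E_3]=c_1E_1$, $[E_3,E_1]=c_2E_2$ (so $G$ is unimodular). Assume that $G$ does not have constant sectional curvature. All surfaces below are smooth, connected, immersed in $G$ with nondegenerate induced metric (definite or Lorentzian), and oriented by a smooth unit normal $N$, $\langle N,N\rangle=\delta\in\{-1,1\}$; the angle functions are $\nu_i=\langle N,E_i\rangle$, so $\sum_{\alpha}\epsilon_\alpha\nu_\alpha^2=\delta$, and $\zeta=\sum_{\alpha}c_\alpha\nu_\alpha^2$. 1. For every such surface $\Sigma$ the following are equivalent: (i) $\Sigma$ has zero mean curvature and $\zeta=0$ identically; (ii) the angle functions $\nu_1,\nu_2,\nu_3$ are constant; (iii) the image of $\Sigma$ lies in a left coset of a $2$-dimensional (immersed, second countable) Lie subgroup of $G$. 2. Let $\nu_1,\nu_2,\nu_3\in\mathbb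 R$ satisfy $\sum_\alpha\epsilon_\alpha\nu_\alpha^2=\delta$ for some $\delta\in\{-1,1\}$ and $\sum_\alpha c_\alpha\nu_\alpha^2=0$. Then there is a complete injectively immersed surface $F:\Sigma_0\to G$ with constant angle functions $\nu_1,\nu_2,\nu_3$. It is unique up to left translation: for every immersed surface $\phi:\Sigma\to G$ with the same constant angle functions there are $g\in G$ and a local diffeomorphism $\psi:\Sigma\to\Sigma_0$ with $\phi(p)=g\,F(\psi(p))$ for all $p\in\Sigma$, and $\psi$ is surjective if $\Sigma$ is complete (so that $\phi(\Sigma)=g\,F(\Sigma_0)$, and $\psi$ is a diffeomorphism if moreover $\phi$ is injective). Here a surface with definite induced metric is complete if it is complete for that metric in the usual sense, and a surface with Lorentzian induced metric is complete if it is complete for the Riemannian metric induced on it by a left-invariant Riemannian metric of $G$ (all choices are equivalent). -/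

import Mathlib

open scoped Manifold ContDiff Topology

universe u v

noncomputable section

/-- Model space of 3-dimensional Lie groups. -/
abbrev E3 : Type := EuclideanSpace ℝ (Fin 3)

/-- Model space of surfaces and of 2-dimensional Lie groups. -/
abbrev E2 : Type := EuclideanSpace ℝ (Fin 2)

/-- A left-invariant semi-Riemannian metric of diagonalizable type on a 3-dimensional Lie group `G`,
given by a basis `E` of the Lie algebra, declared to be positively oriented and orthonormal with
signs `ε`, in which the bracket is diagonal with structure constants `c`
(the indices 1, 2, 3 are 0, 1, 2 here). Unimodularity is a consequence. -/
structure DiagonalMetric (G : Type*) [TopologicalSpace G] [ChartedSpace E3 G] [Group G] where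
  E : Module.Basis (Fin 3) ℝ (GroupLieAlgebra 𝓘(ℝ, E3) G)
  ε : Fin 3 → ℝ
  c : Fin 3 → ℝ
  ε_sign : ∀ i, ε i = 1 ∨ ε i = -1
  bracket_01 : ⁅E 0, E 1⁆ = c 2 • E 2
  bracket_12 : ⁅E 1, E 2⁆ = c 0 • E 0
  bracket_20 : ⁅E 2, E 0⁆ = c 1 • E 1

namespace DiagonalMetric

variable {G : Type*} [TopologicalSpace G] [ChartedSpace E3 G] [Group G] (D : DiagonalMetric G)

/-- The metric on the Lie algebra, for which `⟨E i, E j⟩ = ε i δ i j`. -/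
def metric (X Y : GroupLieAlgebra 𝓘(ℝ, E3) G) : ℝ :=
  ∑ i, D.ε i * D.E.repr X i * D.E.repr Y i

/-- The Levi-Civita connection `∇_X Y` of the left-invariant metric, on left-invariant vector
fields, given by the Koszul formula
`2⟨∇_X Y, Z⟩ = ⟨[X, Y], Z⟩ - ⟨[Y, Z], X⟩ + ⟨[Z, X], Y⟩`. -/
def nabla (X Y : GroupLieAlgebra 𝓘(ℝ, E3) G) : GroupLieAlgebra 𝓘(ℝ, E3) G :=
  ∑ k, (D.ε k * ((D.metric ⁅X, Y⁆ (D.E k) - D.metric ⁅Y, D.E k⁆ X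
    + D.metric ⁅D.E k, X⁆ Y) / 2)) • D.E k

/-- The Riemann curvature tensor `R(X, Y) Z` on left-invariant vector fields. -/
def curvature (X Y Z : GroupLieAlgebra 𝓘(ℝ, E3) G) : GroupLieAlgebra 𝓘(ℝ, E3) G :=
  D.nabla X (D.nabla Y Z) - D.nabla Y (D.nabla X Z) - D.nabla ⁅X, Y⁆ Z

/-- The sectional curvature takes the same value on all nondegenerate planes
(by left invariance it is enough to look at the identity element). -/
def HasConstantSectionalCurvature : Prop :=
  ∃ κ : ℝ, ∀ X Y : GroupLieAlgebra 𝓘(ℝ, E3) G,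
    D.metric X X * D.metric Y Y - D.metric X Y ^ 2 ≠ 0 →
      D.metric (D.curvature X Y Y) X / (D.metric X X * D.metric Y Y - D.metric X Y ^ 2) = κ

end DiagonalMetric

/-- A smooth immersion of a surface `S` into `G` together with a smooth unit normal field `N`.
The normal at `p` is the left translate to the point `toFun p` of the vector `gauss p` of the Lie
algebra, and `sgn` is the sign `⟨N, N⟩`. The surface carries the induced metric, which is
nondegenerate since it has a unit normal. The orientation of the surface is the one
determined by `N`. -/
structure ImmersedSurface {G : Type*} [TopologicalSpace G] [ChartedSpace E3 G] [Group G]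
    (D : DiagonalMetric G) (S : Type*) [TopologicalSpace S] [ChartedSpace E2 S] where
  toFun : S → G
  gauss : S → GroupLieAlgebra 𝓘(ℝ, E3) G
  sgn : ℝ
  smooth : ContMDiff 𝓘(ℝ, E2) 𝓘(ℝ, E3) ∞ toFun
  immersive : ∀ p, Function.Injective (mfderiv 𝓘(ℝ, E2) 𝓘(ℝ, E3) toFun p)
  gauss_smooth : ∀ i, ContMDiff 𝓘(ℝ, E2) 𝓘(ℝ, ℝ) ∞ (fun p => D.E.repr (gauss p) i)
  sgn_sign : sgn = 1 ∨ sgn = -1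
  gauss_unit : ∀ p, D.metric (gauss p) (gauss p) = sgn
  gauss_normal : ∀ p (v : TangentSpace 𝓘(ℝ, E2) p),
    D.metric (gauss p)
      (mfderiv 𝓘(ℝ, E2) 𝓘(ℝ, E3) (fun q => (toFun p)⁻¹ * toFun q) p v) = 0

namespace ImmersedSurface

variable {G : Type*} [TopologicalSpace G] [ChartedSpace E3 G] [Group G]
  {D : DiagonalMetric G} {S : Type*} [TopologicalSpace S] [ChartedSpace E2 S]
  (φ : ImmersedSurface D S)

/-- The tangent vector `dφ(v)` of `G`, left-translated to the identity. -/
def push (p : S) (v : TangentSpace 𝓘(ℝ, E2) p) : GroupLieAlgebra 𝓘(ℝ, E3) G :=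
  mfderiv 𝓘(ℝ, E2) 𝓘(ℝ, E3) (fun q => (φ.toFun p)⁻¹ * φ.toFun q) p v

/-- The angle functions `ν i = ⟨N, E i⟩`. -/
def angle (i : Fin 3) (p : S) : ℝ := D.metric (φ.gauss p) (D.E i)

/-- The function `ζ = ∑ c i (ν i)²`. -/
def zeta (p : S) : ℝ := ∑ i, D.c i * φ.angle i p ^ 2

/-- The derivative `dν i (v)` of an angle function. -/
def angleDeriv (i : Fin 3) (p : S) (v : TangentSpace 𝓘(ℝ, E2) p) : ℝ :=
  mfderiv 𝓘(ℝ, E2) 𝓘(ℝ, ℝ) (φ.angle i) p v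

/-- The ambient covariant derivative `∇_v N` of the unit normal `N = ∑ ε i (ν i) E i` along the
surface, left-translated to the identity. -/
def nablaNormal (p : S) (v : TangentSpace 𝓘(ℝ, E2) p) : GroupLieAlgebra 𝓘(ℝ, E3) G :=
  ∑ i, (D.ε i * φ.angleDeriv i p v) • D.E i
    + D.nabla (φ.push p v) (φ.gauss p)

/-- The coordinate basis of the tangent plane at `p`. -/
def coordVec (p : S) (a : Fin 2) : TangentSpace 𝓘(ℝ, E2) p := EuclideanSpace.single a (1 : ℝ)

/-- Matrix of the induced metric in the coordinate basis. -/
def firstForm (p : S) : Matrix (Fin 2) (Fin 2) ℝ :=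
  Matrix.of fun a b => D.metric (φ.push p (coordVec p a)) (φ.push p (coordVec p b))

/-- Matrix of `⟨A v, w⟩`, where `A v = -∇_v N` is the shape operator, in the coordinate basis. -/
def secondForm (p : S) : Matrix (Fin 2) (Fin 2) ℝ :=
  Matrix.of fun a b => - D.metric (φ.push p (coordVec p a)) (φ.nablaNormal p (coordVec p b))

/-- The matrix of the shape operator in the coordinate basis. -/
def shapeMatrix (p : S) : Matrix (Fin 2) (Fin 2) ℝ := (φ.firstForm p)⁻¹ * φ.secondForm p

/-- The mean curvature: half the trace of the shape operator, times the sign of the normal. -/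
def meanCurvature (p : S) : ℝ := φ.sgn / 2 * (φ.shapeMatrix p).trace

/-- Every `C¹` curve in the surface that has finite length for the length element `√q`, where `q` is
a quadratic form on the Lie algebra (that is, a left-invariant quadratic form on `G`, restricted to
the surface), has an endpoint in the surface. When `√q` is the norm of a Riemannian metric on the
surface, this says that the surface is a complete metric space for it. -/
def IsCompleteFor (q : GroupLieAlgebra 𝓘(ℝ, E3) G → ℝ) : Prop :=
  ∀ γ : ℝ → S, ContMDiffOn 𝓘(ℝ, ℝ) 𝓘(ℝ, E2) 1 γ (Set.Ioo 0 1) →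
    MeasureTheory.IntegrableOn
      (fun t => √(q (φ.push (γ t) (mfderiv 𝓘(ℝ, ℝ) 𝓘(ℝ, E2) γ t (1 : ℝ))))) (Set.Ioo 0 1) →
    ∃ p, Filter.Tendsto γ (𝓝[<] (1 : ℝ)) (𝓝 p)

/-- The induced metric is positive or negative definite, i.e., it has no null vectors. -/
def IsDefinite : Prop :=
  ∀ p (v : TangentSpace 𝓘(ℝ, E2) p), v ≠ 0 → D.metric (φ.push p v) (φ.push p v) ≠ 0

open Classical in
/-- Completeness. If the induced metric is definite, this is completeness of the induced Riemannian
metric in the usual sense. If it is Lorentzian, this is completeness for the Riemannian metric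
induced by a left-invariant Riemannian metric of `G`, namely the one with orthonormal frame `E`
(any two left-invariant Riemannian metrics are bi-Lipschitz, so the choice is irrelevant). -/
def IsComplete : Prop :=
  if φ.IsDefinite then φ.IsCompleteFor (fun X => |D.metric X X|)
  else φ.IsCompleteFor (fun X => ∑ i, D.E.repr X i ^ 2)

end ImmersedSurface

/-- `H` is a 2-dimensional (immersed) Lie subgroup of `G`: the image of an injective immersive
homomorphism from a (second countable) 2-dimensional Lie group. By second countability
such a Lie group can always be realized on a set in the lowest universe. -/
def IsLieSubgroupOfDimTwo {G : Type*} [TopologicalSpace G] [ChartedSpace E3 G] [Group G]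
    (H : Subgroup G) : Prop :=
  ∃ (K : Type) (_ : TopologicalSpace K) (_ : T2Space K) (_ : SecondCountableTopology K)
    (_ : ChartedSpace E2 K) (_ : Group K) (_ : LieGroup 𝓘(ℝ, E2) ∞ K) (ι : K →* G),
    ContMDiff 𝓘(ℝ, E2) 𝓘(ℝ, E3) ∞ ι ∧ Function.Injective ι ∧
    (∀ k, Function.Injective (mfderiv 𝓘(ℝ, E2) 𝓘(ℝ, E3) ι k)) ∧ ι.range = H

end

/-! Everything is pulled back to the Lie algebra by the left logarithmic derivative θ = f⁻¹df
(`leftDeriv`). The angle functions form a covector that annihilates the tangent planes: Σ νᵢθᵢ = 0.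
Put M(u,v) = Σ dνᵢ(u)θᵢ(v). Differentiating the relation and inserting the Maurer–Cartan equation
(`maurerCartan`) shows that the antisymmetric part of M is ζ up to a nonvanishing factor
(`dAngle_sub`, `exists_zeta_eq`). The second fundamental form is M plus a term in which N is frozen
to a left-invariant field. That term has trace zero, so the mean curvature is the trace of M up to a
nonvanishing factor (`sum_adjugate_nab`, `meanCurvature_eq`). Hence (i) says that M is symmetric and
trace-free, and since Σ εᵢνᵢdνᵢ = 0, M vanishes only where all dνᵢ vanish. In particular (ii) gives
(i).

For (i) ⇒ (ii), let U = Σ cᵢνᵢEᵢ. It is tangent because ζ = 0, and M(·,U) = 0 because dζ = 0. Where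
⟨U,U⟩ ≠ 0, a trace-free symmetric form with kernel vector U must vanish (`eq_zero_of_null_vector`).
The square of ⟨U,U⟩ is therefore locally constant, so ⟨U,U⟩ is nonzero everywhere or nowhere. If it
is identically zero, the numbers εᵢνᵢ² satisfy a Vandermonde system with nodes εᵢcᵢ. Distinct nodes
make the νᵢ constant. If two nodes coincide, either the metric is flat, which is excluded, or the
two nodes vanish and the third angle function is zero, and then the third frame vector replaces U
(`exists_angle_eq_of_minimal`).

For (ii) ⇒ (iii) and for part 2, ζ = 0 makes the plane annihilated by ν a subalgebra with a basis
[X,Y] = lY (`exists_frame`). Products of two one-parameter subgroups give an explicit homomorphism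
from a group structure on ℝ² (`exists_isPlaneMap`, `map_mul`). Dividing by its discrete kernel gives
an injectively immersed group K. Surfaces tangent to the plane field factor through left cosets of K
(`exists_lift`). Curves of finite length in K are reconstructed by integration up to their endpoint,
whence completeness (`exists_tendsto`). Lifting one-parameter curves to a complete surface gives
surjectivity (`surjective_of_isComplete`).

For (iii) ⇒ (ii), a tangent vector transverse to the subgroup would make its image contain an open
set, contradicting Hausdorff dimension (`leftDeriv_mem_range_of_subset_coset`). So the tangent
planes are all left translates of one plane, and the normal is constant by connectedness. -/

noncomputable section

/-! ### Derivatives of maps between manifolds, with values in the model spaces. -/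

section ModelDeriv

variable (F F' F'' : Type*) [NormedAddCommGroup F] [NormedSpace ℝ F]
  [NormedAddCommGroup F'] [NormedSpace ℝ F'] [NormedAddCommGroup F''] [NormedSpace ℝ F'']
  {M : Type*} [TopologicalSpace M] [ChartedSpace F M]
  {M' : Type*} [TopologicalSpace M'] [ChartedSpace F' M']
  {M'' : Type*} [TopologicalSpace M''] [ChartedSpace F'' M'']

/-- The manifold derivative, as a map between the model spaces. -/
def modelDeriv (f : M → M') (p : M) : F →L[ℝ] F' := mfderiv 𝓘(ℝ, F) 𝓘(ℝ, F') f p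

/-- Differentiability of a map between manifolds without boundary. -/
abbrev ModelDiffAt (f : M → M') (p : M) : Prop := MDifferentiableAt 𝓘(ℝ, F) 𝓘(ℝ, F') f p

/-- `C^n` maps between manifolds without boundary. -/
abbrev ModelSmoothAt (n : ℕ∞ω) (f : M → M') (p : M) : Prop := ContMDiffAt 𝓘(ℝ, F) 𝓘(ℝ, F') n f p

variable {F F' F''}

theorem modelDeriv_comp {g : M' → M''} {f : M → M'} {p : M} (hg : ModelDiffAt F' F'' g (f p))
    (hf : ModelDiffAt F F' f p) :
    modelDeriv F F'' (fun q => g (f q)) p = (modelDeriv F' F'' g (f p)).comp (modelDeriv F F' f p) :=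
  mfderiv_comp p hg hf

theorem modelDeriv_id (p : M) : modelDeriv F F (fun q : M => q) p = ContinuousLinearMap.id ℝ F :=
  mfderiv_id

theorem modelDeriv_const (c : M') (p : M) : modelDeriv F F' (fun _ : M => c) p = 0 :=
  mfderiv_const

theorem modelDeriv_congr {f g : M → M'} {p : M} (h : f =ᶠ[𝓝 p] g) :
    modelDeriv F F' f p = modelDeriv F F' g p := by
  unfold modelDeriv
  have := h.mfderiv_eq (I := 𝓘(ℝ, F)) (I' := 𝓘(ℝ, F'))
  exact this

theorem modelDeriv_eq_fderiv (f : F → F') (p : F) : modelDeriv F F' f p = fderiv ℝ f p :=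
  mfderiv_eq_fderiv

theorem ModelDiffAt.compose {g : M' → M''} {f : M → M'} {p : M} (hg : ModelDiffAt F' F'' g (f p))
    (hf : ModelDiffAt F F' f p) : ModelDiffAt F F'' (fun q => g (f q)) p :=
  MDifferentiableAt.comp (I' := 𝓘(ℝ, F')) p hg hf

theorem ModelSmoothAt.compose {n : ℕ∞ω} {g : M' → M''} {f : M → M'} {p : M}
    (hg : ModelSmoothAt F' F'' n g (f p))
    (hf : ModelSmoothAt F F' n f p) : ModelSmoothAt F F'' n (fun q => g (f q)) p :=
  ContMDiffAt.comp (I' := 𝓘(ℝ, F')) p hg hf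

theorem modelDeriv_prod {f : M → M'} {g : M → M''} {p : M} (hf : ModelDiffAt F F' f p)
    (hg : ModelDiffAt F F'' g p) :
    (mfderiv 𝓘(ℝ, F) (𝓘(ℝ, F').prod 𝓘(ℝ, F'')) (fun q => (f q, g q)) p : F →L[ℝ] F' × F'')
      = (modelDeriv F F' f p).prod (modelDeriv F F'' g p) :=
  mfderiv_prodMk hf hg

end ModelDeriv

/-! ### Left logarithmic derivatives and the adjoint action. -/

section LeftDeriv

variable (F E F' : Type*) [NormedAddCommGroup E] [NormedSpace ℝ E]
  {G : Type*} [TopologicalSpace G] [ChartedSpace E G] [Group G]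
  [NormedAddCommGroup F] [NormedSpace ℝ F]
  {M : Type*} [TopologicalSpace M] [ChartedSpace F M]
  [NormedAddCommGroup F'] [NormedSpace ℝ F']
  {M' : Type*} [TopologicalSpace M'] [ChartedSpace F' M']

/-- The left logarithmic derivative `f⁻¹ df` at `p` of a map into a Lie group. -/
def leftDeriv (f : M → G) (p : M) : F →L[ℝ] E := modelDeriv F E (fun q => (f p)⁻¹ * f q) p

/-- The adjoint action on the Lie algebra. -/
def adj (g : G) : E →L[ℝ] E := modelDeriv E E (fun h => g * h * g⁻¹) (1 : G)

variable {E F F'}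

theorem leftDeriv_const_mul (f : M → G) (g : G) (p : M) :
    leftDeriv F E (fun q => g * f q) p = leftDeriv F E f p := by
  unfold leftDeriv
  simp_rw [mul_inv_rev, mul_assoc, inv_mul_cancel_left]

theorem leftDeriv_of_eq_one {f : M → G} {p : M} (h : f p = 1) :
    leftDeriv F E f p = modelDeriv F E f p := by
  simp only [leftDeriv, h, inv_one, one_mul]

theorem leftDeriv_congr {f g : M → G} {p : M} (h : f =ᶠ[𝓝 p] g) :
    leftDeriv F E f p = leftDeriv F E g p := by
  unfold leftDeriv
  rw [h.self_of_nhds]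
  exact modelDeriv_congr (by filter_upwards [h] with y hy; rw [hy])

variable [LieGroup 𝓘(ℝ, E) ∞ G]

theorem modelDiffAt_mul_left (g h : G) : ModelDiffAt E E (fun x : G => g * x) h :=
  (contMDiff_mul_left (I := 𝓘(ℝ, E)) (n := ∞) (a := g)).mdifferentiableAt (by simp)

theorem modelDiffAt_mul_right (g h : G) : ModelDiffAt E E (fun x : G => x * g) h :=
  (contMDiff_mul_right (I := 𝓘(ℝ, E)) (n := ∞) (a := g)).mdifferentiableAt (by simp)

theorem ModelDiffAt.const_mul {f : M → G} {p : M} (g : G) (hf : ModelDiffAt F E f p) :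
    ModelDiffAt F E (fun q => g * f q) p := (modelDiffAt_mul_left g (f p)).compose hf

theorem ModelDiffAt.mul_const {f : M → G} {p : M} (hf : ModelDiffAt F E f p) (g : G) :
    ModelDiffAt F E (fun q => f q * g) p := (modelDiffAt_mul_right g (f p)).compose hf

theorem ModelDiffAt.group_mul {f g : M → G} {p : M} (hf : ModelDiffAt F E f p) (hg : ModelDiffAt F E g p) :
    ModelDiffAt F E (fun q => f q * g q) p :=
  MDifferentiableAt.comp (I' := 𝓘(ℝ, E).prod 𝓘(ℝ, E)) (g := fun z : G × G => z.1 * z.2) p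
    ((contMDiff_mul 𝓘(ℝ, E) ∞).mdifferentiableAt (by simp)) (hf.prodMk hg)

theorem ModelDiffAt.group_inv {f : M → G} {p : M} (hf : ModelDiffAt F E f p) :
    ModelDiffAt F E (fun q => (f q)⁻¹) p :=
  MDifferentiableAt.comp (I' := 𝓘(ℝ, E)) (g := fun z : G => z⁻¹) p
    ((contMDiff_inv 𝓘(ℝ, E) (∞ : ℕ∞ω)).mdifferentiableAt (by simp)) hf

theorem leftDeriv_comp {f : M → G} {u : M' → M} {x : M'} (hf : ModelDiffAt F E f (u x))
    (hu : ModelDiffAt F' F u x) :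
    leftDeriv F' E (fun y => f (u y)) x = (leftDeriv F E f (u x)).comp (modelDeriv F' F u x) :=
  modelDeriv_comp (g := fun q => (f (u x))⁻¹ * f q) (hf.const_mul _) hu

theorem modelDeriv_eq_comp_leftDeriv {f : M → G} {p : M} (hf : ModelDiffAt F E f p) :
    modelDeriv F E f p
      = (modelDeriv E E (fun h => f p * h) (1 : G)).comp (leftDeriv F E f p) := by
  have h3 := modelDeriv_comp (g := fun h => f p * h) (f := fun q => (f p)⁻¹ * f q)
    (modelDiffAt_mul_left (E := E) (f p) _) (hf.const_mul (f p)⁻¹)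
  simp only [mul_inv_cancel_left, inv_mul_cancel] at h3
  exact h3

theorem leftDeriv_eq_comp_modelDeriv {f : M → G} {p : M} (hf : ModelDiffAt F E f p) :
    leftDeriv F E f p
      = (modelDeriv E E (fun h => (f p)⁻¹ * h) (f p)).comp (modelDeriv F E f p) :=
  modelDeriv_comp (g := fun h => (f p)⁻¹ * h) (modelDiffAt_mul_left (E := E) (f p)⁻¹ _) hf

theorem modelDeriv_apply_eq_zero_iff {f : M → G} {p : M} (hf : ModelDiffAt F E f p) (v : F) :
    modelDeriv F E f p v = 0 ↔ leftDeriv F E f p v = 0 := by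
  constructor
  · intro h
    rw [leftDeriv_eq_comp_modelDeriv hf, ContinuousLinearMap.comp_apply, h, map_zero]
  · intro h
    rw [modelDeriv_eq_comp_leftDeriv hf, ContinuousLinearMap.comp_apply, h, map_zero]

/-- At the identity both partial derivatives of multiplication are the identity map. -/
theorem modelDeriv_mul_of_eq_one {u w : M → G} {p : M} (hu : ModelDiffAt F E u p)
    (hw : ModelDiffAt F E w p) (hu1 : u p = 1) (hw1 : w p = 1) :
    modelDeriv F E (fun q => u q * w q) p = modelDeriv F E u p + modelDeriv F E w p := by
  have hm : MDifferentiableAt (𝓘(ℝ, E).prod 𝓘(ℝ, E)) 𝓘(ℝ, E) (fun z : G × G => z.1 * z.2)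
      (u p, w p) := (contMDiff_mul 𝓘(ℝ, E) ∞).mdifferentiableAt (by simp)
  have h1 := mfderiv_comp (I' := 𝓘(ℝ, E).prod 𝓘(ℝ, E)) (g := fun z : G × G => z.1 * z.2) p
    hm (hu.prodMk hw)
  ext v
  have h3 := DFunLike.congr_fun h1 v
  have h4 := mfderiv_prod_eq_add_apply hm (v := (modelDeriv F E u p v, modelDeriv F E w p v))
  have h5 : modelDeriv E E (fun z => z * w p) (u p) = ContinuousLinearMap.id ℝ E := by
    simp only [hw1, mul_one]; exact modelDeriv_id _
  have h6 : modelDeriv E E (fun z => u p * z) (w p) = ContinuousLinearMap.id ℝ E := by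
    simp only [hu1, one_mul]; exact modelDeriv_id _
  have h7 : (mfderiv 𝓘(ℝ, F) (𝓘(ℝ, E).prod 𝓘(ℝ, E)) (fun q => (u q, w q)) p : F →L[ℝ] E × E) v
      = (modelDeriv F E u p v, modelDeriv F E w p v) :=
    DFunLike.congr_fun (modelDeriv_prod hu hw) v
  have h8 : modelDeriv F E (fun q => u q * w q) p v
      = modelDeriv E E (fun z => z * w p) (u p) (modelDeriv F E u p v)
        + modelDeriv E E (fun z => u p * z) (w p) (modelDeriv F E w p v) :=
    (h3.trans (congrArg (mfderiv (𝓘(ℝ, E).prod 𝓘(ℝ, E)) 𝓘(ℝ, E) (fun z : G × G => z.1 * z.2)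
      (u p, w p) : E × E →L[ℝ] E) h7)).trans h4
  rw [h8, h5, h6]; rfl

/-- Up to conjugation by g(p), the product (f p g p)⁻¹ f q g q splits into two factors that both
equal 1 at q = p, where the derivative of a product is the sum. -/
theorem leftDeriv_mul {f g : M → G} {p : M} (hf : ModelDiffAt F E f p) (hg : ModelDiffAt F E g p) :
    leftDeriv F E (fun q => f q * g q) p
      = (adj E (g p)⁻¹).comp (leftDeriv F E f p) + leftDeriv F E g p := by
  have hc : ModelDiffAt E E (fun h : G => (g p)⁻¹ * h * (g p)⁻¹⁻¹) ((f p)⁻¹ * f p) :=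
    (modelDiffAt_mul_left _ _).mul_const _
  have h0 : (fun q => (f p * g p)⁻¹ * (f q * g q))
    = fun q => ((g p)⁻¹ * ((f p)⁻¹ * f q) * (g p)⁻¹⁻¹) * ((g p)⁻¹ * g q) := by
    funext q; group
  have h2 := modelDeriv_comp (f := fun q => (f p)⁻¹ * f q) hc (hf.const_mul (f p)⁻¹)
  rw [leftDeriv, h0, modelDeriv_mul_of_eq_one (hc.compose (f := fun q => (f p)⁻¹ * f q) (hf.const_mul _))
    (hg.const_mul _) (by simp) (by simp), h2]
  unfold adj leftDeriv
  simp only [inv_mul_cancel]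

theorem adj_comp_adj (g h : G) : (adj E g).comp (adj E h) = adj E (g * h) := by
  have hc : ∀ g x : G, ModelDiffAt E E (fun x : G => g * x * g⁻¹) x :=
    fun g x => (modelDiffAt_mul_left _ _).mul_const _
  have h2 := modelDeriv_comp (hc g _) (hc h 1)
  have h3 : (fun q => g * (h * q * h⁻¹) * g⁻¹) = fun q => (g * h) * q * (g * h)⁻¹ := by
    funext q; group
  rw [h3] at h2
  unfold adj
  rw [h2, mul_one, mul_inv_cancel]

omit [LieGroup 𝓘(ℝ, E) ∞ G] in
theorem adj_one : adj E (1 : G) = ContinuousLinearMap.id ℝ E := by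
  unfold adj
  simp only [one_mul, inv_one, mul_one]
  exact modelDeriv_id _

theorem adj_adj_inv (g : G) (v : E) : adj E g (adj E g⁻¹ v) = v := by
  have := DFunLike.congr_fun (adj_comp_adj (E := E) g g⁻¹) v
  rw [mul_inv_cancel, adj_one] at this
  exact this

end LeftDeriv

end

noncomputable section

/-! ### Charts, maps with zero derivative, and uniqueness from the logarithmic derivative. -/

section Charts

variable (F : Type*) [NormedAddCommGroup F] [NormedSpace ℝ F]
  {M : Type*} [TopologicalSpace M] [ChartedSpace F M]

/-- The preferred chart at a point. -/
abbrev chartTo (p : M) : M → F := extChartAt 𝓘(ℝ, F) p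

/-- The inverse of the preferred chart at a point. -/
abbrev chartFrom (p : M) : F → M := (extChartAt 𝓘(ℝ, F) p).symm

variable {F} {F' : Type*} [NormedAddCommGroup F'] [NormedSpace ℝ F']
  {M' : Type*} [TopologicalSpace M'] [ChartedSpace F' M']

theorem chartFrom_chartTo {p q : M} (h : q ∈ (extChartAt 𝓘(ℝ, F) p).source) :
    chartFrom F p (chartTo F p q) = q := (extChartAt 𝓘(ℝ, F) p).left_inv h

theorem chartTo_chartFrom {p : M} {y : F} (h : y ∈ (extChartAt 𝓘(ℝ, F) p).target) :
    chartTo F p (chartFrom F p y) = y := (extChartAt 𝓘(ℝ, F) p).right_inv h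

variable [IsManifold 𝓘(ℝ, F) ∞ M]

theorem smoothAt_chartTo {p q : M} (h : q ∈ (extChartAt 𝓘(ℝ, F) p).source) :
    ModelSmoothAt F F ∞ (chartTo F p) q :=
  contMDiffAt_extChartAt' (by simpa [extChartAt_source] using h)

theorem smoothAt_chartFrom {p : M} {y : F} (h : y ∈ (extChartAt 𝓘(ℝ, F) p).target) :
    ModelSmoothAt F F ∞ (chartFrom F p) y :=
  (contMDiffOn_extChartAt_symm p).contMDiffAt ((isOpen_extChartAt_target p).mem_nhds h)

theorem diffAt_chartTo {p q : M} (h : q ∈ (extChartAt 𝓘(ℝ, F) p).source) :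
    ModelDiffAt F F (chartTo F p) q := (smoothAt_chartTo h).mdifferentiableAt (by simp)

theorem diffAt_chartFrom {p : M} {y : F} (h : y ∈ (extChartAt 𝓘(ℝ, F) p).target) :
    ModelDiffAt F F (chartFrom F p) y := (smoothAt_chartFrom h).mdifferentiableAt (by simp)

theorem modelDeriv_chartTo_comp_chartFrom {p q : M} (h : q ∈ (extChartAt 𝓘(ℝ, F) p).source) :
    (modelDeriv F F (chartTo F p) q).comp (modelDeriv F F (chartFrom F p) (chartTo F p q))
      = ContinuousLinearMap.id ℝ F := by
  have ht : chartTo F p q ∈ (extChartAt 𝓘(ℝ, F) p).target := (extChartAt 𝓘(ℝ, F) p).map_source h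
  have h1 := modelDeriv_comp (g := chartTo F p) (f := chartFrom F p) (p := chartTo F p q)
    (by rw [chartFrom_chartTo h]; exact diffAt_chartTo h) (diffAt_chartFrom ht)
  rw [chartFrom_chartTo h] at h1
  rw [← h1]
  refine (modelDeriv_congr ?_).trans (modelDeriv_id _)
  filter_upwards [(isOpen_extChartAt_target p).mem_nhds ht] with y hy using chartTo_chartFrom hy

theorem modelDeriv_chartFrom_comp_chartTo {p q : M} (h : q ∈ (extChartAt 𝓘(ℝ, F) p).source) :
    (modelDeriv F F (chartFrom F p) (chartTo F p q)).comp (modelDeriv F F (chartTo F p) q)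
      = ContinuousLinearMap.id ℝ F := by
  have ht : chartTo F p q ∈ (extChartAt 𝓘(ℝ, F) p).target := (extChartAt 𝓘(ℝ, F) p).map_source h
  have h1 := modelDeriv_comp (g := chartFrom F p) (f := chartTo F p) (p := q)
    (diffAt_chartFrom ht) (diffAt_chartTo h)
  rw [← h1]
  refine (modelDeriv_congr ?_).trans (modelDeriv_id _)
  filter_upwards [(isOpen_extChartAt_source p).mem_nhds h] with y hy using chartFrom_chartTo hy

theorem modelDeriv_chartTo_self (p : M) :
    modelDeriv F F (chartTo F p) p = ContinuousLinearMap.id ℝ F := by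
  have : IsManifold 𝓘(ℝ, F) 1 M := IsManifold.of_le (n := ∞) (by simp)
  exact mfderiv_extChartAt_self

theorem modelDeriv_chartFrom_self (p : M) :
    modelDeriv F F (chartFrom F p) (chartTo F p p) = ContinuousLinearMap.id ℝ F := by
  have := modelDeriv_chartTo_comp_chartFrom (mem_extChartAt_source (I := 𝓘(ℝ, F)) p)
  rwa [modelDeriv_chartTo_self, ContinuousLinearMap.id_comp] at this

variable [IsManifold 𝓘(ℝ, F') ∞ M']

theorem eventually_eq_of_modelDeriv_eq_zero {f : M → M'} {U : Set M} (hU : IsOpen U)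
    (hf : ∀ p ∈ U, ModelDiffAt F F' f p) (hf' : ∀ p ∈ U, modelDeriv F F' f p = 0) {p : M}
    (hp : p ∈ U) : ∀ᶠ q in 𝓝 p, f q = f p := by
  have hps := mem_extChartAt_source (I := 𝓘(ℝ, F)) p
  have hpt := mem_extChartAt_target (I := 𝓘(ℝ, F)) p
  have hfp : ContinuousAt f p := (hf p hp).continuousAt
  have hV : U ∩ f ⁻¹' (extChartAt 𝓘(ℝ, F') (f p)).source ∈ 𝓝 p :=
    Filter.inter_mem (hU.mem_nhds hp) (hfp ((isOpen_extChartAt_source (f p)).mem_nhds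
      (mem_extChartAt_source (f p))))
  have hc : ContinuousAt (chartFrom F p) (chartTo F p p) := (diffAt_chartFrom hpt).continuousAt
  have hW : (chartFrom F p) ⁻¹' (U ∩ f ⁻¹' (extChartAt 𝓘(ℝ, F') (f p)).source)
      ∩ (extChartAt 𝓘(ℝ, F) p).target ∈ 𝓝 (chartTo F p p) :=
    Filter.inter_mem (hc (by rwa [chartFrom_chartTo hps]))
      ((isOpen_extChartAt_target p).mem_nhds hpt)
  obtain ⟨r, hr, hball⟩ := Metric.mem_nhds_iff.1 hW
  have hd : ∀ y ∈ Metric.ball (chartTo F p p) r,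
      ModelDiffAt F F' (fun y => f (chartFrom F p y)) y := fun y hy =>
    (hf _ (hball hy).1.1).compose (diffAt_chartFrom (hball hy).2)
  have hd' : ∀ y ∈ Metric.ball (chartTo F p p) r,
      DifferentiableAt ℝ (fun y => chartTo F' (f p) (f (chartFrom F p y))) y := fun y hy =>
    (ModelDiffAt.compose (f := fun y => f (chartFrom F p y)) (diffAt_chartTo (hball hy).1.2)
      (hd y hy)).differentiableAt
  have hz : ∀ y ∈ Metric.ball (chartTo F p p) r,
      fderiv ℝ (fun y => chartTo F' (f p) (f (chartFrom F p y))) y = 0 := fun y hy => by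
    rw [← modelDeriv_eq_fderiv, modelDeriv_comp (f := fun y => f (chartFrom F p y)) (diffAt_chartTo (hball hy).1.2)
        (hd y hy),
      modelDeriv_comp (hf _ (hball hy).1.1) (diffAt_chartFrom (hball hy).2), hf' _ (hball hy).1.1]
    simp
  have hcp : ContinuousAt (chartTo F p) p := (diffAt_chartTo hps).continuousAt
  filter_upwards [hcp (Metric.ball_mem_nhds _ hr), (isOpen_extChartAt_source p).mem_nhds hps]
    with q hq hq'
  have h1 := Metric.isOpen_ball.is_const_of_fderiv_eq_zero (convex_ball _ _).isPreconnected
    (fun y hy => (hd' y hy).differentiableWithinAt) hz hq (Metric.mem_ball_self hr)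
  have h2 := (hball hq).1.2
  simp only [Set.mem_preimage] at h2
  rw [chartFrom_chartTo hq'] at h1 h2
  rw [chartFrom_chartTo hps] at h1
  exact (extChartAt 𝓘(ℝ, F') (f p)).injOn h2 (mem_extChartAt_source (f p)) h1

theorem eq_of_modelDeriv_eq_zero {f : M → M'} {U : Set M} (hU : IsOpen U) (hc : IsPreconnected U)
    (hf : ∀ p ∈ U, ModelDiffAt F F' f p) (hf' : ∀ p ∈ U, modelDeriv F F' f p = 0) {p q : M}
    (hp : p ∈ U) (hq : q ∈ U) : f p = f q := by
  have : PreconnectedSpace U := Subtype.preconnectedSpace hc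
  have hl : IsLocallyConstant (fun x : U => f x) := by
    rw [IsLocallyConstant.iff_eventually_eq]
    intro x
    exact continuous_subtype_val.continuousAt.eventually
      (eventually_eq_of_modelDeriv_eq_zero hU hf hf' x.2)
  exact hl.apply_eq_of_preconnectedSpace ⟨p, hp⟩ ⟨q, hq⟩

end Charts

section Uniqueness

variable {F E : Type*} [NormedAddCommGroup E] [NormedSpace ℝ E]
  {G : Type*} [TopologicalSpace G] [ChartedSpace E G] [Group G] [LieGroup 𝓘(ℝ, E) ∞ G]
  [NormedAddCommGroup F] [NormedSpace ℝ F]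
  {M : Type*} [TopologicalSpace M] [ChartedSpace F M] [IsManifold 𝓘(ℝ, F) ∞ M]

/-- Two maps into a Lie group with the same logarithmic derivative differ by a left translation. -/
theorem mul_inv_eq_of_leftDeriv_eq {f g : M → G} {U : Set M} (hU : IsOpen U)
    (hc : IsPreconnected U) (hf : ∀ p ∈ U, ModelDiffAt F E f p) (hg : ∀ p ∈ U, ModelDiffAt F E g p)
    (h : ∀ p ∈ U, leftDeriv F E f p = leftDeriv F E g p) {p q : M} (hp : p ∈ U) (hq : q ∈ U) :
    f p * (g p)⁻¹ = f q * (g q)⁻¹ := by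
  have hd : ∀ p ∈ U, ModelDiffAt F E (fun q => f q * (g q)⁻¹) p := fun p hp =>
    (hf p hp).group_mul (hg p hp).group_inv
  refine eq_of_modelDeriv_eq_zero (F := F) (F' := E) hU hc hd (fun p hp => ?_) hp hq
  -- The product rule for f = (f g⁻¹) g: equal logarithmic derivatives of f and g force that of f
  -- g⁻¹, conjugated by g⁻¹, to vanish.
  have h1 := leftDeriv_mul (hd p hp) (hg p hp)
  simp only [inv_mul_cancel_right] at h1
  rw [h p hp, right_eq_add] at h1
  ext v
  refine (modelDeriv_apply_eq_zero_iff (hd p hp) v).2 ?_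
  have h2 := congrArg (adj E (g p)) (DFunLike.congr_fun h1 v)
  simpa [adj_adj_inv] using h2

end Uniqueness
end

noncomputable section

/-! ### Regularity of the logarithmic derivative and the Maurer–Cartan equation. -/

section LeftDerivSmooth

variable {F E : Type*} [NormedAddCommGroup E] [NormedSpace ℝ E]
  {G : Type*} [TopologicalSpace G] [ChartedSpace E G] [Group G] [LieGroup 𝓘(ℝ, E) ∞ G]
  [NormedAddCommGroup F] [NormedSpace ℝ F]
  {M : Type*} [TopologicalSpace M] [ChartedSpace F M]

theorem ModelSmoothAt.group_mul {n : ℕ∞ω} (hn : n ≤ ∞) {f g : M → G} {p : M}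
    (hf : ModelSmoothAt F E n f p) (hg : ModelSmoothAt F E n g p) :
    ModelSmoothAt F E n (fun q => f q * g q) p :=
  ContMDiffAt.comp (I' := 𝓘(ℝ, E).prod 𝓘(ℝ, E)) (g := fun z : G × G => z.1 * z.2) p
    ((contMDiff_mul 𝓘(ℝ, E) ∞).contMDiffAt.of_le hn) (hf.prodMk hg)

theorem ModelSmoothAt.group_inv {n : ℕ∞ω} (hn : n ≤ ∞) {f : M → G} {p : M}
    (hf : ModelSmoothAt F E n f p) : ModelSmoothAt F E n (fun q => (f q)⁻¹) p :=
  ContMDiffAt.comp (I' := 𝓘(ℝ, E)) (g := fun z : G => z⁻¹) p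
    ((contMDiff_inv 𝓘(ℝ, E) (∞ : ℕ∞ω)).contMDiffAt.of_le hn) hf

theorem ModelSmoothAt.const_mul {n : ℕ∞ω} (hn : n ≤ ∞) {f : M → G} {p : M} (g : G)
    (hf : ModelSmoothAt F E n f p) : ModelSmoothAt F E n (fun q => g * f q) p :=
  ModelSmoothAt.group_mul hn contMDiffAt_const hf

/-- The preferred chart at 1 has identity derivative there, so composing with it changes nothing and
leaves a derivative between vector spaces. -/
theorem leftDeriv_eq_fderiv {f : F → G} {x : F} (hf : ModelDiffAt F E f x) :
    leftDeriv F E f x = fderiv ℝ (fun y => chartTo E (1 : G) ((f x)⁻¹ * f y)) x := by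
  have h1 : (f x)⁻¹ * f x = 1 := inv_mul_cancel _
  have h2 := modelDeriv_comp (g := chartTo E (1 : G)) (f := fun y => (f x)⁻¹ * f y) (p := x)
    (by rw [h1]; exact diffAt_chartTo (mem_extChartAt_source _)) (hf.const_mul _)
  rw [modelDeriv_eq_fderiv, h1, modelDeriv_chartTo_self] at h2
  exact h2.symm

/-- The value at x is a partial derivative on the diagonal of the two-variable map (x, y) ↦
f(x)⁻¹f(y), so exactly one order of smoothness is lost. -/
theorem contDiffAt_leftDeriv {n m : ℕ∞ω} (hn : n ≤ ∞) (hmn : m + 1 ≤ n) {f : F → G} {x : F}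
    (hf : ∀ᶠ y in 𝓝 x, ModelSmoothAt F E n f y) :
    ContDiffAt ℝ m (leftDeriv F E f) x := by
  have h0 : n ≠ 0 := by
    rintro rfl
    simp at hmn
  have h1 : leftDeriv F E f
      =ᶠ[𝓝 x] fun x => fderiv ℝ ((fun x y => chartTo E (1 : G) ((f x)⁻¹ * f y)) x) x := by
    filter_upwards [hf] with y hy using leftDeriv_eq_fderiv (hy.mdifferentiableAt h0)
  refine ContDiffAt.congr_of_eventuallyEq ?_ h1
  refine ContDiffAt.fderiv (n := n) (g := fun x => x) ?_ contDiffAt_id hmn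
  rw [← contMDiffAt_iff_contDiffAt]
  have hfx := hf.self_of_nhds
  have h2 : ModelSmoothAt (F × F) E n (fun z : F × F => (f z.1)⁻¹ * f z.2) (x, x) :=
    ModelSmoothAt.group_mul hn
      (ModelSmoothAt.group_inv hn (ModelSmoothAt.compose (f := fun z : F × F => z.1) hfx
        contDiffAt_fst.contMDiffAt))
      (ModelSmoothAt.compose (f := fun z : F × F => z.2) hfx contDiffAt_snd.contMDiffAt)
  refine ModelSmoothAt.compose (g := chartTo E (1 : G)) ?_ h2
  simp only [inv_mul_cancel]
  exact (smoothAt_chartTo (mem_extChartAt_source _)).of_le hn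

end LeftDerivSmooth

section MaurerCartan

variable (F E : Type*) [NormedAddCommGroup E] [NormedSpace ℝ E]
  (G : Type*) [TopologicalSpace G] [ChartedSpace E G] [Group G]
  [NormedAddCommGroup F] [NormedSpace ℝ F]

/-- The bracket of the Lie algebra, as an operation on the model space. -/
def lieBr (X Y : E) : E := (Bracket.bracket : GroupLieAlgebra 𝓘(ℝ, E) G → GroupLieAlgebra 𝓘(ℝ, E) G
  → GroupLieAlgebra 𝓘(ℝ, E) G) X Y

/-- Left-invariant vector fields in the chart at the identity. -/
def invField (y : E) : E →L[ℝ] E :=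
  fderiv ℝ (fun z => chartTo E (1 : G) (chartFrom E (1 : G) y * chartFrom E (1 : G) z))
    (chartTo E (1 : G) 1)

variable {F E G} [LieGroup 𝓘(ℝ, E) ∞ G]

theorem modelDeriv_mul_left_eq {g : G} : modelDeriv E E (fun h : G => g * h) 1
    = modelDeriv E E (fun z => g * chartFrom E (1 : G) z) (chartTo E (1 : G) 1) := by
  have hs := mem_extChartAt_source (I := 𝓘(ℝ, E)) (1 : G)
  have h1 := modelDeriv_comp (g := fun h : G => g * h) (f := chartFrom E (1 : G))
    (p := chartTo E (1 : G) 1) (modelDiffAt_mul_left _ _)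
    (diffAt_chartFrom (mem_extChartAt_target _))
  rw [modelDeriv_chartFrom_self, chartFrom_chartTo hs, ContinuousLinearMap.comp_id] at h1
  exact h1.symm

theorem invField_chartTo {g : G} (hg : g ∈ (extChartAt 𝓘(ℝ, E) (1 : G)).source) :
    invField E G (chartTo E (1 : G) g)
      = (modelDeriv E E (chartTo E (1 : G)) g).comp (modelDeriv E E (fun h : G => g * h) 1) := by
  have hs := mem_extChartAt_source (I := 𝓘(ℝ, E)) (1 : G)
  rw [modelDeriv_mul_left_eq, invField, ← modelDeriv_eq_fderiv, chartFrom_chartTo hg]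
  have h1 : g * chartFrom E (1 : G) (chartTo E (1 : G) 1) = g := by
    rw [chartFrom_chartTo hs, mul_one]
  have h2 := modelDeriv_comp (g := chartTo E (1 : G)) (f := fun z => g * chartFrom E (1 : G) z)
    (p := chartTo E (1 : G) 1) (by rw [h1]; exact diffAt_chartTo hg)
    ((diffAt_chartFrom (mem_extChartAt_target _)).const_mul g)
  rw [h1] at h2
  exact h2

theorem invField_one : invField E G (chartTo E (1 : G) 1) = ContinuousLinearMap.id ℝ E := by
  rw [invField_chartTo (mem_extChartAt_source _), modelDeriv_chartTo_self]
  simp only [one_mul]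
  rw [modelDeriv_id]; rfl

theorem contDiffAt_invField {y : E} (hy : y ∈ (extChartAt 𝓘(ℝ, E) (1 : G)).target) :
    ContDiffAt ℝ ∞ (invField E G) y := by
  have hs := mem_extChartAt_source (I := 𝓘(ℝ, E)) (1 : G)
  have ht := mem_extChartAt_target (I := 𝓘(ℝ, E)) (1 : G)
  refine ContDiffAt.fderiv (n := ∞) (g := fun _ => chartTo E (1 : G) 1) (f := fun y z =>
    chartTo E (1 : G) (chartFrom E (1 : G) y * chartFrom E (1 : G) z)) ?_ contDiffAt_const
    (by simp)
  rw [← contMDiffAt_iff_contDiffAt]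
  have h2 : ModelSmoothAt (E × E) E ∞
      (fun z : E × E => chartFrom E (1 : G) z.1 * chartFrom E (1 : G) z.2)
      (y, chartTo E (1 : G) 1) :=
    ModelSmoothAt.group_mul le_rfl
      (ModelSmoothAt.compose (f := fun z : E × E => z.1) (smoothAt_chartFrom hy)
        contDiffAt_fst.contMDiffAt)
      (ModelSmoothAt.compose (f := fun z : E × E => z.2) (smoothAt_chartFrom ht)
        contDiffAt_snd.contMDiffAt)
  refine ModelSmoothAt.compose (g := chartTo E (1 : G)) ?_ h2
  simp only [chartFrom_chartTo hs, mul_one]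
  exact smoothAt_chartTo ((extChartAt 𝓘(ℝ, E) (1 : G)).map_target hy)

theorem fderiv_chartTo_comp {f : F → G} {x : F} (hf : ModelDiffAt F E f x)
    (hx : f x ∈ (extChartAt 𝓘(ℝ, E) (1 : G)).source) :
    fderiv ℝ (fun y => chartTo E (1 : G) (f y)) x
      = (invField E G (chartTo E (1 : G) (f x))).comp (leftDeriv F E f x) := by
  rw [← modelDeriv_eq_fderiv, modelDeriv_comp (diffAt_chartTo hx) hf, invField_chartTo hx,
    modelDeriv_eq_comp_leftDeriv hf]
  rfl

/-- In the chart at 1 the left-invariant field with value w is y ↦ `invField` y w. The bracket of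
two such fields at 1 simplifies because `invField` is the identity there. -/
theorem lieBr_eq (X Y : E) : lieBr E G X Y = fderiv ℝ (invField E G) (chartTo E (1 : G) 1) X Y
    - fderiv ℝ (invField E G) (chartTo E (1 : G) 1) Y X := by
  have hs := mem_extChartAt_source (I := 𝓘(ℝ, E)) (1 : G)
  have ht := mem_extChartAt_target (I := 𝓘(ℝ, E)) (1 : G)
  have hM : IsManifold 𝓘(ℝ, E) 1 G := IsManifold.of_le (n := ∞) (by simp)
  obtain ⟨P, hP, h0⟩ : ∃ P : E → E → E,
      (∀ w y, P w y = (modelDeriv E E (chartFrom E (1 : G)) y).inverse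
        (modelDeriv E E (fun h : G => chartFrom E (1 : G) y * h) 1 w)) ∧
      lieBr E G X Y = (modelDeriv E E (chartTo E (1 : G)) 1).inverse
        (VectorField.lieBracketWithin ℝ (P X) (P Y)
          ((chartFrom E (1 : G)) ⁻¹' Set.univ ∩ Set.range 𝓘(ℝ, E)) (chartTo E (1 : G) 1)) := by
    refine ⟨fun w => VectorField.mpullbackWithin 𝓘(ℝ, E) 𝓘(ℝ, E) (chartFrom E (1 : G))
      (mulInvariantVectorField (w : GroupLieAlgebra 𝓘(ℝ, E) G)) (Set.range 𝓘(ℝ, E)), ?_, rfl⟩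
    intro w y
    have hr : (mfderivWithin 𝓘(ℝ, E) 𝓘(ℝ, E) (chartFrom E (1 : G)) (Set.range 𝓘(ℝ, E)) y
        : E →L[ℝ] E) = modelDeriv E E (chartFrom E (1 : G)) y := by
      simp only [modelWithCornersSelf_coe, Set.range_id, mfderivWithin_univ]
      rfl
    exact congrArg (fun A : E →L[ℝ] E => A.inverse
      (modelDeriv E E (fun h : G => chartFrom E (1 : G) y * h) 1 w)) hr
  have key : ∀ w : E, P w =ᶠ[𝓝 (chartTo E (1 : G) 1)] fun y => invField E G y w := by
    intro w
    filter_upwards [(isOpen_extChartAt_target (I := 𝓘(ℝ, E)) (1 : G)).mem_nhds ht] with y hy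
    have hys := (extChartAt 𝓘(ℝ, E) (1 : G)).map_target hy
    have h1 := invField_chartTo hys
    rw [chartTo_chartFrom hy] at h1
    have ha := modelDeriv_chartTo_comp_chartFrom hys
    have hb := modelDeriv_chartFrom_comp_chartTo hys
    rw [chartTo_chartFrom hy] at ha hb
    rw [hP, ContinuousLinearMap.inverse_eq hb ha, h1]; rfl
  have hd : DifferentiableAt ℝ (invField E G) (chartTo E (1 : G) 1) :=
    (contDiffAt_invField ht).differentiableAt (by simp)
  rw [h0, modelDeriv_chartTo_self]
  simp only [modelWithCornersSelf_coe, Set.range_id, Set.preimage_univ, Set.inter_univ,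
    VectorField.lieBracketWithin_univ, ContinuousLinearMap.inverse_id]
  rw [(key X).lieBracket_vectorField_eq (key Y), VectorField.lieBracket]
  rw [fderiv_clm_apply hd (by fun_prop), fderiv_clm_apply hd (by fun_prop)]
  simp [invField_one]

/-- The Maurer–Cartan equation. -/
theorem maurerCartan {n : ℕ∞ω} (hn : n ≤ ∞) (h2 : 2 ≤ n) {f : F → G} {x : F}
    (hf : ∀ᶠ y in 𝓝 x, ModelSmoothAt F E n f y) (u v : F) :
    fderiv ℝ (leftDeriv F E f) x u v - fderiv ℝ (leftDeriv F E f) x v u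
      = - lieBr E G (leftDeriv F E f x u) (leftDeriv F E f x v) := by
  -- Left translation leaves the logarithmic derivative unchanged.
  wlog h1 : f x = 1 generalizing f
  · have := this (f := fun y => (f x)⁻¹ * f y)
      (by filter_upwards [hf] with y hy using hy.const_mul hn _) (by simp)
    have h3 : leftDeriv F E (fun y => (f x)⁻¹ * f y) = leftDeriv F E f :=
      funext fun y => leftDeriv_const_mul f _ y
    rwa [h3] at this
  have h0 : n ≠ 0 := by rintro rfl; simp at h2
  have hs := mem_extChartAt_source (I := 𝓘(ℝ, E)) (1 : G)
  have ht := mem_extChartAt_target (I := 𝓘(ℝ, E)) (1 : G)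
  have hcf : ContinuousAt f x := hf.self_of_nhds.continuousAt
  have hsrc : ∀ᶠ y in 𝓝 x, f y ∈ (extChartAt 𝓘(ℝ, E) (1 : G)).source :=
    hcf.eventually (by rw [h1]; exact (isOpen_extChartAt_source (1 : G)).mem_nhds hs)
  -- In the chart, df = L(f)∘θ with L = `invField`. Differentiating once more and using the symmetry
  -- of the second derivative of f leaves dθ balanced by the derivative of L, which is the bracket.
  have hD : fderiv ℝ (fun y => chartTo E (1 : G) (f y)) =ᶠ[𝓝 x]
      fun y => (invField E G (chartTo E (1 : G) (f y))).comp (leftDeriv F E f y) := by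
    filter_upwards [hf, hsrc] with y hy hy' using
      fderiv_chartTo_comp (hy.mdifferentiableAt h0) hy'
  have hcd : ContDiffAt ℝ n (fun y => chartTo E (1 : G) (f y)) x := by
    rw [← contMDiffAt_iff_contDiffAt]
    exact ModelSmoothAt.compose (g := chartTo E (1 : G)) (f := f)
      ((smoothAt_chartTo hsrc.self_of_nhds).of_le hn) hf.self_of_nhds
  have hsymm := hcd.isSymmSndFDerivAt (by simpa using h2)
  have hω : DifferentiableAt ℝ (leftDeriv F E f) x :=
    (contDiffAt_leftDeriv (m := 1) hn (by simpa [one_add_one_eq_two] using h2) hf).differentiableAt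
      (by simp)
  have hL : DifferentiableAt ℝ (invField E G) (chartTo E (1 : G) (f x)) := by
    rw [h1]; exact (contDiffAt_invField ht).differentiableAt (by simp)
  have hc : DifferentiableAt ℝ (fun y => chartTo E (1 : G) (f y)) x :=
    hcd.differentiableAt h0
  have hLc : DifferentiableAt ℝ (fun y => invField E G (chartTo E (1 : G) (f y))) x :=
    DifferentiableAt.comp (g := invField E G) x hL hc
  have hA : ∀ a b, fderiv ℝ (fderiv ℝ (fun y => chartTo E (1 : G) (f y))) x a b
      = fderiv ℝ (leftDeriv F E f) x a b
        + fderiv ℝ (invField E G) (chartTo E (1 : G) 1) (leftDeriv F E f x a)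
          (leftDeriv F E f x b) := by
    intro a b
    have hc' := fderiv_chartTo_comp (hf.self_of_nhds.mdifferentiableAt h0) hsrc.self_of_nhds
    rw [hD.fderiv_eq, fderiv_clm_comp hLc hω,
      fderiv_fun_comp (g := invField E G) x hL hc, hc', h1, invField_one]
    simp
  have h3 := hsymm u v
  rw [hA, hA] at h3
  rw [lieBr_eq, sub_eq_iff_eq_add]
  rw [← sub_eq_zero] at h3 ⊢
  rw [← h3]
  abel

end MaurerCartan
end

noncomputable section

/-! ### One-parameter subgroups. -/

section OneParameter

variable {E : Type*} [NormedAddCommGroup E] [NormedSpace ℝ E]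
  {G : Type*} [TopologicalSpace G] [ChartedSpace E G] [Group G] [LieGroup 𝓘(ℝ, E) ∞ G]

theorem hasMFDerivAt_invariant_iff {γ : ℝ → G} {t : ℝ} {X : E} :
    HasMFDerivAt 𝓘(ℝ, ℝ) 𝓘(ℝ, E) γ t ((1 : ℝ →L[ℝ] ℝ).smulRight
      (mulInvariantVectorField (I := 𝓘(ℝ, E)) X (γ t)))
      ↔ ModelDiffAt ℝ E γ t ∧ leftDeriv ℝ E γ t 1 = X := by
  set A : E →L[ℝ] E := modelDeriv E E (fun h => γ t * h) (1 : G) with hA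
  constructor
  · intro h
    have hd : ModelDiffAt ℝ E γ t := h.mdifferentiableAt
    refine ⟨hd, ?_⟩
    have h1 : modelDeriv ℝ E γ t = (1 : ℝ →L[ℝ] ℝ).smulRight (A X) := h.mfderiv
    have h2 : modelDeriv E E (fun h : G => (γ t)⁻¹ * h) (γ t) (A X) = X := by
      have := modelDeriv_comp (p := (1 : G)) (g := fun h : G => (γ t)⁻¹ * h)
        (f := fun h : G => γ t * h) (modelDiffAt_mul_left (E := E) _ _)
        (modelDiffAt_mul_left (E := E) _ _)
      simp only [inv_mul_cancel_left, mul_one] at this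
      rw [modelDeriv_id] at this
      exact (DFunLike.congr_fun this X).symm
    rw [leftDeriv_eq_comp_modelDeriv hd, h1]
    simp [h2]
  · rintro ⟨hd, h⟩
    have h1 : modelDeriv ℝ E γ t = (1 : ℝ →L[ℝ] ℝ).smulRight (A X) := by
      ext
      rw [modelDeriv_eq_comp_leftDeriv hd]
      simp [h, hA]
    have h2 := hd.hasMFDerivAt
    have h3 : mfderiv 𝓘(ℝ, ℝ) 𝓘(ℝ, E) γ t = (1 : ℝ →L[ℝ] ℝ).smulRight (A X) := h1
    rw [h3] at h2
    exact h2

/-- In a chart the curve solves g' = `invField`(g) X with smooth right-hand side, so each order of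
smoothness of g yields the next. -/
theorem smoothAt_of_leftDeriv_eq {γ : ℝ → G} {X : E}
    (h : ∀ t, ModelDiffAt ℝ E γ t ∧ leftDeriv ℝ E γ t 1 = X) (t₀ : ℝ) :
    ModelSmoothAt ℝ E ∞ γ t₀ := by
  set f : ℝ → G := fun t => (γ t₀)⁻¹ * γ t with hf
  have hfd : ∀ t, ModelDiffAt ℝ E f t := fun t => (h t).1.const_mul _
  have hfl : ∀ t, leftDeriv ℝ E f t 1 = X := fun t => by
    rw [hf, leftDeriv_const_mul, (h t).2]
  have hfc : Continuous f := continuous_iff_continuousAt.2 fun t => (hfd t).continuousAt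
  have hU : IsOpen (f ⁻¹' (extChartAt 𝓘(ℝ, E) (1 : G)).source) :=
    (isOpen_extChartAt_source (1 : G)).preimage hfc
  have ht₀ : t₀ ∈ f ⁻¹' (extChartAt 𝓘(ℝ, E) (1 : G)).source := by simp [hf]
  set U := f ⁻¹' (extChartAt 𝓘(ℝ, E) (1 : G)).source with hUdef
  set g : ℝ → E := fun t => chartTo E (1 : G) (f t) with hg
  have hd : ∀ t ∈ U, DifferentiableAt ℝ g t := fun t ht =>
    (ModelDiffAt.compose (f := f) (diffAt_chartTo ht) (hfd t)).differentiableAt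
  have hderiv : ∀ t ∈ U, deriv g t = invField E G (g t) X := fun t ht => by
    rw [← fderiv_apply_one_eq_deriv, hg, fderiv_chartTo_comp (hfd t) ht]
    simp [hfl]
  have hn : ∀ n : ℕ, ContDiffOn ℝ n g U := by
    intro n
    induction n with
    | zero => exact contDiffOn_zero.2 fun t ht => (hd t ht).continuousAt.continuousWithinAt
    | succ n ih =>
      push_cast
      rw [contDiffOn_succ_iff_deriv_of_isOpen hU]
      refine ⟨fun t ht => (hd t ht).differentiableWithinAt, by simp, ?_⟩
      refine ContDiffOn.congr ?_ hderiv
      refine ContDiffOn.clm_apply ?_ contDiffOn_const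
      intro t ht
      have hi : ContDiffAt ℝ n (invField E G) (g t) :=
        (contDiffAt_invField ((extChartAt 𝓘(ℝ, E) (1 : G)).map_source ht)).of_le
          (by exact_mod_cast le_top)
      exact hi.comp_contDiffWithinAt t (ih t ht)
  have hgs : ContDiffAt ℝ ∞ g t₀ :=
    contDiffAt_infty.2 fun n => (hn n).contDiffAt (hU.mem_nhds ht₀)
  have h1 : ModelSmoothAt ℝ E ∞ (fun t => γ t₀ * chartFrom E (1 : G) (g t)) t₀ :=
    ModelSmoothAt.const_mul le_rfl _ (ModelSmoothAt.compose (f := g)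
      (smoothAt_chartFrom ((extChartAt 𝓘(ℝ, E) (1 : G)).map_source ht₀)) hgs.contMDiffAt)
  refine h1.congr_of_eventuallyEq ?_
  filter_upwards [hU.mem_nhds ht₀] with t ht
  rw [hg, chartFrom_chartTo ht, hf]
  simp

/-- One-parameter subgroups exist. -/
theorem exists_oneParameter [CompleteSpace E] [T2Space G] (X : E) :
    ∃ γ : ℝ → G, γ 0 = 1 ∧ (∀ t, ModelSmoothAt ℝ E ∞ γ t) ∧ ∀ t, leftDeriv ℝ E γ t 1 = X := by
  have h3 : LieGroup 𝓘(ℝ, E) (minSmoothness ℝ 3) G := by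
    simp only [minSmoothness_of_isRCLikeNormedField]
    exact LieGroup.of_le (n := ∞) (WithTop.coe_le_coe.2 (le_top : (3 : ℕ∞) ≤ ⊤))
  have hM : IsManifold 𝓘(ℝ, E) 1 G := IsManifold.of_le (n := ∞) (by simp)
  have hV := (contMDiff_mulInvariantVectorField (I := 𝓘(ℝ, E)) (G := G) X).of_le
    (show (1 : ℕ∞ω) ≤ minSmoothness ℝ 2 by
      simp only [minSmoothness_of_isRCLikeNormedField]; norm_num)
  obtain ⟨γ, h0, hγ⟩ := exists_isMIntegralCurveAt_of_contMDiffAt_boundaryless (t₀ := 0)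
    (hV.contMDiffAt (x := (1 : G)))
  obtain ⟨ε, hε, hγε⟩ := isMIntegralCurveAt_iff'.1 hγ
  have hball : Metric.ball (0 : ℝ) ε = Set.Ioo (-ε) ε := by rw [Real.ball_eq_Ioo]; simp
  rw [hball] at hγε
  -- Left translation moves one local integral curve to every starting point with the same ε. This
  -- uniform time makes the field complete.
  have hloc : ∀ g : G, ∃ β : ℝ → G, β 0 = g ∧ IsMIntegralCurveOn β
      (mulInvariantVectorField (I := 𝓘(ℝ, E)) X) (Set.Ioo (-ε) ε) := by
    intro g
    refine ⟨fun t => g * γ t, by simp [h0], fun t ht => ?_⟩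
    have h4 := (hγε t ht).hasMFDerivAt (isOpen_Ioo.mem_nhds ht)
    obtain ⟨hd, hl⟩ := hasMFDerivAt_invariant_iff.1 h4
    exact (hasMFDerivAt_invariant_iff (γ := fun t => g * γ t).2
      ⟨hd.const_mul g, by rw [leftDeriv_const_mul, hl]⟩).hasMFDerivWithinAt
  obtain ⟨β, hβ0, hβ⟩ := exists_isMIntegralCurve_of_isMIntegralCurveOn hV hε hloc 1
  have hall : ∀ t, ModelDiffAt ℝ E β t ∧ leftDeriv ℝ E β t 1 = X := fun t =>
    hasMFDerivAt_invariant_iff.1 (hβ t)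
  exact ⟨β, hβ0, smoothAt_of_leftDeriv_eq hall, fun t => (hall t).2⟩

end OneParameter
end

noncomputable section

/-! ### The two-dimensional model groups and their homomorphisms into G. -/

section AffineGroup

/-- The simply connected Lie group of dimension 2 whose Lie algebra has a basis with
`[X, Y] = l • Y`. -/
def AffPlane (_l : ℝ) : Type := E2

namespace AffPlane

variable (l : ℝ)

/-- Multiplication. -/
def mulMap (a b : E2) : E2 := !₂[a 0 + b 0, Real.exp (-(l * b 0)) * a 1 + b 1]

/-- Inversion. -/
def invMap (a : E2) : E2 := !₂[-a 0, -(Real.exp (l * a 0) * a 1)]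

@[simp] theorem mulMap_zero_apply (a b : E2) : mulMap l a b 0 = a 0 + b 0 := by simp [mulMap]

@[simp] theorem mulMap_one_apply (a b : E2) :
    mulMap l a b 1 = Real.exp (-(l * b 0)) * a 1 + b 1 := by simp [mulMap]

@[simp] theorem invMap_zero_apply (a : E2) : invMap l a 0 = -a 0 := by simp [invMap]

@[simp] theorem invMap_one_apply (a : E2) : invMap l a 1 = -(Real.exp (l * a 0) * a 1) := by
  simp [invMap]

theorem plane_ext {a b : E2} (h0 : a 0 = b 0) (h1 : a 1 = b 1) : a = b := by
  ext i; fin_cases i <;> assumption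

theorem mulMap_assoc (a b c : E2) : mulMap l (mulMap l a b) c = mulMap l a (mulMap l b c) := by
  refine plane_ext ?_ ?_
  · simp [add_assoc]
  · simp only [mulMap_one_apply, mulMap_zero_apply, mul_add, neg_add, Real.exp_add]
    ring

theorem zero_mulMap (a : E2) : mulMap l 0 a = a := plane_ext (by simp) (by simp)

theorem mulMap_zero (a : E2) : mulMap l a 0 = a := plane_ext (by simp) (by simp)

theorem invMap_mulMap (a : E2) : mulMap l (invMap l a) a = 0 := by
  refine plane_ext (by simp) ?_
  simp only [mulMap_one_apply, invMap_one_apply, PiLp.zero_apply]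
  rw [mul_neg, ← mul_assoc, ← Real.exp_add]
  simp

instance : TopologicalSpace (AffPlane l) := inferInstanceAs (TopologicalSpace E2)
instance : T2Space (AffPlane l) := inferInstanceAs (T2Space E2)
instance : SecondCountableTopology (AffPlane l) := inferInstanceAs (SecondCountableTopology E2)
instance : ConnectedSpace (AffPlane l) := inferInstanceAs (ConnectedSpace E2)
instance : ChartedSpace E2 (AffPlane l) := inferInstanceAs (ChartedSpace E2 E2)
instance : IsManifold 𝓘(ℝ, E2) ∞ (AffPlane l) := inferInstanceAs (IsManifold 𝓘(ℝ, E2) ∞ E2)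

instance : Group (AffPlane l) where
  mul := mulMap l
  one := (0 : E2)
  inv := invMap l
  mul_assoc := mulMap_assoc l
  one_mul := zero_mulMap l
  mul_one := mulMap_zero l
  inv_mul_cancel := invMap_mulMap l

theorem contDiff_mulMap : ContDiff ℝ ∞ (fun z : E2 × E2 => mulMap l z.1 z.2) := by
  rw [contDiff_euclidean]
  intro i
  fin_cases i
  · simp only [Fin.zero_eta, mulMap_zero_apply]; fun_prop
  · simp only [Fin.mk_one, mulMap_one_apply]; fun_prop

theorem contDiff_invMap : ContDiff ℝ ∞ (invMap l) := by
  rw [contDiff_euclidean]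
  intro i
  fin_cases i
  · simp only [Fin.zero_eta, invMap_zero_apply]; fun_prop
  · simp only [Fin.mk_one, invMap_one_apply]; fun_prop

instance : LieGroup 𝓘(ℝ, E2) ∞ (AffPlane l) where
  contMDiff_mul := by
    have h := (contDiff_mulMap l).contMDiff
    rw [modelWithCornersSelf_prod, ← chartedSpaceSelf_prod] at h
    exact h
  contMDiff_inv := (contDiff_invMap l).contMDiff

end AffPlane

end AffineGroup

section PlaneMap

variable {E : Type*} [NormedAddCommGroup E] [NormedSpace ℝ E]
  {G : Type*} [TopologicalSpace G] [ChartedSpace E G] [Group G]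

/-- A map of the plane into a Lie group whose logarithmic derivative is the left-invariant form of
`AffPlane l` with values `X`, `Y`. -/
structure IsPlaneMap (l : ℝ) (X Y : E) (Φ : E2 → G) : Prop where
  smooth : ∀ x, ModelSmoothAt E2 E ∞ Φ x
  map_zero : Φ 0 = 1
  leftDeriv_apply : ∀ x v, leftDeriv E2 E Φ x v = v 0 • X + (v 1 + l * x 1 * v 0) • Y

variable {l : ℝ} {X Y : E} {Φ : E2 → G}

theorem IsPlaneMap.diffAt (h : IsPlaneMap l X Y Φ) (x : E2) : ModelDiffAt E2 E Φ x :=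
  (h.smooth x).mdifferentiableAt (by simp)

variable [LieGroup 𝓘(ℝ, E) ∞ G]

/-- The coordinates of the plane. -/
abbrev coordCLM (i : Fin 2) : E2 →L[ℝ] ℝ := EuclideanSpace.proj i

theorem exists_isPlaneMap [CompleteSpace E] [T2Space G] (l : ℝ) (X Y : E)
    (h : lieBr E G X Y = l • Y) : ∃ Φ : E2 → G, IsPlaneMap l X Y Φ := by
  obtain ⟨γ, hγ0, hγs, hγ⟩ := exists_oneParameter (G := G) X
  obtain ⟨β, hβ0, hβs, hβ⟩ := exists_oneParameter (G := G) Y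
  have hcs : ∀ (i : Fin 2) (x : E2), ModelSmoothAt E2 ℝ ∞ (fun x : E2 => x i) x := fun i x =>
    ((coordCLM i).contDiff.contDiffAt (x := x)).contMDiffAt
  have hcd : ∀ (i : Fin 2) (x : E2), modelDeriv E2 ℝ (fun x : E2 => x i) x = coordCLM i :=
    fun i x => (modelDeriv_eq_fderiv _ _).trans (coordCLM i).fderiv
  have h1 : ∀ x : E2, ModelSmoothAt E2 E ∞ (fun x : E2 => γ (x 0)) x := fun x =>
    ModelSmoothAt.compose (f := fun x : E2 => x 0) (hγs _) (hcs 0 x)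
  have h2 : ∀ x : E2, ModelSmoothAt E2 E ∞ (fun x : E2 => β (x 1)) x := fun x =>
    ModelSmoothAt.compose (f := fun x : E2 => x 1) (hβs _) (hcs 1 x)
  have hne : (∞ : ℕ∞ω) ≠ 0 := by simp
  set Φ : E2 → G := fun x => γ (x 0) * β (x 1) with hΦ
  have hs : ∀ x, ModelSmoothAt E2 E ∞ Φ x := fun x => (h1 x).group_mul le_rfl (h2 x)
  have hl1 : ∀ x v, leftDeriv E2 E (fun x : E2 => γ (x 0)) x v = v 0 • X := fun x v => by
    have h3 := leftDeriv_comp (f := γ) (u := fun x : E2 => x 0) (x := x)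
      ((hγs _).mdifferentiableAt hne) ((hcs 0 x).mdifferentiableAt hne)
    rw [h3, hcd, ContinuousLinearMap.comp_apply, ← hγ (x 0), ← map_smul]
    simp
  have hl2 : ∀ x v, leftDeriv E2 E (fun x : E2 => β (x 1)) x v = v 1 • Y := fun x v => by
    have h3 := leftDeriv_comp (f := β) (u := fun x : E2 => x 1) (x := x)
      ((hβs _).mdifferentiableAt hne) ((hcs 1 x).mdifferentiableAt hne)
    rw [h3, hcd, ContinuousLinearMap.comp_apply, ← hβ (x 1), ← map_smul]
    simp
  have hl : ∀ x v, leftDeriv E2 E Φ x v = v 0 • adj E (β (x 1))⁻¹ X + v 1 • Y := fun x v => by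
    rw [hΦ, leftDeriv_mul ((h1 x).mdifferentiableAt hne) ((h2 x).mdifferentiableAt hne)]
    simp [hl1, hl2]
  set e0 : E2 := EuclideanSpace.single 0 1
  set e1 : E2 := EuclideanSpace.single 1 1
  have hω : ∀ x, DifferentiableAt ℝ (leftDeriv E2 E Φ) x := fun x =>
    (contDiffAt_leftDeriv (n := ∞) (m := ∞) le_rfl (by simp)
      (Filter.Eventually.of_forall hs)).differentiableAt hne
  have happ : ∀ x v w, fderiv ℝ (leftDeriv E2 E Φ) x w v
      = fderiv ℝ (fun x => leftDeriv E2 E Φ x v) x w := fun x v w => by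
    rw [fderiv_clm_apply (hω x) (by fun_prop)]
    simp
  -- Since θ(e1) is the constant Y, the Maurer–Cartan equation becomes an equation for θ(e0) alone
  -- along the second coordinate.
  have hmc : ∀ x, fderiv ℝ (fun x => leftDeriv E2 E Φ x e0) x e1
      = lieBr E G (leftDeriv E2 E Φ x e0) Y := fun x => by
    have h3 := maurerCartan (n := ∞) le_rfl (WithTop.coe_le_coe.2 (le_top : (2 : ℕ∞) ≤ ⊤))
      (Filter.Eventually.of_forall hs) (x := x) e0 e1
    rw [happ, happ] at h3
    have h4 : (fun x => leftDeriv E2 E Φ x e1) = fun _ => Y := by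
      funext x; simp [hl, e1]
    rw [h4] at h3
    simpa [hl, e1] using h3
  -- The curve a solves a' = [a, Y] with a(0) = X. The affine curve X + ltY solves it too, because
  -- [X,Y] = lY and [Y,Y] = 0.
  set a : ℝ → E := fun t => adj E (β t)⁻¹ X with ha
  have had : ∀ t, HasDerivAt a (lieBr E G (a t) Y) t := by
    intro t
    have h5 : a = fun t => leftDeriv E2 E Φ (t • e1) e0 := by
      funext t; simp [hl, ha, e0, e1]
    have h6 : HasDerivAt (fun t : ℝ => t • e1) e1 t := by
      simpa using (hasDerivAt_id t).smul_const e1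
    have h7 : DifferentiableAt ℝ (fun x => leftDeriv E2 E Φ x e0) (t • e1) :=
      (hω _).clm_apply (by fun_prop)
    have h8 := h7.hasFDerivAt.comp_hasDerivAt t h6
    rw [hmc] at h8
    rw [h5]
    exact h8
  obtain ⟨L, hL⟩ : ∃ L : E →L[ℝ] E, ∀ Z, lieBr E G Z Y = L Z := by
    refine ⟨(ContinuousLinearMap.apply ℝ E Y).comp (fderiv ℝ (invField E G) (chartTo E (1 : G) 1))
      - fderiv ℝ (invField E G) (chartTo E (1 : G) 1) Y, fun Z => ?_⟩
    rw [lieBr_eq]; simp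
  have hLY : L Y = 0 := by rw [← hL, lieBr_eq, sub_self]
  have hLX : L X = l • Y := by rw [← hL, h]
  have hb : ∀ t, HasDerivAt (fun t : ℝ => X + (l * t) • Y) (L (X + (l * t) • Y)) t := by
    intro t
    have h9 : HasDerivAt (fun t : ℝ => l * t) l t := by simpa using (hasDerivAt_id t).const_mul l
    have h10 := (h9.smul_const Y).const_add X
    simpa [hLX, hLY] using h10
  have haeq : a = fun t => X + (l * t) • Y := by
    refine ODE_solution_unique_univ (v := fun _ => L) (s := fun _ => Set.univ) (K := ‖L‖₊) (t₀ := 0)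
      (fun t => L.lipschitz.lipschitzOnWith) (fun t => ⟨?_, Set.mem_univ _⟩)
      (fun t => ⟨hb t, Set.mem_univ _⟩) ?_
    · rw [← hL]; exact had t
    · simp [ha, hβ0, adj_one]
  refine ⟨Φ, hs, by simp [hΦ, hγ0, hβ0], fun x v => ?_⟩
  have := congrFun haeq (x 1)
  simp only [ha] at this
  rw [hl, this]
  module

/-- The form described by `leftDeriv_apply` is left-invariant for `AffPlane.mulMap`, so b ↦ Φ(ab)
and Φ have the same logarithmic derivative and differ by a constant left factor. The exponential in
the group law is the adjoint action of the first one-parameter subgroup on Y. -/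
theorem IsPlaneMap.map_mul (h : IsPlaneMap l X Y Φ) (a b : E2) :
    Φ (AffPlane.mulMap l a b) = Φ a * Φ b := by
  have hm : ∀ b, HasFDerivAt (AffPlane.mulMap l a)
      (fderiv ℝ (AffPlane.mulMap l a) b) b := fun b =>
    (((AffPlane.contDiff_mulMap l).comp (contDiff_prodMk_right a)).differentiable
      (by simp) b).hasFDerivAt
  have h0 : ∀ b v, fderiv ℝ (AffPlane.mulMap l a) b v 0 = v 0 := fun b v => by
    have h1 : HasFDerivAt (fun b => AffPlane.mulMap l a b 0)
      ((coordCLM 0).comp (fderiv ℝ (AffPlane.mulMap l a) b)) b :=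
      (coordCLM 0).hasFDerivAt.comp b (hm b)
    have h2 : HasFDerivAt (fun b : E2 => AffPlane.mulMap l a b 0) (coordCLM 0) b := by
      simp only [AffPlane.mulMap_zero_apply]
      exact (coordCLM 0).hasFDerivAt.const_add _
    simpa using DFunLike.congr_fun (h1.unique h2) v
  have h1 : ∀ b v, fderiv ℝ (AffPlane.mulMap l a) b v 1
      = -(l * v 0) * Real.exp (-(l * b 0)) * a 1 + v 1 := fun b v => by
    have h1 : HasFDerivAt (fun b => AffPlane.mulMap l a b 1)
      ((coordCLM 1).comp (fderiv ℝ (AffPlane.mulMap l a) b)) b :=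
      (coordCLM 1).hasFDerivAt.comp b (hm b)
    have h2 : HasFDerivAt (fun b : E2 => AffPlane.mulMap l a b 1)
        ((a 1) • (Real.exp (-(l * b 0)) • -(l • coordCLM 0)) + coordCLM 1) b := by
      simp only [AffPlane.mulMap_one_apply]
      have h3 : HasFDerivAt (fun b : E2 => b 0) (coordCLM 0) b := (coordCLM 0).hasFDerivAt
      have h4 : HasFDerivAt (fun b : E2 => b 1) (coordCLM 1) b := (coordCLM 1).hasFDerivAt
      exact (((h3.const_mul l).neg.exp).mul_const (a 1)).add h4
    have := DFunLike.congr_fun (h1.unique h2) v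
    simp only [ContinuousLinearMap.comp_apply] at this
    simp at this
    rw [this]
    ring
  have hda : ∀ p, ModelDiffAt E2 E (fun b => Φ (AffPlane.mulMap l a b)) p := fun p =>
    ModelDiffAt.compose (f := AffPlane.mulMap l a) (h.diffAt _)
      (hm p).differentiableAt.mdifferentiableAt
  have := mul_inv_eq_of_leftDeriv_eq (F := E2) (E := E) (f := fun b => Φ (AffPlane.mulMap l a b))
    (g := Φ) isOpen_univ
    isPreconnected_univ (fun p _ => hda p) (fun p _ => h.diffAt p) (fun p _ => ?_)
    (Set.mem_univ b) (Set.mem_univ 0)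
  · simp only [AffPlane.mulMap_zero, h.map_zero, inv_one, mul_one] at this
    rw [← this, inv_mul_cancel_right]
  · rw [leftDeriv_comp (f := Φ) (u := AffPlane.mulMap l a) (h.diffAt _)
      (hm p).differentiableAt.mdifferentiableAt]
    ext v
    rw [modelDeriv_eq_fderiv, ContinuousLinearMap.comp_apply, h.leftDeriv_apply,
      h.leftDeriv_apply, h0, h1, AffPlane.mulMap_one_apply]
    congr 2
    ring

end PlaneMap
end

noncomputable section

/-! ### Flow boxes for the left-invariant plane field. -/

section LocalLeaf

variable {E : Type*} [NormedAddCommGroup E] [NormedSpace ℝ E]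
  {G : Type*} [TopologicalSpace G] [ChartedSpace E G] [Group G] [LieGroup 𝓘(ℝ, E) ∞ G]
  {l : ℝ} {X Y : E} {Φ : E2 → G}

omit [LieGroup 𝓘(ℝ, E) ∞ G] in
theorem IsPlaneMap.leftDeriv_mem (h : IsPlaneMap l X Y Φ) (x v : E2) :
    leftDeriv E2 E Φ x v ∈ Submodule.span ℝ {X, Y} := by
  rw [h.leftDeriv_apply, Submodule.mem_span_pair]
  exact ⟨_, _, rfl⟩

/-- Conjugation by Φ(a) carries Φ to Φ composed with conjugation by a in the plane group, so its
differential preserves the span of X and Y. -/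
theorem IsPlaneMap.adj_mem (h : IsPlaneMap l X Y Φ) (a : E2) {W : E}
    (hW : W ∈ Submodule.span ℝ {X, Y}) : adj E (Φ a) W ∈ Submodule.span ℝ {X, Y} := by
  obtain ⟨s, t, rfl⟩ := Submodule.mem_span_pair.1 hW
  set c : E2 → E2 := fun b => AffPlane.mulMap l (AffPlane.mulMap l a b) (AffPlane.invMap l a)
  have hc : DifferentiableAt ℝ c 0 := by
    have h1 : ContDiff ℝ ∞ c := (AffPlane.contDiff_mulMap l).comp
      (((AffPlane.contDiff_mulMap l).comp (contDiff_prodMk_right a)).prodMk contDiff_const)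
    exact h1.differentiable (by simp) 0
  have hinv : Φ (AffPlane.invMap l a) = (Φ a)⁻¹ := by
    rw [eq_inv_iff_mul_eq_one, ← h.map_mul, AffPlane.invMap_mulMap, h.map_zero]
  have h2 : (fun b => Φ (c b)) = fun b => Φ a * Φ b * (Φ a)⁻¹ := by
    funext b
    rw [h.map_mul, h.map_mul, hinv]
  have hg : ModelDiffAt E E (fun x : G => Φ a * x * (Φ a)⁻¹) (Φ 0) :=
    (modelDiffAt_mul_left _ _).mul_const _
  have h3 := modelDeriv_comp (g := fun x : G => Φ a * x * (Φ a)⁻¹) (f := Φ) (p := (0 : E2)) hg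
    (h.diffAt 0)
  have h4 : leftDeriv E2 E (fun b => Φ (c b)) 0 = (adj E (Φ a)).comp (leftDeriv E2 E Φ 0) := by
    rw [h2, leftDeriv_of_eq_one (by simp [h.map_zero]), h3, leftDeriv_of_eq_one h.map_zero,
      h.map_zero]
    rfl
  have h5 := leftDeriv_comp (f := Φ) (u := c) (x := 0) (h.diffAt _) hc.mdifferentiableAt
  have h6 : leftDeriv E2 E Φ 0 !₂[s, t] = s • X + t • Y := by
    rw [h.leftDeriv_apply]; simp
  rw [← h6, ← ContinuousLinearMap.comp_apply, ← h4, h5]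
  exact h.leftDeriv_mem _ _

theorem IsPlaneMap.inv_adj_mem (h : IsPlaneMap l X Y Φ) (a : E2) {Z : E}
    (hZ : adj E (Φ a)⁻¹ Z ∈ Submodule.span ℝ {X, Y}) : Z ∈ Submodule.span ℝ {X, Y} := by
  have := h.adj_mem a hZ
  rwa [adj_adj_inv] at this

/-- A frame of the tangent space adapted to a plane. -/
def frameMap (Z X Y : E) : ℝ × E2 →L[ℝ] E :=
  (ContinuousLinearMap.fst ℝ ℝ E2).smulRight Z
    + ((coordCLM 0).comp (ContinuousLinearMap.snd ℝ ℝ E2)).smulRight X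
    + ((coordCLM 1).comp (ContinuousLinearMap.snd ℝ ℝ E2)).smulRight Y

theorem frameMap_apply (Z X Y : E) (w : ℝ × E2) :
    frameMap Z X Y w = w.1 • Z + w.2 0 • X + w.2 1 • Y := by
  simp [frameMap]

theorem not_mem_span_of_bijective {Z : E} (hB : Function.Bijective (frameMap Z X Y)) :
    Z ∉ Submodule.span ℝ {X, Y} := by
  intro hZ
  obtain ⟨s, t, hst⟩ := Submodule.mem_span_pair.1 hZ
  have := @hB.1 (1, 0) (0, !₂[s, t]) (by simp [frameMap_apply, hst])
  simpa using congrArg Prod.fst this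

/-- Flow-box coordinates adapted to the left cosets of a plane map. -/
theorem IsPlaneMap.exists_flowBox [CompleteSpace E] [T2Space G] (h : IsPlaneMap l X Y Φ) {Z : E}
    (hB : Function.Bijective (frameMap Z X Y)) :
    ∃ (Θ : ℝ × E2 → G) (P : OpenPartialHomeomorph (ℝ × E2) E),
      (∀ z, ModelSmoothAt (ℝ × E2) E ∞ Θ z) ∧ (∀ x, Θ (0, x) = Φ x) ∧
      (∀ z w, leftDeriv (ℝ × E2) E Θ z w
        = w.1 • adj E (Φ z.2)⁻¹ Z + leftDeriv E2 E Φ z.2 w.2) ∧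
      (∀ z, P z = chartTo E (1 : G) (Θ z)) ∧ (0 : ℝ × E2) ∈ P.source ∧
      ContDiffAt ℝ ∞ P.symm (chartTo E (1 : G) 1) := by
  obtain ⟨γ, hγ0, hγs, hγ⟩ := exists_oneParameter (G := G) Z
  have hne : (∞ : ℕ∞ω) ≠ 0 := by simp
  have hf1 : ∀ z : ℝ × E2, ModelSmoothAt (ℝ × E2) ℝ ∞ (fun z : ℝ × E2 => z.1) z := fun z =>
    contDiffAt_fst.contMDiffAt
  have hf2 : ∀ z : ℝ × E2, ModelSmoothAt (ℝ × E2) E2 ∞ (fun z : ℝ × E2 => z.2) z := fun z =>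
    contDiffAt_snd.contMDiffAt
  have h1 : ∀ z : ℝ × E2, ModelSmoothAt (ℝ × E2) E ∞ (fun z : ℝ × E2 => γ z.1) z := fun z =>
    ModelSmoothAt.compose (f := fun z : ℝ × E2 => z.1) (hγs _) (hf1 z)
  have h2 : ∀ z : ℝ × E2, ModelSmoothAt (ℝ × E2) E ∞ (fun z : ℝ × E2 => Φ z.2) z := fun z =>
    ModelSmoothAt.compose (f := fun z : ℝ × E2 => z.2) (h.smooth _) (hf2 z)
  -- For fixed first coordinate, Θ runs through a left coset of the image of Φ; the curve γ is
  -- transverse to these cosets at the identity.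
  set Θ : ℝ × E2 → G := fun z => γ z.1 * Φ z.2 with hΘ
  have hs : ∀ z, ModelSmoothAt (ℝ × E2) E ∞ Θ z := fun z => (h1 z).group_mul le_rfl (h2 z)
  have hl : ∀ z w, leftDeriv (ℝ × E2) E Θ z w
      = w.1 • adj E (Φ z.2)⁻¹ Z + leftDeriv E2 E Φ z.2 w.2 := by
    intro z w
    have h3 := leftDeriv_comp (f := γ) (u := fun z : ℝ × E2 => z.1) (x := z)
      ((hγs _).mdifferentiableAt hne) ((hf1 z).mdifferentiableAt hne)
    have h4 := leftDeriv_comp (f := Φ) (u := fun z : ℝ × E2 => z.2) (x := z)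
      (h.diffAt _) ((hf2 z).mdifferentiableAt hne)
    have h5 : modelDeriv (ℝ × E2) ℝ (fun z : ℝ × E2 => z.1) z = ContinuousLinearMap.fst ℝ ℝ E2 :=
      (modelDeriv_eq_fderiv _ _).trans fderiv_fst
    have h6 : modelDeriv (ℝ × E2) E2 (fun z : ℝ × E2 => z.2) z = ContinuousLinearMap.snd ℝ ℝ E2 :=
      (modelDeriv_eq_fderiv _ _).trans fderiv_snd
    have h7 : leftDeriv ℝ E γ z.1 w.1 = w.1 • Z := by
      rw [← hγ z.1, ← map_smul]; simp
    rw [hΘ, leftDeriv_mul ((h1 z).mdifferentiableAt hne) ((h2 z).mdifferentiableAt hne), h3, h4,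
      h5, h6]
    simp [h7]
  have hΘ0 : Θ 0 = 1 := by simp [hΘ, hγ0, h.map_zero]
  have hss : Θ 0 ∈ (extChartAt 𝓘(ℝ, E) (1 : G)).source := by
    rw [hΘ0]; exact mem_extChartAt_source _
  have hg : ContDiffAt ℝ ∞ (fun z => chartTo E (1 : G) (Θ z)) 0 := by
    rw [← contMDiffAt_iff_contDiffAt]
    exact ModelSmoothAt.compose (g := chartTo E (1 : G)) (f := Θ) (smoothAt_chartTo hss) (hs 0)
  have hg' : fderiv ℝ (fun z => chartTo E (1 : G) (Θ z)) 0 = frameMap Z X Y := by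
    rw [fderiv_chartTo_comp ((hs 0).mdifferentiableAt hne) hss, hΘ0, invField_one]
    refine ContinuousLinearMap.ext fun w => ?_
    rw [ContinuousLinearMap.comp_apply, hl, h.leftDeriv_apply, frameMap_apply]
    simp [h.map_zero, adj_one, add_assoc]
  obtain ⟨T, hT⟩ : ∃ T : (ℝ × E2) ≃L[ℝ] E, (T : ℝ × E2 →L[ℝ] E) = frameMap Z X Y :=
    ⟨ContinuousLinearEquiv.ofBijective (frameMap Z X Y) (LinearMap.ker_eq_bot.2 hB.1)
      (LinearMap.range_eq_top.2 hB.2), ContinuousLinearEquiv.coe_ofBijective _ _ _⟩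
  have hfd : HasFDerivAt (fun z => chartTo E (1 : G) (Θ z)) (T : ℝ × E2 →L[ℝ] E) 0 := by
    rw [hT, ← hg']; exact (hg.differentiableAt hne).hasFDerivAt
  refine ⟨Θ, hg.toOpenPartialHomeomorph _ hfd hne, hs, fun x => by simp [hΘ, hγ0], hl,
    fun z => rfl, hg.mem_toOpenPartialHomeomorph_source hfd hne, ?_⟩
  have := hg.to_localInverse hfd hne
  rw [hΘ0] at this
  exact this

/-- The slice of a flow box at transverse coordinate zero is Φ. This local injectivity makes the
kernel of Φ discrete. -/
theorem IsPlaneMap.injOn_nhds [CompleteSpace E] [T2Space G] (h : IsPlaneMap l X Y Φ) {Z : E}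
    (hB : Function.Bijective (frameMap Z X Y)) : ∃ V ∈ 𝓝 (0 : E2), Set.InjOn Φ V := by
  obtain ⟨Θ, P, -, hΘ, -, hP, h0, -⟩ := h.exists_flowBox hB
  refine ⟨(fun x => ((0 : ℝ), x)) ⁻¹' P.source, ?_, ?_⟩
  · exact (Continuous.prodMk_right (0 : ℝ)).continuousAt (P.open_source.mem_nhds h0)
  · intro x hx y hy hxy
    have := P.injOn hx hy (by rw [hP, hP, hΘ, hΘ, hxy])
    exact congrArg Prod.snd this

variable {F : Type*} [NormedAddCommGroup F] [NormedSpace ℝ F]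
  {M : Type*} [TopologicalSpace M] [ChartedSpace F M] [IsManifold 𝓘(ℝ, F) ∞ M]

/-- A map tangent to the left-invariant plane field locally factors through the plane map. -/
theorem IsPlaneMap.exists_local_lift [CompleteSpace E] [T2Space G] (h : IsPlaneMap l X Y Φ) {Z : E}
    (hB : Function.Bijective (frameMap Z X Y)) {φ : M → G}
    (hφ : ∀ p, ModelSmoothAt F E ∞ φ p)
    (hspan : ∀ p v, leftDeriv F E φ p v ∈ Submodule.span ℝ {X, Y}) (p : M) :
    ∃ x : M → E2, ModelSmoothAt F E2 ∞ x p ∧ x p = 0 ∧ ∀ᶠ q in 𝓝 p, φ q = φ p * Φ (x q) := by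
  obtain ⟨Θ, P, hΘs, hΘ0, hΘl, hP, h0, hPs⟩ := h.exists_flowBox hB
  have hne : (∞ : ℕ∞ω) ≠ 0 := by simp
  have hP0 : P 0 = chartTo E (1 : G) 1 := by
    rw [hP, show (0 : ℝ × E2) = (0, 0) from rfl, hΘ0, h.map_zero]
  have hPs0 : P.symm (chartTo E (1 : G) 1) = 0 := by rw [← hP0, P.left_inv h0]
  set u : M → G := fun q => (φ p)⁻¹ * φ q with hu
  have hup : u p = 1 := by simp [hu]
  have hus : ∀ q, ModelSmoothAt F E ∞ u q := fun q => (hφ q).const_mul le_rfl _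
  have huc : Continuous u := continuous_iff_continuousAt.2 fun q => (hus q).continuousAt
  set s : M → ℝ × E2 := fun q => P.symm (chartTo E (1 : G) (u q)) with hsdef
  have hcu : ModelSmoothAt F E ∞ (fun q => chartTo E (1 : G) (u q)) p :=
    ModelSmoothAt.compose (g := chartTo E (1 : G)) (f := u)
      (smoothAt_chartTo (by rw [hup]; exact mem_extChartAt_source _)) (hus p)
  have hss : ModelSmoothAt F (ℝ × E2) ∞ s p :=
    ModelSmoothAt.compose (g := P.symm) (f := fun q => chartTo E (1 : G) (u q))
      (by rw [hup]; exact hPs.contMDiffAt) hcu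
  have hsp : s p = 0 := by simp only [hsdef, hup, hPs0]
  have hΘc : Continuous Θ := continuous_iff_continuousAt.2 fun q => (hΘs q).continuousAt
  have hev1 : ∀ᶠ q in 𝓝 p, u q ∈ (extChartAt 𝓘(ℝ, E) (1 : G)).source :=
    huc.continuousAt.eventually (by
      rw [hup]; exact (isOpen_extChartAt_source (1 : G)).mem_nhds (mem_extChartAt_source _))
  have hev2 : ∀ᶠ q in 𝓝 p, chartTo E (1 : G) (u q) ∈ P.target :=
    hcu.continuousAt.eventually (by
      change ∀ᶠ y in 𝓝 (chartTo E (1 : G) (u p)), _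
      rw [hup, ← hP0]; exact P.open_target.mem_nhds (P.map_source h0))
  have hev3 : ∀ᶠ q in 𝓝 p, Θ (s q) ∈ (extChartAt 𝓘(ℝ, E) (1 : G)).source :=
    (hΘc.continuousAt.comp hss.continuousAt).eventually (by
      rw [Function.comp_apply, hsp, show (0 : ℝ × E2) = (0, 0) from rfl, hΘ0, h.map_zero]
      exact (isOpen_extChartAt_source (1 : G)).mem_nhds (mem_extChartAt_source _))
  have hev4 : ∀ᶠ q in 𝓝 p, ModelDiffAt F (ℝ × E2) s q := by
    have hM : IsManifold 𝓘(ℝ, F) 1 M := IsManifold.of_le (n := ∞) (by simp)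
    have h5 : ModelSmoothAt F (ℝ × E2) 1 s p := hss.of_le (by simp)
    filter_upwards [(contMDiffAt_iff_contMDiffAt_nhds (by simp)).1 h5] with q hq using
      hq.mdifferentiableAt (by simp)
  have hev : ∀ᶠ q in 𝓝 p, Θ (s q) = u q := by
    filter_upwards [hev1, hev2, hev3] with q h1 h2 h3
    refine (extChartAt 𝓘(ℝ, E) (1 : G)).injOn h3 h1 ?_
    have := P.right_inv h2
    rwa [hP] at this
  obtain ⟨U, hU, hUo, hpU⟩ := eventually_nhds_iff.1 (hev.and hev4)
  have hd1 : ∀ q ∈ U, ModelDiffAt F ℝ (fun q => (s q).1) q := fun q hq =>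
    ModelDiffAt.compose (g := fun z : ℝ × E2 => z.1) (f := s)
      differentiableAt_fst.mdifferentiableAt (hU q hq).2
  -- The logarithmic derivative of Θ∘s is the differential of the transverse coordinate times
  -- Ad(Φ)⁻¹Z, plus a vector of the plane. It lies in the plane by `hspan`, whereas Ad(Φ)⁻¹Z does
  -- not.
  have hd0 : ∀ q ∈ U, modelDeriv F ℝ (fun q => (s q).1) q = 0 := by
    intro q hq
    have hsq := (hU q hq).2
    have h1 : modelDeriv F ℝ (fun q => (s q).1) q
        = (ContinuousLinearMap.fst ℝ ℝ E2).comp (modelDeriv F (ℝ × E2) s q) := by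
      rw [modelDeriv_comp (g := fun z : ℝ × E2 => z.1) (f := s)
        differentiableAt_fst.mdifferentiableAt hsq, modelDeriv_eq_fderiv, fderiv_fst]
    have h2 : leftDeriv F E u q = leftDeriv F E φ q := leftDeriv_const_mul _ _ _
    have h3 : leftDeriv F E u q = leftDeriv F E (fun q => Θ (s q)) q := by
      have he : (fun y => Θ (s y)) =ᶠ[𝓝 q] u := by
        filter_upwards [hUo.mem_nhds hq] with y hy using (hU y hy).1
      exact (leftDeriv_congr he).symm
    have h4 := leftDeriv_comp (f := Θ) (u := s) (x := q) ((hΘs _).mdifferentiableAt hne) hsq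
    ext v
    rw [h1]
    by_contra hv
    have h5 := hspan q v
    rw [← h2, h3, h4, ContinuousLinearMap.comp_apply, hΘl] at h5
    have h6 := (Submodule.add_mem_iff_left _ (h.leftDeriv_mem _ _)).1 h5
    have h7 := (Submodule.smul_mem_iff _ (by simpa using hv)).1 h6
    exact not_mem_span_of_bijective hB (h.inv_adj_mem _ h7)
  have hz := eventually_eq_of_modelDeriv_eq_zero (F' := ℝ) hUo hd1 hd0 hpU
  refine ⟨fun q => (s q).2, ModelSmoothAt.compose (g := fun z : ℝ × E2 => z.2) (f := s)
    contDiffAt_snd.contMDiffAt hss, by simp [hsp], ?_⟩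
  filter_upwards [hz, hUo.mem_nhds hpU] with q hq hqU
  have h8 : s q = (0, (s q).2) := Prod.ext (by rw [hq, hsp]; rfl) rfl
  have h9 := (hU q hqU).1
  rw [h8, hΘ0] at h9
  rw [h9, hu]
  simp

end LocalLeaf
end

noncomputable section

/-! ### The quotient of a Lie group by a discrete subgroup. -/

namespace DiscreteCoset

variable {F : Type*} [NormedAddCommGroup F] [NormedSpace ℝ F]
  {P : Type*} [TopologicalSpace P] [ChartedSpace F P] [Group P] [LieGroup 𝓘(ℝ, F) ∞ P]
  (N : Subgroup P) [DiscreteTopology N]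

/-- The quotient map. -/
abbrev proj (z : P) : P ⧸ N := QuotientGroup.mk z

section Topological

variable [IsTopologicalGroup P]

omit [ChartedSpace F P] [LieGroup 𝓘(ℝ, F) ∞ P] in
omit [IsTopologicalGroup P] in
theorem exists_open_inter_eq_one : ∃ V ∈ 𝓝 (1 : P), ∀ x ∈ V, x ∈ N → x = 1 := by
  have h : IsOpen ({1} : Set N) := isOpen_discrete _
  obtain ⟨V, hV, hV1⟩ := isOpen_induced_iff.1 h
  have h1 : (1 : N) ∈ Subtype.val ⁻¹' V := by rw [hV1]; rfl
  refine ⟨V, hV.mem_nhds h1, fun x hx hxN => ?_⟩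
  have : (⟨x, hxN⟩ : N) ∈ Subtype.val ⁻¹' V := hx
  rw [hV1] at this
  exact congrArg Subtype.val this

-- Points a and b of a small enough W with the same image have a⁻¹b in N and near 1, hence a = b.
-- The quotient map is thus injective on W as well as open.
omit [ChartedSpace F P] [LieGroup 𝓘(ℝ, F) ∞ P] in
theorem isLocalHomeomorph_proj : IsLocalHomeomorph (proj N) := by
  rw [isLocalHomeomorph_iff_isOpenEmbedding_restrict]
  intro z
  obtain ⟨V, hV, hN⟩ := exists_open_inter_eq_one N
  have hc : Filter.Tendsto (fun w : P × P => w.1⁻¹ * w.2) (𝓝 (z, z)) (𝓝 1) := by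
    have : Continuous (fun w : P × P => w.1⁻¹ * w.2) := by fun_prop
    simpa using this.tendsto (z, z)
  have h2 := hc hV
  rw [Filter.mem_map, nhds_prod_eq, Filter.mem_prod_same_iff] at h2
  obtain ⟨U, hU, hUV⟩ := h2
  obtain ⟨W, hWU, hW, hzW⟩ := mem_nhds_iff.1 hU
  refine ⟨W, hW.mem_nhds hzW, ?_⟩
  refine .of_continuous_injective_isOpenMap (QuotientGroup.continuous_mk.comp
    continuous_subtype_val) ?_ (QuotientGroup.isOpenMap_coe.domRestrict hW)
  intro a b hab
  have h3 : (a : P)⁻¹ * b ∈ N := QuotientGroup.eq.1 hab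
  have h4 := hN _ (hUV (Set.mk_mem_prod (hWU a.2) (hWU b.2))) h3
  exact Subtype.ext (inv_mul_eq_one.1 h4)

omit [ChartedSpace F P] [LieGroup 𝓘(ℝ, F) ∞ P] in
/-- Two continuous lifts differ locally by a constant. -/
theorem eventually_eq_mul_const {A : Type*} [TopologicalSpace A] {s t : A → P} {a : A}
    (hs : ContinuousAt s a) (ht : ContinuousAt t a) (h : ∀ᶠ b in 𝓝 a, proj N (s b) = proj N (t b)) :
    ∃ n : P, ∀ᶠ b in 𝓝 a, t b = s b * n := by
  obtain ⟨V, hV, hN⟩ := exists_open_inter_eq_one N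
  refine ⟨(s a)⁻¹ * t a, ?_⟩
  have hc : Filter.Tendsto (fun b => ((s a)⁻¹ * t a)⁻¹ * ((s b)⁻¹ * t b)) (𝓝 a) (𝓝 1) := by
    have h1 : ContinuousAt (fun b => ((s a)⁻¹ * t a)⁻¹ * ((s b)⁻¹ * t b)) a :=
      continuousAt_const.mul (hs.inv.mul ht)
    have h2 := h1.tendsto
    rwa [inv_mul_cancel] at h2
  have h0 := QuotientGroup.eq.1 h.self_of_nhds
  filter_upwards [hc hV, h] with b hb hb'
  have h1 := hN _ hb (N.mul_mem (N.inv_mem h0) (QuotientGroup.eq.1 hb'))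
  rw [inv_mul_eq_one] at h1
  rw [h1, mul_inv_cancel_left]

end Topological

theorem isTopologicalGroup (F : Type*) [NormedAddCommGroup F] [NormedSpace ℝ F]
    (P : Type*) [TopologicalSpace P] [ChartedSpace F P] [Group P] [LieGroup 𝓘(ℝ, F) ∞ P] :
    IsTopologicalGroup P := topologicalGroup_of_lieGroup 𝓘(ℝ, F) ∞

variable (F) in
/-- The manifold structure on the quotient by a discrete subgroup. -/
@[reducible] def chartedSpace : ChartedSpace F (P ⧸ N) :=
  have := isTopologicalGroup F P
  (isLocalHomeomorph_proj N).chartedSpace QuotientGroup.mk_surjective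

attribute [local instance] chartedSpace

variable [IsTopologicalGroup P]

omit [IsTopologicalGroup P] in
theorem exists_section_of_mem_atlas {e : OpenPartialHomeomorph (P ⧸ N) F}
    (he : e ∈ atlas F (P ⧸ N)) : ∃ (s : OpenPartialHomeomorph (P ⧸ N) P) (z : P),
      (∀ q ∈ s.source, proj N (s q) = q) ∧ (∀ y, s.symm y = proj N y) ∧
      e = s.trans (chartAt F z) := by
  have := isTopologicalGroup F P
  obtain ⟨q, rfl⟩ : ∃ q : P ⧸ N, ((isLocalHomeomorph_proj N).localInverseAt
    (QuotientGroup.mk_surjective.hasRightInverse.choose q)).trans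
    (chartAt F (QuotientGroup.mk_surjective.hasRightInverse.choose q)) = e := he
  refine ⟨_, _, fun q hq => ?_, fun y => ?_, rfl⟩
  · exact IsLocalHomeomorph.apply_localInverseAt_of_mem _ hq
  · rw [IsLocalHomeomorph.localInverseAt_symm]

/-- A section followed back along the projection is a continuous lift of it, so it is locally right
translation by a fixed element, which is smooth. -/
theorem contMDiffAt_section_proj (s : OpenPartialHomeomorph (P ⧸ N) P)
    (hs : ∀ q ∈ s.source, proj N (s q) = q) {z : P} (hz : proj N z ∈ s.source) :
    ModelSmoothAt F F ∞ (fun y => s (proj N y)) z := by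
  have hc : ContinuousAt (fun y => s (proj N y)) z :=
    ContinuousAt.comp (f := proj N) (g := s) (s.continuousAt hz) QuotientGroup.continuous_mk.continuousAt
  have hev : ∀ᶠ y in 𝓝 z, proj N y ∈ s.source :=
    QuotientGroup.continuous_mk.continuousAt.eventually (s.open_source.mem_nhds hz)
  obtain ⟨n, hn⟩ := eventually_eq_mul_const N continuousAt_id hc
    (by filter_upwards [hev] with y hy; exact (hs _ hy).symm)
  have h1 : ModelSmoothAt F F ∞ (fun y : P => y * n) z :=
    (contMDiff_mul_right (I := 𝓘(ℝ, F)) (n := ∞) (a := n)).contMDiffAt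
  exact h1.congr_of_eventuallyEq hn

/-- Transition maps are right translations by elements of N, read in charts of the covering group.
-/
theorem isManifold : IsManifold 𝓘(ℝ, F) ∞ (P ⧸ N) := by
  refine isManifold_of_contDiffOn _ _ _ fun e e' he he' => ?_
  obtain ⟨s, z, hs, hs', rfl⟩ := exists_section_of_mem_atlas N he
  obtain ⟨t, w, ht, ht', rfl⟩ := exists_section_of_mem_atlas N he'
  intro y hy
  simp only [modelWithCornersSelf_coe, modelWithCornersSelf_coe_symm, Set.range_id, Set.preimage_id,
    Set.inter_univ, Function.comp_id, Function.id_comp] at hy ⊢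
  refine ContDiffAt.contDiffWithinAt ?_
  simp only [OpenPartialHomeomorph.trans_source, OpenPartialHomeomorph.symm_source,
    Set.mem_inter_iff, Set.mem_preimage,
    OpenPartialHomeomorph.trans_symm_eq_symm_trans_symm,
    OpenPartialHomeomorph.coe_trans, Function.comp_apply, hs'] at hy
  rw [← contMDiffAt_iff_contDiffAt]
  have h1 : ModelSmoothAt F F ∞ (chartAt F z).symm y :=
    (contMDiffOn_chart_symm (I := 𝓘(ℝ, F)) (n := ∞)).contMDiffAt
      ((chartAt F z).open_target.mem_nhds hy.1.1)
  have h2 := contMDiffAt_section_proj (F := F) N t ht hy.2.1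
  have h3 : ModelSmoothAt F F ∞ (chartAt F w) (t (proj N ((chartAt F z).symm y))) :=
    (contMDiffOn_chart (I := 𝓘(ℝ, F)) (n := ∞)).contMDiffAt
      ((chartAt F w).open_source.mem_nhds hy.2.2)
  have h4 := ModelSmoothAt.compose (g := chartAt F w)
    (f := fun y => t (proj N ((chartAt F z).symm y))) h3
    (ModelSmoothAt.compose (g := fun y => t (proj N y)) (f := (chartAt F z).symm) h2 h1)
  refine h4.congr_of_eventuallyEq (Filter.Eventually.of_forall fun x => ?_)
  simp [hs']

attribute [local instance] isManifold

theorem contMDiffAt_proj (z : P) : ModelSmoothAt F F ∞ (proj N) z := by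
  refine contMDiffAt_iff_target.2 ⟨QuotientGroup.continuous_mk.continuousAt, ?_⟩
  obtain ⟨s, w, hs, hs', he⟩ := exists_section_of_mem_atlas N
    (chart_mem_atlas F (proj N z))
  have hm := mem_chart_source F (proj N z)
  rw [he] at hm
  simp only [OpenPartialHomeomorph.trans_source, Set.mem_inter_iff, Set.mem_preimage] at hm
  have h3 : ModelSmoothAt F F ∞ (chartAt F w) (s (proj N z)) :=
    (contMDiffOn_chart (I := 𝓘(ℝ, F)) (n := ∞)).contMDiffAt
      ((chartAt F w).open_source.mem_nhds hm.2)
  have h4 := ModelSmoothAt.compose (g := chartAt F w) (f := fun y => s (proj N y)) h3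
    (contMDiffAt_section_proj (F := F) N s hs hm.1)
  refine h4.congr_of_eventuallyEq (Filter.Eventually.of_forall fun x => ?_)
  simp [extChartAt, he]

omit [IsTopologicalGroup P] in
theorem exists_smooth_section (q : P ⧸ N) : ∃ σ : P ⧸ N → P,
    ModelSmoothAt F F ∞ σ q ∧ ∀ᶠ q' in 𝓝 q, proj N (σ q') = q' := by
  obtain ⟨s, w, hs, hs', he⟩ := exists_section_of_mem_atlas N (chart_mem_atlas F q)
  have hm := mem_chart_source F q
  rw [he] at hm
  simp only [OpenPartialHomeomorph.trans_source, Set.mem_inter_iff, Set.mem_preimage] at hm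
  refine ⟨s, ?_, by filter_upwards [s.open_source.mem_nhds hm.1] with q' hq' using hs _ hq'⟩
  have h1 : ModelSmoothAt F F ∞ (chartAt F q) q := contMDiffAt_extChartAt
  have h2 : ModelSmoothAt F F ∞ (chartAt F w).symm (chartAt F q q) := by
    refine (contMDiffOn_chart_symm (I := 𝓘(ℝ, F)) (n := ∞)).contMDiffAt
      ((chartAt F w).open_target.mem_nhds ?_)
    rw [he]
    exact (chartAt F w).map_source hm.2
  have h3 := ModelSmoothAt.compose (g := (chartAt F w).symm) (f := chartAt F q) h2 h1
  refine h3.congr_of_eventuallyEq ?_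
  filter_upwards [s.open_source.mem_nhds hm.1, s.continuousAt hm.1
    ((chartAt F w).open_source.mem_nhds hm.2)] with q' hq' hq''
  rw [he]
  exact ((chartAt F w).left_inv hq'').symm

theorem lieGroup [N.Normal] : LieGroup 𝓘(ℝ, F) ∞ (P ⧸ N) where
  contMDiff_mul := by
    rintro ⟨a, b⟩
    obtain ⟨σ, hσ, hσ'⟩ := exists_smooth_section (F := F) N a
    obtain ⟨τ, hτ, hτ'⟩ := exists_smooth_section (F := F) N b
    have h1 : ContMDiffAt (𝓘(ℝ, F).prod 𝓘(ℝ, F)) 𝓘(ℝ, F) ∞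
        (fun z : (P ⧸ N) × (P ⧸ N) => proj N (σ z.1 * τ z.2)) (a, b) := by
      refine ContMDiffAt.comp (I' := 𝓘(ℝ, F)) (g := proj N)
        (f := fun z : (P ⧸ N) × (P ⧸ N) => σ z.1 * τ z.2) (a, b) (contMDiffAt_proj N _) ?_
      exact ContMDiffAt.mul (I := 𝓘(ℝ, F))
        (ContMDiffAt.comp (I' := 𝓘(ℝ, F)) (g := σ) (a, b) hσ contMDiffAt_fst)
        (ContMDiffAt.comp (I' := 𝓘(ℝ, F)) (g := τ) (a, b) hτ contMDiffAt_snd)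
    refine h1.congr_of_eventuallyEq ?_
    filter_upwards [continuousAt_fst.eventually hσ', continuousAt_snd.eventually hτ'] with z h2 h3
    rw [proj, QuotientGroup.mk_mul]
    exact congrArg₂ _ h2.symm h3.symm
  contMDiff_inv := by
    intro a
    obtain ⟨σ, hσ, hσ'⟩ := exists_smooth_section (F := F) N a
    have h1 : ModelSmoothAt F F ∞ (fun z => proj N (σ z)⁻¹) a :=
      ModelSmoothAt.compose (g := proj N) (f := fun z => (σ z)⁻¹) (contMDiffAt_proj N _)
        (hσ.group_inv le_rfl)
    refine h1.congr_of_eventuallyEq ?_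
    filter_upwards [hσ'] with z h2
    rw [proj, QuotientGroup.mk_inv]
    exact congrArg _ h2.symm

end DiscreteCoset
end

noncomputable section

/-! ### The inverse function theorem on manifolds. -/

section InverseFunction

variable {F : Type*} [NormedAddCommGroup F] [NormedSpace ℝ F] [FiniteDimensional ℝ F]
  {M : Type*} [TopologicalSpace M] [ChartedSpace F M] [IsManifold 𝓘(ℝ, F) ∞ M]
  {M' : Type*} [TopologicalSpace M'] [ChartedSpace F M'] [IsManifold 𝓘(ℝ, F) ∞ M']

theorem exists_equiv_of_injective {A : F →L[ℝ] F} (hA : Function.Injective A) :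
    ∃ T : F ≃L[ℝ] F, (T : F →L[ℝ] F) = A := by
  have hs : Function.Surjective A := LinearMap.injective_iff_surjective (f := A.toLinearMap).1 hA
  have : CompleteSpace F := FiniteDimensional.complete ℝ F
  exact ⟨ContinuousLinearEquiv.ofBijective A (LinearMap.ker_eq_bot.2 hA)
      (LinearMap.range_eq_top.2 hs), ContinuousLinearEquiv.coe_ofBijective _ _ _⟩

/-- The inverse function theorem on manifolds. -/
theorem isLocalDiffeomorph_of_injective {f : M → M'} (hf : ∀ p, ModelSmoothAt F F ∞ f p)
    (hinj : ∀ p, Function.Injective (modelDeriv F F f p)) :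
    IsLocalDiffeomorph 𝓘(ℝ, F) 𝓘(ℝ, F) ∞ f := by
  have hF : CompleteSpace F := FiniteDimensional.complete ℝ F
  have hne : (∞ : ℕ∞ω) ≠ 0 := by simp
  intro p
  have hfc : Continuous f := continuous_iff_continuousAt.2 fun q => (hf q).continuousAt
  set e := chartAt F p with he
  set e' := chartAt F (f p) with he'
  set g : F → F := fun y => e' (f (e.symm y)) with hg
  set D : Set F := e.target ∩ e.symm ⁻¹' (f ⁻¹' e'.source) with hD
  have hDo : IsOpen D := e.isOpen_inter_preimage_symm (e'.open_source.preimage hfc)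
  have hes : ∀ y ∈ e.target, ModelSmoothAt F F ∞ e.symm y := fun y hy =>
    (contMDiffOn_chart_symm (I := 𝓘(ℝ, F)) (n := ∞)).contMDiffAt (e.open_target.mem_nhds hy)
  have hes' : ∀ q ∈ e'.source, ModelSmoothAt F F ∞ e' q := fun q hq =>
    (contMDiffOn_chart (I := 𝓘(ℝ, F)) (n := ∞)).contMDiffAt (e'.open_source.mem_nhds hq)
  have hgs : ∀ y ∈ D, ContDiffAt ℝ ∞ g y := fun y hy => by
    rw [← contMDiffAt_iff_contDiffAt]
    exact ModelSmoothAt.compose (g := e') (f := fun y => f (e.symm y)) (hes' _ hy.2)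
      (ModelSmoothAt.compose (g := f) (f := e.symm) (hf _) (hes y hy.1))
  have hgd : ∀ y ∈ D, Function.Injective (fderiv ℝ g y) := fun y hy => by
    have hy' : e.symm y ∈ (extChartAt 𝓘(ℝ, F) p).source := by
      rw [extChartAt_source]; exact e.map_target hy.1
    have hfy' : f (e.symm y) ∈ (extChartAt 𝓘(ℝ, F) (f p)).source := by
      rw [extChartAt_source]; exact hy.2
    have h1 : modelDeriv F F g y = (modelDeriv F F (chartTo F (f p)) (f (e.symm y))).comp
        ((modelDeriv F F f (e.symm y)).comp (modelDeriv F F (chartFrom F p) y)) := by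
      have h2 := modelDeriv_comp (g := f) (f := e.symm) (p := y) ((hf _).mdifferentiableAt hne)
        ((hes y hy.1).mdifferentiableAt hne)
      have h3 := modelDeriv_comp (g := e') (f := fun y => f (e.symm y)) (p := y)
        ((hes' _ hy.2).mdifferentiableAt hne)
        (((hf _).compose (f := e.symm) (hes y hy.1)).mdifferentiableAt hne)
      rw [h2] at h3
      exact h3
    rw [← modelDeriv_eq_fderiv, h1]
    have h4 := modelDeriv_chartFrom_comp_chartTo hfy'
    have h5 := modelDeriv_chartTo_comp_chartFrom hy'
    have hyc : chartTo F p (e.symm y) = y := e.right_inv hy.1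
    rw [hyc] at h5
    intro a b hab
    simp only [ContinuousLinearMap.comp_apply] at hab
    have h6 := congrArg (modelDeriv F F (chartFrom F (f p)) (chartTo F (f p) (f (e.symm y)))) hab
    have h7 : ∀ w, modelDeriv F F (chartFrom F (f p)) (chartTo F (f p) (f (e.symm y)))
      (modelDeriv F F (chartTo F (f p)) (f (e.symm y)) w) = w := fun w => DFunLike.congr_fun h4 w
    rw [h7, h7] at h6
    have h8 := congrArg (modelDeriv F F (chartTo F p) (e.symm y)) (hinj _ h6)
    have h9 : ∀ w, modelDeriv F F (chartTo F p) (e.symm y) (modelDeriv F F (chartFrom F p) y w)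
      = w := fun w => DFunLike.congr_fun h5 w
    rwa [h9, h9] at h8
  have hps : p ∈ e.source := mem_chart_source F p
  have hpD : e p ∈ D := ⟨e.map_source hps, by
    simp only [Set.mem_preimage, e.left_inv hps]; exact mem_chart_source F (f p)⟩
  obtain ⟨T, hT⟩ := exists_equiv_of_injective (hgd _ hpD)
  have hfd : HasFDerivAt g (T : F →L[ℝ] F) (e p) := by
    rw [hT]; exact ((hgs _ hpD).differentiableAt hne).hasFDerivAt
  set P := ((hgs _ hpD).toOpenPartialHomeomorph g hfd hne).restrOpen D hDo with hP
  have hPs : P.source ⊆ D := fun y hy => hy.2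
  have hPg : ∀ y, P y = g y := fun y => rfl
  have hpP : e p ∈ P.source :=
    ⟨(hgs _ hpD).mem_toOpenPartialHomeomorph_source hfd hne, hpD⟩
  -- The local inverse must be smooth on the whole target, not only at the image of the centre. For
  -- this the derivative is inverted at every point of D.
  have hPsymm : ∀ y ∈ P.target, ContDiffAt ℝ ∞ P.symm y := by
    intro y hy
    have hys := hPs (P.map_target hy)
    obtain ⟨T', hT'⟩ := exists_equiv_of_injective (hgd _ hys)
    refine P.contDiffAt_symm (f₀' := T') hy ?_ (hgs _ hys)
    rw [hT']
    exact ((hgs _ hys).differentiableAt hne).hasFDerivAt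
  set Q : OpenPartialHomeomorph M M' := (e.trans P).trans e'.symm with hQ
  have hQf : ∀ q ∈ Q.source, f q = Q q := by
    intro q hq
    simp only [hQ, OpenPartialHomeomorph.trans_source, Set.mem_inter_iff, Set.mem_preimage] at hq
    have h1 := hPs hq.1.2
    simp only [hQ, OpenPartialHomeomorph.coe_trans, Function.comp_apply, hPg, hg,
      e.left_inv hq.1.1]
    have h2 := h1.2
    simp only [Set.mem_preimage, e.left_inv hq.1.1] at h2
    exact (e'.left_inv h2).symm
  refine ⟨⟨Q.toPartialEquiv, Q.open_source, Q.open_target, ?_, ?_⟩, ?_, hQf⟩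
  · intro q hq
    exact ((hf q).contMDiffWithinAt).congr (fun q hq => (hQf q hq).symm) (hQf q hq).symm
  · intro q hq
    have hq' : q ∈ Q.target := hq
    simp only [hQ, OpenPartialHomeomorph.trans_target, OpenPartialHomeomorph.symm_target,
      OpenPartialHomeomorph.symm_symm, Set.mem_inter_iff, Set.mem_preimage] at hq'
    have h1 := ModelSmoothAt.compose (g := P.symm) (f := e') (hPsymm _ hq'.2.1).contMDiffAt
      (hes' q hq'.1)
    exact (ModelSmoothAt.compose (g := e.symm) (f := fun q => P.symm (e' q))
      (hes _ hq'.2.2) h1).contMDiffWithinAt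
  · change p ∈ Q.source
    simp only [hQ, OpenPartialHomeomorph.trans_source, Set.mem_inter_iff, Set.mem_preimage]
    refine ⟨⟨hps, hpP⟩, ?_⟩
    simp only [OpenPartialHomeomorph.coe_trans, Function.comp_apply, hPg, hg, e.left_inv hps]
    exact e'.map_source (mem_chart_source F (f p))

end InverseFunction
end

noncomputable section

/-! ### The injectively immersed subgroup covered by the plane group. -/

section PlaneCover

variable {E : Type*} [NormedAddCommGroup E] [NormedSpace ℝ E]
  {G : Type*} [TopologicalSpace G] [ChartedSpace E G] [Group G]

/-- `ι : K → G` is an injective homomorphism of a Lie group `K` covered by the plane,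
through which the plane map `Φ` factors. -/
structure PlaneCover (l : ℝ) (Φ : E2 → G) {K : Type*} [TopologicalSpace K] [ChartedSpace E2 K]
    [Group K] (π : E2 → K) (ι : K →* G) : Prop where
  smooth : ∀ x, ModelSmoothAt E2 E2 ∞ π x
  surjective : Function.Surjective π
  comp : ∀ x, ι (π x) = Φ x
  injective : Function.Injective ι
  map_mul : ∀ a b, π (AffPlane.mulMap l a b) = π a * π b
  exists_section : ∀ q, ∃ σ : K → E2, ModelSmoothAt E2 E2 ∞ σ q ∧ ∀ᶠ q' in 𝓝 q, π (σ q') = q'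

variable [LieGroup 𝓘(ℝ, E) ∞ G] {l : ℝ} {X Y Z : E} {Φ : E2 → G}

/-- K is the plane group modulo the kernel of Φ. The kernel is discrete because Φ is injective near
0, hence closed, which makes K Hausdorff. -/
theorem IsPlaneMap.exists_planeCover [CompleteSpace E] [T2Space G] (h : IsPlaneMap l X Y Φ)
    (hB : Function.Bijective (frameMap Z X Y)) :
    ∃ (K : Type) (_ : TopologicalSpace K) (_ : T2Space K) (_ : SecondCountableTopology K)
      (_ : ConnectedSpace K) (_ : ChartedSpace E2 K) (_ : Group K) (_ : LieGroup 𝓘(ℝ, E2) ∞ K)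
      (π : E2 → K) (ι : K →* G), PlaneCover l Φ π ι := by
  let f : AffPlane l →* G :=
    { toFun := Φ, map_one' := h.map_zero, map_mul' := h.map_mul }
  have hG : IsTopologicalGroup (AffPlane l) := DiscreteCoset.isTopologicalGroup E2 _
  have hN : DiscreteTopology f.ker := by
    obtain ⟨V, hV, hinj⟩ := h.injOn_nhds hB
    obtain ⟨W, hWV, hW, h0⟩ := mem_nhds_iff.1 hV
    refine discreteTopology_of_isOpen_singleton_one (isOpen_induced_iff.2 ⟨W, hW, ?_⟩)
    ext x
    constructor
    · intro hx
      have h1 : Φ x.1 = Φ 0 := by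
        rw [h.map_zero]; exact x.2
      exact Subtype.ext (hinj (hWV hx) (hWV h0) h1)
    · rintro rfl
      exact h0
  have hcl : IsClosed (f.ker : Set (AffPlane l)) := Subgroup.isClosed_of_discrete
  let _ : ChartedSpace E2 (AffPlane l ⧸ f.ker) := DiscreteCoset.chartedSpace E2 f.ker
  refine ⟨AffPlane l ⧸ f.ker, inferInstance, inferInstance, inferInstance, ?_,
    DiscreteCoset.chartedSpace E2 f.ker, inferInstance, DiscreteCoset.lieGroup f.ker,
    (DiscreteCoset.proj f.ker : AffPlane l → AffPlane l ⧸ f.ker), QuotientGroup.kerLift f, ?_⟩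
  · exact QuotientGroup.mk_surjective.connectedSpace QuotientGroup.continuous_mk
  · exact ⟨DiscreteCoset.contMDiffAt_proj (F := E2) f.ker,
      QuotientGroup.mk_surjective (s := f.ker), fun x => rfl,
      QuotientGroup.kerLift_injective f, fun a b => rfl,
      DiscreteCoset.exists_smooth_section (F := E2) f.ker⟩

omit [LieGroup 𝓘(ℝ, E) ∞ G] in
theorem IsPlaneMap.leftDeriv_injective (h : IsPlaneMap l X Y Φ)
    (hB : Function.Bijective (frameMap Z X Y)) (x : E2) :
    Function.Injective (leftDeriv E2 E Φ x) := by
  rw [injective_iff_map_eq_zero]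
  intro v hv
  rw [h.leftDeriv_apply] at hv
  have := @hB.1 (0, !₂[v 0, v 1 + l * x 1 * v 0]) 0 (by
    rw [frameMap_apply]
    simpa [frameMap_apply] using hv)
  have h2 := congrArg Prod.snd this
  have h3 := congrArg (fun w : E2 => w 0) h2
  have h4 := congrArg (fun w : E2 => w 1) h2
  simp at h3 h4
  refine AffPlane.plane_ext h3 ?_
  rw [h3] at h4
  simpa using h4

namespace PlaneCover

variable {K : Type*} [TopologicalSpace K] [ChartedSpace E2 K] [Group K]
    [LieGroup 𝓘(ℝ, E2) ∞ K] {π : E2 → K} {ι : K →* G}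

omit [TopologicalSpace G] [LieGroup 𝓘(ℝ, E2) ∞ K] in
theorem diffAt (hK : PlaneCover l Φ π ι) (x : E2) : ModelDiffAt E2 E2 π x :=
  (hK.smooth x).mdifferentiableAt (by simp)

omit [TopologicalSpace G] [LieGroup 𝓘(ℝ, E2) ∞ K] in
theorem map_zero (hK : PlaneCover l Φ π ι) : π 0 = 1 := by
  have := hK.map_mul 0 0
  rw [AffPlane.mulMap_zero] at this
  exact left_eq_mul.1 this

omit [LieGroup 𝓘(ℝ, E) ∞ G] [LieGroup 𝓘(ℝ, E2) ∞ K] in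
theorem smooth_ι (hK : PlaneCover l Φ π ι) (h : IsPlaneMap l X Y Φ) (q : K) :
    ModelSmoothAt E2 E ∞ ι q := by
  obtain ⟨σ, hσ, hσ'⟩ := hK.exists_section q
  have h1 := ModelSmoothAt.compose (g := Φ) (f := σ) (h.smooth _) hσ
  refine h1.congr_of_eventuallyEq ?_
  filter_upwards [hσ'] with q' hq'
  rw [← hK.comp, hq']

omit [LieGroup 𝓘(ℝ, E2) ∞ K] in
theorem leftDeriv_ι_comp (hK : PlaneCover l Φ π ι) (h : IsPlaneMap l X Y Φ) (x : E2) :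
    (leftDeriv E2 E ι (π x)).comp (modelDeriv E2 E2 π x) = leftDeriv E2 E Φ x := by
  rw [← leftDeriv_comp (f := ι) (u := π) ((hK.smooth_ι h _).mdifferentiableAt (by simp))
    (hK.diffAt x)]
  simp only [hK.comp]

omit [LieGroup 𝓘(ℝ, E2) ∞ K] in
theorem leftDeriv_ι_mem (hK : PlaneCover l Φ π ι) (h : IsPlaneMap l X Y Φ) (q : K) (v : E2) :
    leftDeriv E2 E ι q v ∈ Submodule.span ℝ {X, Y} := by
  obtain ⟨σ, hσ, hσ'⟩ := hK.exists_section q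
  have h1 := leftDeriv_comp (f := Φ) (u := σ) (h.diffAt _) (hσ.mdifferentiableAt (by simp))
  have h2 : leftDeriv E2 E (fun y => Φ (σ y)) q = leftDeriv E2 E ι q := by
    refine leftDeriv_congr ?_
    filter_upwards [hσ'] with q' hq'
    rw [← hK.comp, hq']
  rw [← h2, h1]
  exact h.leftDeriv_mem _ _

-- The differential of Φ is injective and factors through that of π. The latter is then injective,
-- so bijective by dimension, and injectivity passes to ι.
omit [LieGroup 𝓘(ℝ, E2) ∞ K] in
theorem leftDeriv_ι_injective (hK : PlaneCover l Φ π ι) (h : IsPlaneMap l X Y Φ)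
    (hB : Function.Bijective (frameMap Z X Y)) (q : K) :
    Function.Injective (leftDeriv E2 E ι q) := by
  obtain ⟨x, rfl⟩ := hK.surjective q
  have h1 := h.leftDeriv_injective hB x
  rw [← hK.leftDeriv_ι_comp h x] at h1
  have h2 : Function.Injective (modelDeriv E2 E2 π x) := by
    rw [ContinuousLinearMap.coe_comp] at h1
    exact h1.of_comp
  have h3 : Function.Surjective (modelDeriv E2 E2 π x) :=
    LinearMap.injective_iff_surjective (f := (modelDeriv E2 E2 π x).toLinearMap).1 h2
  intro a b hab
  obtain ⟨a', rfl⟩ := h3 a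
  obtain ⟨b', rfl⟩ := h3 b
  rw [h1 (a₁ := a') (a₂ := b') hab]

variable {F : Type*} [NormedAddCommGroup F] [NormedSpace ℝ F]
  {M : Type*} [TopologicalSpace M] [ChartedSpace F M] [IsManifold 𝓘(ℝ, F) ∞ M]

/-- A map from a connected manifold which is tangent to the left-invariant plane field
factors through a left coset of the subgroup. -/
theorem exists_lift [CompleteSpace E] [T2Space G] [PreconnectedSpace M]
    (hK : PlaneCover l Φ π ι) (h : IsPlaneMap l X Y Φ)
    (hB : Function.Bijective (frameMap Z X Y)) {φ : M → G}
    (hφ : ∀ p, ModelSmoothAt F E ∞ φ p)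
    (hspan : ∀ p v, leftDeriv F E φ p v ∈ Submodule.span ℝ {X, Y}) (p₀ : M) :
    ∃ ψ : M → K, (∀ p, ModelSmoothAt F E2 ∞ ψ p) ∧ ∀ p, φ p = φ p₀ * ι (ψ p) := by
  have hloc := h.exists_local_lift (F := F) hB hφ hspan
  -- A local lift moves between nearby points by an element of ι(K), so membership in the coset is
  -- both an open and a closed condition.
  set A : Set M := {p | ∃ k, φ p = φ p₀ * ι k} with hA
  have hAo : IsOpen A := by
    rw [isOpen_iff_mem_nhds]
    rintro p ⟨k, hk⟩
    obtain ⟨x, -, -, hx⟩ := hloc p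
    filter_upwards [hx] with q hq
    exact ⟨k * π (x q), by rw [hq, hk, _root_.map_mul, hK.comp, mul_assoc]⟩
  have hAc : IsClosed A := by
    rw [← isOpen_compl_iff, isOpen_iff_mem_nhds]
    intro p hp
    obtain ⟨x, -, -, hx⟩ := hloc p
    filter_upwards [hx] with q hq
    rintro ⟨k, hk⟩
    refine hp ⟨k * (π (x q))⁻¹, ?_⟩
    rw [_root_.map_mul, map_inv, hK.comp, ← mul_assoc, ← hk, hq, mul_inv_cancel_right]
  have hAu : A = Set.univ := IsClopen.eq_univ ⟨hAc, hAo⟩ ⟨p₀, 1, by simp⟩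
  have hall : ∀ p, ∃ k, φ p = φ p₀ * ι k := fun p => by
    have : p ∈ A := by rw [hAu]; trivial
    exact this
  choose ψ hψ using hall
  refine ⟨ψ, fun p => ?_, hψ⟩
  obtain ⟨x, hxs, hx0, hx⟩ := hloc p
  -- The lift ψ was only chosen pointwise. Injectivity of ι forces it to agree near p with the
  -- smooth local lift.
  have h1 : ModelSmoothAt F E2 ∞ (fun q => ψ p * π (x q)) p :=
    ModelSmoothAt.const_mul le_rfl _ (ModelSmoothAt.compose (f := x) (hK.smooth _) hxs)
  refine h1.congr_of_eventuallyEq ?_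
  filter_upwards [hx] with q hq
  apply hK.injective
  rw [hψ q, hψ p, mul_assoc, mul_right_inj] at hq
  rw [hq, _root_.map_mul, hK.comp]

end PlaneCover

end PlaneCover
end

noncomputable section

/-! ### Coordinates in the orthonormal frame and the subalgebra orthogonal to ν. -/

section Coordinates

namespace DiagonalMetric

variable {G : Type*} [TopologicalSpace G] [ChartedSpace E3 G] [Group G] (D : DiagonalMetric G)

/-- The coordinates of a vector of the Lie algebra in the orthonormal frame. -/
def crd (i : Fin 3) : E3 →L[ℝ] ℝ :=
  LinearMap.toContinuousLinearMap (show E3 →ₗ[ℝ] ℝ from D.E.coord i)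

/-- The vector of the Lie algebra with given coordinates in the orthonormal frame. -/
def vec (x : Fin 3 → ℝ) : E3 := ∑ i, x i • (D.E i : GroupLieAlgebra 𝓘(ℝ, E3) G)

theorem repr_eq (X : GroupLieAlgebra 𝓘(ℝ, E3) G) (i : Fin 3) : D.E.repr X i = D.crd i X := rfl

@[simp] theorem crd_vec (x : Fin 3 → ℝ) (i : Fin 3) : D.crd i (D.vec x) = x i := by
  exact congrFun (D.E.repr_sum_self x) i

theorem crd_ext {X Y : E3} (h : ∀ i, D.crd i X = D.crd i Y) : X = Y :=
  D.E.ext_elem (x := X) (y := Y) h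

theorem metric_eq (X Y : GroupLieAlgebra 𝓘(ℝ, E3) G) :
    D.metric X Y = ∑ i, D.ε i * D.crd i X * D.crd i Y := rfl

theorem eps_sq (i : Fin 3) : D.ε i * D.ε i = 1 := by
  rcases D.ε_sign i with h | h <;> rw [h] <;> norm_num

theorem eps_ne (i : Fin 3) : D.ε i ≠ 0 := by
  rcases D.ε_sign i with h | h <;> rw [h] <;> norm_num

/-- The bracket on the space of coordinate vectors. -/
def brk (x y : Fin 3 → ℝ) : Fin 3 → ℝ :=
  ![D.c 0 * (x 1 * y 2 - x 2 * y 1), D.c 1 * (x 2 * y 0 - x 0 * y 2),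
    D.c 2 * (x 0 * y 1 - x 1 * y 0)]

variable [LieGroup 𝓘(ℝ, E3) ∞ G]

theorem lie_sum (x y : Fin 3 → ℝ) :
    ⁅∑ i, x i • D.E i, ∑ i, y i • D.E i⁆ = ∑ i, D.brk x y i • D.E i := by
  have h3 : LieGroup 𝓘(ℝ, E3) (minSmoothness ℝ 3) G := by
    simp only [minSmoothness_of_isRCLikeNormedField]
    exact LieGroup.of_le (n := ∞) ENat.LEInfty.out
  have h10 : ⁅D.E 1, D.E 0⁆ = -(D.c 2 • D.E 2) := by rw [← D.bracket_01, lie_skew]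
  have h21 : ⁅D.E 2, D.E 1⁆ = -(D.c 0 • D.E 0) := by rw [← D.bracket_12, lie_skew]
  have h02 : ⁅D.E 0, D.E 2⁆ = -(D.c 1 • D.E 1) := by rw [← D.bracket_20, lie_skew]
  simp only [Fin.sum_univ_three, lie_add, add_lie, lie_smul, smul_lie, lie_self, D.bracket_01,
    D.bracket_12, D.bracket_20, h10, h21, h02, brk, Matrix.cons_val]
  module

theorem lie_eq (X Y : GroupLieAlgebra 𝓘(ℝ, E3) G) :
    ⁅X, Y⁆ = D.vec (D.brk (fun i => D.crd i X) (fun i => D.crd i Y)) := by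
  have h := D.lie_sum (D.E.repr X) (D.E.repr Y)
  rw [D.E.sum_repr, D.E.sum_repr] at h
  exact h

theorem lieBr_eq_vec (X Y : E3) :
    lieBr E3 G X Y = D.vec (D.brk (fun i => D.crd i X) (fun i => D.crd i Y)) :=
  D.lie_eq X Y

/-- In coordinates the bracket is the cross product with components scaled by cᵢ. The cross product
of two vectors annihilated by ν is a multiple of ν, so all their brackets lie along (cᵢνᵢ), and this
vector lies in the plane because Σ cᵢνᵢ² = 0. If it vanishes, the plane is abelian and any nonzero y
in it will do. -/
theorem exists_frame {ν : Fin 3 → ℝ} (hν : ν ≠ 0) (hc : ∑ i, D.c i * ν i ^ 2 = 0) :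
    ∃ (l : ℝ) (X Y Z : E3), lieBr E3 G X Y = l • Y ∧ Function.Bijective (frameMap Z X Y) ∧
      ∀ V, V ∈ Submodule.span ℝ {X, Y} ↔ ∑ i, ν i * D.crd i V = 0 := by
  have hνs : 0 < ν 0 ^ 2 + ν 1 ^ 2 + ν 2 ^ 2 := by
    obtain ⟨i, hi⟩ := Function.ne_iff.1 hν
    have := pow_pos (abs_pos.2 hi) 2
    fin_cases i <;> simp at this ⊢ <;> positivity
  rw [Fin.sum_univ_three] at hc
  -- a vector orthogonal to `ν` spanning a line that contains the commutator
  obtain ⟨y, m, hy0, hyν, hym⟩ : ∃ (y : Fin 3 → ℝ) (m : ℝ), 0 < y 0 ^ 2 + y 1 ^ 2 + y 2 ^ 2 ∧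
      ν 0 * y 0 + ν 1 * y 1 + ν 2 * y 2 = 0 ∧ ∀ i, D.c i * ν i = m * y i := by
    by_cases hw : ∀ i, D.c i * ν i = 0
    · by_cases h : ν 0 = 0 ∧ ν 1 = 0
      · exact ⟨![1, 0, 0], 0, by simp, by simp [h.1], by simpa using hw⟩
      · refine ⟨![ν 1, -ν 0, 0], 0, ?_, by simp; ring, by simpa using hw⟩
        rcases not_and_or.1 h with h | h <;> simp <;> positivity
    · push Not at hw
      obtain ⟨i, hi⟩ := hw
      refine ⟨fun i => D.c i * ν i, 1, ?_, by linear_combination hc, by simp⟩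
      have := pow_pos (abs_pos.2 hi) 2
      fin_cases i <;> simp only [Fin.zero_eta, Fin.mk_one, Fin.reduceFinMk, sq_abs] at this ⊢ <;>
        positivity
  set x : Fin 3 → ℝ := ![ν 1 * y 2 - ν 2 * y 1, ν 2 * y 0 - ν 0 * y 2, ν 0 * y 1 - ν 1 * y 0]
    with hx
  -- With x = ν × y and ν·y = 0, the double cross product is x × y = -|y|²ν; then cᵢνᵢ = m yᵢ is
  -- inserted.
  have hbr : ∀ i, D.brk x y i = -(y 0 ^ 2 + y 1 ^ 2 + y 2 ^ 2) * m * y i := by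
    intro i
    rw [mul_assoc, ← hym]
    fin_cases i <;> simp [brk, hx]
    · linear_combination D.c 0 * y 0 * hyν
    · linear_combination D.c 1 * y 1 * hyν
    · linear_combination D.c 2 * y 2 * hyν
  have hxν : ν 0 * x 0 + ν 1 * x 1 + ν 2 * x 2 = 0 := by simp [hx]; ring
  have hxy : x 0 * y 0 + x 1 * y 1 + x 2 * y 2 = 0 := by simp [hx]; ring
  have hxx : x 0 ^ 2 + x 1 ^ 2 + x 2 ^ 2
      = (ν 0 ^ 2 + ν 1 ^ 2 + ν 2 ^ 2) * (y 0 ^ 2 + y 1 ^ 2 + y 2 ^ 2) := by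
    simp [hx]
    linear_combination -(ν 0 * y 0 + ν 1 * y 1 + ν 2 * y 2) * hyν
  have hx0 : 0 < x 0 ^ 2 + x 1 ^ 2 + x 2 ^ 2 := by rw [hxx]; positivity
  have hfc : ∀ (w : ℝ × E2) i, D.crd i (frameMap (D.vec ν) (D.vec x) (D.vec y) w)
      = w.1 * ν i + w.2 0 * x i + w.2 1 * y i := by
    intro w i
    rw [frameMap_apply]
    simp [add_assoc]
  have hinj : Function.Injective (frameMap (D.vec ν) (D.vec x) (D.vec y)) := by
    rw [injective_iff_map_eq_zero]
    intro w hw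
    have h : ∀ i, w.1 * ν i + w.2 0 * x i + w.2 1 * y i = 0 := fun i => by
      rw [← hfc, hw, map_zero]
    have h1 : w.1 * (ν 0 ^ 2 + ν 1 ^ 2 + ν 2 ^ 2) = 0 := by
      linear_combination ν 0 * h 0 + ν 1 * h 1 + ν 2 * h 2 - w.2 0 * hxν - w.2 1 * hyν
    have h2 : w.2 0 * (x 0 ^ 2 + x 1 ^ 2 + x 2 ^ 2) = 0 := by
      linear_combination x 0 * h 0 + x 1 * h 1 + x 2 * h 2 - w.1 * hxν - w.2 1 * hxy
    have h3 : w.2 1 * (y 0 ^ 2 + y 1 ^ 2 + y 2 ^ 2) = 0 := by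
      linear_combination y 0 * h 0 + y 1 * h 1 + y 2 * h 2 - w.1 * hyν - w.2 0 * hxy
    refine Prod.ext ((mul_eq_zero_iff_right hνs.ne').1 h1) (AffPlane.plane_ext ?_ ?_)
    · exact (mul_eq_zero_iff_right hx0.ne').1 h2
    · exact (mul_eq_zero_iff_right hy0.ne').1 h3
  have hbij : Function.Bijective (frameMap (D.vec ν) (D.vec x) (D.vec y)) := by
    refine ⟨hinj, (LinearMap.injective_iff_surjective_of_finrank_eq_finrank
      (f := (frameMap (D.vec ν) (D.vec x) (D.vec y)).toLinearMap) ?_).1 hinj⟩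
    simp
  refine ⟨-(y 0 ^ 2 + y 1 ^ 2 + y 2 ^ 2) * m, D.vec x, D.vec y, D.vec ν,
    D.crd_ext fun i => ?_, hbij, fun V => ⟨fun hV => ?_, fun hV => ?_⟩⟩
  · rw [D.lieBr_eq_vec]
    simp [hbr]
  · obtain ⟨a, b, rfl⟩ := Submodule.mem_span_pair.1 hV
    simp only [map_add, map_smul, crd_vec, Fin.sum_univ_three, smul_eq_mul]
    linear_combination a * hxν + b * hyν
  · obtain ⟨w, rfl⟩ := hbij.2 V
    simp only [hfc, Fin.sum_univ_three] at hV
    have h1 : w.1 * (ν 0 ^ 2 + ν 1 ^ 2 + ν 2 ^ 2) = 0 := by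
      linear_combination hV - w.2 0 * hxν - w.2 1 * hyν
    rw [frameMap_apply, (mul_eq_zero_iff_right hνs.ne').1 h1]
    refine Submodule.mem_span_pair.2 ⟨w.2 0, w.2 1, ?_⟩
    simp

end DiagonalMetric

namespace ImmersedSurface

variable {G : Type*} [TopologicalSpace G] [ChartedSpace E3 G] [Group G]
  {D : DiagonalMetric G} {S : Type*} [TopologicalSpace S] [ChartedSpace E2 S]
  (φ : ImmersedSurface D S)

theorem angle_eq (i : Fin 3) (p : S) : φ.angle i p = D.ε i * D.crd i (φ.gauss p) := by
  rw [angle, DiagonalMetric.metric_eq]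
  have h : ∀ j, D.crd j (D.E i) = if i = j then 1 else 0 := fun j => by
    rw [← D.repr_eq, D.E.repr_self, Finsupp.single_apply]
  simp [h]

theorem crd_gauss (i : Fin 3) (p : S) : D.crd i (φ.gauss p) = D.ε i * φ.angle i p := by
  rw [angle_eq, ← mul_assoc, D.eps_sq, one_mul]

theorem sum_angle_sq (p : S) : ∑ i, D.ε i * φ.angle i p ^ 2 = φ.sgn := by
  rw [← φ.gauss_unit p, DiagonalMetric.metric_eq]
  refine Finset.sum_congr rfl fun i _ => ?_
  rw [angle_eq]
  linear_combination D.ε i * D.crd i (φ.gauss p) ^ 2 * D.eps_sq i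

theorem metric_gauss (p : S) (X : E3) :
    D.metric (φ.gauss p) X = ∑ i, φ.angle i p * D.crd i X := by
  refine (D.metric_eq _ X).trans ?_
  simp_rw [angle_eq]

/-- The signs cancel between the metric and the coordinates of N, so the angle functions themselves
are the components of the covector annihilating the tangent plane. -/
theorem sum_angle_mul_crd (p : S) (v : E2) :
    ∑ i, φ.angle i p * D.crd i (leftDeriv E2 E3 φ.toFun p v) = 0 := by
  rw [← metric_gauss]
  exact φ.gauss_normal p v

theorem sgn_ne : φ.sgn ≠ 0 := by
  rcases φ.sgn_sign with h | h <;> rw [h] <;> norm_num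

theorem leftDeriv_injective [LieGroup 𝓘(ℝ, E3) ∞ G] (p : S) :
    Function.Injective (leftDeriv E2 E3 φ.toFun p) := by
  have h1 : ModelDiffAt E2 E3 φ.toFun p := (φ.smooth p).mdifferentiableAt (by simp)
  rw [injective_iff_map_eq_zero]
  intro v hv
  exact (injective_iff_map_eq_zero (modelDeriv E2 E3 φ.toFun p)).1 (φ.immersive p) v
    ((modelDeriv_apply_eq_zero_iff h1 v).2 hv)

end ImmersedSurface
end Coordinates
end

noncomputable section

/-! ### Endpoints of curves of finite length in the subgroup. -/

section Completeness

open MeasureTheory Set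

/-- The primitive is continuous up to the closed endpoints although the integrand is only controlled
inside. This produces the endpoint of a curve of finite length. -/
theorem exists_primitive {a : ℝ → ℝ} (hc : ContinuousOn a (Ioo 0 1))
    (hi : IntegrableOn a (Ioo 0 1)) :
    ∃ s : ℝ → ℝ, ContinuousOn s (Icc 0 1) ∧ ∀ t ∈ Ioo (0 : ℝ) 1, HasDerivAt s (a t) t := by
  have h01 : IntervalIntegrable a volume 0 1 :=
    (intervalIntegrable_iff_integrableOn_Ioo_of_le zero_le_one).2 hi
  refine ⟨fun t => ∫ x in (0 : ℝ)..t, a x, ?_, fun t ht => ?_⟩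
  · have := intervalIntegral.continuousOn_primitive_interval' h01 left_mem_uIcc
    rwa [uIcc_of_le zero_le_one] at this
  · have hn : Ioo (0 : ℝ) 1 ∈ 𝓝 t := Ioo_mem_nhds ht.1 ht.2
    refine intervalIntegral.integral_hasDerivAt_right ?_ ?_ (hc.continuousAt hn)
    · refine h01.mono_set ?_
      rw [uIcc_of_le zero_le_one, uIcc_of_le ht.1.le]
      exact Icc_subset_Icc_right ht.2.le
    · exact ⟨Ioo 0 1, hn, hc.aestronglyMeasurable measurableSet_Ioo⟩

theorem integrableOn_of_abs_le {a r : ℝ → ℝ} (hc : ContinuousOn a (Ioo 0 1))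
    (hr : IntegrableOn r (Ioo 0 1)) (h : ∀ t ∈ Ioo (0 : ℝ) 1, |a t| ≤ r t) :
    IntegrableOn a (Ioo 0 1) :=
  Integrable.mono' hr (hc.aestronglyMeasurable measurableSet_Ioo)
    ((ae_restrict_iff' measurableSet_Ioo).2 (Filter.Eventually.of_forall h))

variable {E : Type*} [NormedAddCommGroup E] [NormedSpace ℝ E]

/-- Inverting the full frame gives linear coordinates on the plane that are defined and continuous
on all of E. -/
theorem exists_coordinates [CompleteSpace E] {X Y Z : E}
    (hB : Function.Bijective (frameMap Z X Y)) :
    ∃ A B : E →L[ℝ] ℝ, (∀ a b : ℝ, A (a • X + b • Y) = a ∧ B (a • X + b • Y) = b) := by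
  obtain ⟨T, hT⟩ : ∃ T : (ℝ × E2) ≃L[ℝ] E, (T : ℝ × E2 →L[ℝ] E) = frameMap Z X Y :=
    ⟨ContinuousLinearEquiv.ofBijective (frameMap Z X Y) (LinearMap.ker_eq_bot.2 hB.1)
      (LinearMap.range_eq_top.2 hB.2), ContinuousLinearEquiv.coe_ofBijective _ _ _⟩
  have h : ∀ a b : ℝ, T.symm (a • X + b • Y) = (0, !₂[a, b]) := by
    intro a b
    rw [ContinuousLinearEquiv.symm_apply_eq, ← ContinuousLinearEquiv.coe_coe, hT, frameMap_apply]
    simp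
  refine ⟨(coordCLM 0).comp ((ContinuousLinearMap.snd ℝ ℝ E2).comp (T.symm : E →L[ℝ] ℝ × E2)),
    (coordCLM 1).comp ((ContinuousLinearMap.snd ℝ ℝ E2).comp (T.symm : E →L[ℝ] ℝ × E2)), fun a b => ?_⟩
  simp [h]

variable {G : Type*} [TopologicalSpace G] [ChartedSpace E G] [Group G] [LieGroup 𝓘(ℝ, E) ∞ G]
  {l : ℝ} {X Y Z : E} {Φ : E2 → G} {K : Type*} [TopologicalSpace K] [ChartedSpace E2 K] [Group K]
  [LieGroup 𝓘(ℝ, E2) ∞ K] {π : E2 → K} {ι : K →* G}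

/-- The logarithmic derivative of the map `t ↦ (s t, τ t)` into the plane group. -/
theorem IsPlaneMap.leftDeriv_curve (h : IsPlaneMap l X Y Φ) {s τ : ℝ → ℝ} {s' τ' t : ℝ}
    (hs : HasDerivAt s s' t) (hτ : HasDerivAt τ τ' t) :
    ModelDiffAt ℝ E (fun t => Φ !₂[s t, τ t]) t ∧
      leftDeriv ℝ E (fun t => Φ !₂[s t, τ t]) t 1 = s' • X + (τ' + l * τ t * s') • Y := by
  have hd : HasDerivAt (fun t => (!₂[s t, τ t] : E2)) !₂[s', τ'] t := by
    rw [hasDerivAt_iff_hasFDerivAt, ← hasFDerivWithinAt_univ, hasFDerivWithinAt_euclidean]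
    intro i
    refine HasDerivAt.hasFDerivAt (f' := (!₂[s', τ'] : E2) i) ?_ |>.congr_fderiv ?_ |>.hasFDerivWithinAt
    rotate_left
    · ext; simp
    fin_cases i
    · exact hs
    · exact hτ
  have hm : ModelDiffAt ℝ E2 (fun t => (!₂[s t, τ t] : E2)) t :=
    hd.differentiableAt.mdifferentiableAt
  refine ⟨ModelDiffAt.compose (g := Φ) (f := fun t => (!₂[s t, τ t] : E2)) (h.diffAt _) hm, ?_⟩
  rw [leftDeriv_comp (f := Φ) (u := fun t => (!₂[s t, τ t] : E2)) (h.diffAt _) hm,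
    ContinuousLinearMap.comp_apply, modelDeriv_eq_fderiv, fderiv_apply_one_eq_deriv, hd.deriv,
    h.leftDeriv_apply]
  rfl

/-- A curve of finite length in the subgroup has an endpoint. -/
theorem PlaneCover.exists_tendsto [CompleteSpace E] (hK : PlaneCover l Φ π ι)
    (h : IsPlaneMap l X Y Φ) (hB : Function.Bijective (frameMap Z X Y)) {γ : ℝ → K}
    (hγ : ∀ t ∈ Ioo (0 : ℝ) 1, ModelSmoothAt ℝ E2 1 γ t) {q : E → ℝ} {C : ℝ}
    (hC : ∀ a b : ℝ, |a| + |b| ≤ C * √(q (a • X + b • Y)))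
    (hi : IntegrableOn (fun t => √(q (leftDeriv E2 E ι (γ t) (modelDeriv ℝ E2 γ t 1))))
      (Ioo 0 1)) :
    ∃ p, Filter.Tendsto γ (𝓝[<] (1 : ℝ)) (𝓝 p) := by
  have hKt : IsTopologicalGroup K := topologicalGroup_of_lieGroup 𝓘(ℝ, E2) ∞
  obtain ⟨A, B, hAB⟩ := exists_coordinates hB
  set θ : ℝ → E := fun t => leftDeriv ℝ E (fun t => ι (γ t)) t 1 with hω
  have hιγ : ∀ t ∈ Ioo (0 : ℝ) 1, ModelSmoothAt ℝ E 1 (fun t => ι (γ t)) t := fun t ht =>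
    ModelSmoothAt.compose (g := ι) (f := γ) ((hK.smooth_ι h _).of_le (by simp)) (hγ t ht)
  have hωe : ∀ t ∈ Ioo (0 : ℝ) 1, θ t = leftDeriv E2 E ι (γ t) (modelDeriv ℝ E2 γ t 1) := by
    intro t ht
    rw [hω]
    simp only
    rw [leftDeriv_comp (f := ι) (u := γ) ((hK.smooth_ι h _).mdifferentiableAt (by simp))
      ((hγ t ht).mdifferentiableAt one_ne_zero)]
    rfl
  have hωc : ContinuousOn θ (Ioo 0 1) := by
    intro t ht
    have h1 : ContDiffAt ℝ 0 (leftDeriv ℝ E (fun t => ι (γ t))) t := by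
      refine contDiffAt_leftDeriv (n := 1) (m := 0) (by simp) (by simp) ?_
      filter_upwards [Ioo_mem_nhds ht.1 ht.2] with y hy using hιγ y hy
    exact (h1.continuousAt.clm_apply continuousAt_const).continuousWithinAt
  have hωab : ∀ t ∈ Ioo (0 : ℝ) 1, θ t = A (θ t) • X + B (θ t) • Y := by
    intro t ht
    have h1 := hK.leftDeriv_ι_mem h (γ t) (modelDeriv ℝ E2 γ t 1)
    rw [← hωe t ht] at h1
    obtain ⟨a, b, hab⟩ := Submodule.mem_span_pair.1 h1
    rw [← hab, (hAB a b).1, (hAB a b).2]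
  have hle : ∀ t ∈ Ioo (0 : ℝ) 1, |A (θ t)| + |B (θ t)| ≤
      C * √(q (leftDeriv E2 E ι (γ t) (modelDeriv ℝ E2 γ t 1))) := fun t ht => by
    rw [← hωe t ht]
    conv_rhs => rw [hωab t ht]
    exact hC _ _
  have hAc : ContinuousOn (fun t => A (θ t)) (Ioo 0 1) := A.continuous.comp_continuousOn hωc
  have hBc : ContinuousOn (fun t => B (θ t)) (Ioo 0 1) := B.continuous.comp_continuousOn hωc
  have hAi : IntegrableOn (fun t => A (θ t)) (Ioo 0 1) :=
    integrableOn_of_abs_le hAc (hi.const_mul C) fun t ht =>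
      (le_add_of_nonneg_right (abs_nonneg _)).trans (hle t ht)
  have hBi : IntegrableOn (fun t => B (θ t)) (Ioo 0 1) :=
    integrableOn_of_abs_le hBc (hi.const_mul C) fun t ht =>
      (le_add_of_nonneg_left (abs_nonneg _)).trans (hle t ht)
  obtain ⟨s, hsc, hs⟩ := exists_primitive hAc hAi
  have hec : ContinuousOn (fun t => Real.exp (l * s t)) (Icc 0 1) :=
    Real.continuous_exp.comp_continuousOn (continuousOn_const.mul hsc)
  -- The system s' = A, τ' + lτs' = B, which prescribes the logarithmic derivative in plane
  -- coordinates, is solved for τ with the integrating factor exp(ls).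
  obtain ⟨w, hwc, hw⟩ := exists_primitive (a := fun t => Real.exp (l * s t) * B (θ t))
    ((hec.mono Ioo_subset_Icc_self).mul hBc)
    (hBi.continuousOn_mul_of_subset hec isCompact_Icc measurableSet_Ioo Ioo_subset_Icc_self)
  set τ : ℝ → ℝ := fun t => Real.exp (-(l * s t)) * w t with hτ
  have hτc : ContinuousOn τ (Icc 0 1) :=
    (Real.continuous_exp.comp_continuousOn (continuousOn_const.mul hsc).neg).mul hwc
  have hcurve : ∀ t ∈ Ioo (0 : ℝ) 1, ModelDiffAt ℝ E (fun t => Φ !₂[s t, τ t]) t ∧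
      leftDeriv ℝ E (fun t => Φ !₂[s t, τ t]) t 1 = θ t := by
    intro t ht
    have h1 : HasDerivAt τ (Real.exp (-(l * s t)) * -(l * A (θ t)) * w t
        + Real.exp (-(l * s t)) * (Real.exp (l * s t) * B (θ t))) t :=
      (((hs t ht).const_mul l).neg.exp).mul (hw t ht)
    obtain ⟨h2, h3⟩ := h.leftDeriv_curve (hs t ht) h1
    refine ⟨h2, h3.trans ?_⟩
    conv_rhs => rw [hωab t ht]
    congr 2
    have h4 : Real.exp (-(l * s t)) * Real.exp (l * s t) = 1 := by
      rw [← Real.exp_add]; simp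
    rw [hτ]
    linear_combination B (θ t) * h4
  set β : ℝ → E2 := fun t => !₂[s t, τ t] with hβ
  have hβc : ContinuousOn β (Icc 0 1) := by
    refine (PiLp.continuous_toLp 2 _).comp_continuousOn (continuousOn_pi.2 fun i => ?_)
    fin_cases i
    · exact hsc
    · exact hτc
  have hhalf : (1 / 2 : ℝ) ∈ Ioo (0 : ℝ) 1 := by norm_num
  -- The images of γ and π∘β in G have the same logarithmic derivative, so they differ by a constant
  -- left factor, and injectivity of ι brings this back to K. The base point 1/2 is any interior
  -- one.
  have hconst : ∀ t ∈ Ioo (0 : ℝ) 1, γ t = γ (1 / 2) * (π (β (1 / 2)))⁻¹ * π (β t) := by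
    intro t ht
    have h1 := mul_inv_eq_of_leftDeriv_eq (F := ℝ) (f := fun t => ι (γ t)) (g := fun t => Φ (β t))
      isOpen_Ioo isPreconnected_Ioo (fun t ht => (hιγ t ht).mdifferentiableAt one_ne_zero)
      (fun t ht => (hcurve t ht).1)
      (fun t ht => ContinuousLinearMap.ext_ring (by rw [(hcurve t ht).2])) ht hhalf
    rw [mul_inv_eq_iff_eq_mul] at h1
    apply hK.injective
    rw [_root_.map_mul, _root_.map_mul, map_inv, hK.comp, hK.comp, h1]
  refine ⟨γ (1 / 2) * (π (β (1 / 2)))⁻¹ * π (β 1), ?_⟩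
  have hπ : Continuous π := continuous_iff_continuousAt.2 fun x => (hK.smooth x).continuousAt
  have hlim : Filter.Tendsto (fun t => γ (1 / 2) * (π (β (1 / 2)))⁻¹ * π (β t)) (𝓝[Ioo 0 1] (1 : ℝ))
      (𝓝 (γ (1 / 2) * (π (β (1 / 2)))⁻¹ * π (β 1))) := by
    refine Filter.Tendsto.const_mul _ ((hπ.tendsto _).comp ?_)
    exact (hβc 1 (right_mem_Icc.2 zero_le_one)).mono_left (nhdsWithin_mono _ Ioo_subset_Icc_self)
  rw [← nhdsWithin_Ioo_eq_nhdsLT zero_lt_one]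
  refine hlim.congr' ?_
  filter_upwards [self_mem_nhdsWithin] with t ht using (hconst t ht).symm

end Completeness
end

noncomputable section

/-! ### Path lifting along local homeomorphisms, and surjectivity from completeness. -/

section PathLifting

open Set

variable {S K : Type*} [TopologicalSpace S] [T2Space S] [TopologicalSpace K] {f : S → K}
  {c : ℝ → K}

/-- `γ` lifts the path `c` along `f` on the set `J`. -/
structure IsLiftOn (f : S → K) (c : ℝ → K) (J : Set ℝ) (γ : ℝ → S) : Prop where
  continuousOn : ContinuousOn γ J
  lifts : ∀ s ∈ J, f (γ s) = c s

omit [T2Space S] [TopologicalSpace K] in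
theorem IsLiftOn.mono {J J' : Set ℝ} {γ : ℝ → S} (h : IsLiftOn f c J γ) (hJ : J' ⊆ J) :
    IsLiftOn f c J' γ :=
  ⟨h.continuousOn.mono hJ, fun s hs => h.lifts s (hJ hs)⟩

theorem IsLiftOn.eqOn (hf : IsLocalHomeomorph f) {t : ℝ} {γ γ' : ℝ → S}
    (h : IsLiftOn f c (Icc 0 t) γ) (h' : IsLiftOn f c (Icc 0 t) γ') (h0 : γ 0 = γ' 0) (ht : 0 ≤ t) :
    EqOn γ γ' (Icc 0 t) :=
  (T2Space.isSeparatedMap f).eqOn_of_comp_eqOn hf.isLocallyInjective isPreconnected_Icc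
    h.continuousOn h'.continuousOn (fun s hs => (h.lifts s hs).trans (h'.lifts s hs).symm)
    (left_mem_Icc.2 ht) h0

omit [T2Space S] in
theorem IsLiftOn.extend (hf : IsLocalHomeomorph f) (hc : Continuous c) {t : ℝ} (ht : 0 ≤ t)
    {γ : ℝ → S} (h : IsLiftOn f c (Icc 0 t) γ) {y : ℝ} (hy : t < y) :
    ∃ t' ∈ Ioc t y, ∃ γ', IsLiftOn f c (Icc 0 t') γ' ∧ γ' 0 = γ 0 := by
  obtain ⟨e, he, hfe⟩ := hf (γ t)
  have h1 : ∀ᶠ s in 𝓝 t, c s ∈ e.target := by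
    refine hc.continuousAt (e.open_target.mem_nhds ?_)
    rw [← h.lifts t (right_mem_Icc.2 ht), hfe]
    exact e.map_source he
  obtain ⟨r, hr, hrt⟩ := (nhdsGE_basis t).mem_iff.1
    (mem_nhdsWithin_of_mem_nhds (t := Ici t) (s := {s | c s ∈ e.target}) h1)
  obtain ⟨t', ht', ht''⟩ := exists_between (lt_min hy hr)
  have hle : Icc t t' ⊆ {s | c s ∈ e.target} := fun s hs =>
    hrt ⟨hs.1, hs.2.trans_lt (ht''.trans_le (min_le_right _ _))⟩
  set γ' : ℝ → S := fun s => if s ≤ t then γ s else e.symm (c s) with hγ'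
  have ha : EqOn γ' γ (Icc 0 t) := fun s hs => if_pos hs.2
  have hb : EqOn γ' (fun s => e.symm (c s)) (Icc t t') := by
    intro s hs
    rcases hs.1.eq_or_lt with rfl | hlt
    · simp only [hγ', le_refl, if_true]
      rw [← h.lifts t (right_mem_Icc.2 ht), hfe, e.left_inv he]
    · exact if_neg hlt.not_ge
  have hu : Icc 0 t ∪ Icc t t' = Icc 0 t' := Icc_union_Icc_eq_Icc ht ht'.le
  refine ⟨t', ⟨ht', ht''.le.trans (min_le_left _ _)⟩, γ', ⟨?_, ?_⟩, ha (left_mem_Icc.2 ht)⟩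
  · rw [← hu]
    refine ContinuousOn.union_of_isClosed (h.continuousOn.congr ha)
      (ContinuousOn.congr ?_ hb) isClosed_Icc isClosed_Icc
    exact e.continuousOn_symm.comp hc.continuousOn hle
  · rw [← hu]
    rintro s (hs | hs)
    · rw [ha hs, h.lifts s hs]
    · rw [hb hs, hfe]
      exact e.right_inv (hle hs)

/-- Lifts on the intervals [0,s] agree on overlaps by uniqueness, so their diagonal s ↦ γ s s is a
lift on the union. -/
theorem exists_isLiftOn_Ico (hf : IsLocalHomeomorph f) {p : S} {x : ℝ}
    (h : ∀ s ∈ Ico 0 x, ∃ γ, IsLiftOn f c (Icc 0 s) γ ∧ γ 0 = p) (hx : 0 < x) :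
    ∃ γ, IsLiftOn f c (Ico 0 x) γ ∧ γ 0 = p := by
  have : Nonempty (ℝ → S) := ⟨fun _ => p⟩
  choose! γ hγ hγ0 using h
  have heq : ∀ m ∈ Ico 0 x, EqOn (fun s => γ s s) (γ m) (Icc 0 m) := by
    intro m hm s hs
    have hsx : s ∈ Ico 0 x := ⟨hs.1, hs.2.trans_lt hm.2⟩
    exact (hγ s hsx).eqOn hf ((hγ m hm).mono (Icc_subset_Icc_right hs.2))
      (by rw [hγ0 s hsx, hγ0 m hm]) hs.1 (right_mem_Icc.2 hs.1)
  refine ⟨fun s => γ s s, ⟨fun s hs => ?_, fun s hs => (hγ s hs).lifts s (right_mem_Icc.2 hs.1)⟩,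
    hγ0 0 ⟨le_rfl, hx⟩⟩
  obtain ⟨m, hsm, hmx⟩ := exists_between hs.2
  have hm : m ∈ Ico 0 x := ⟨hs.1.trans hsm.le, hmx⟩
  have h1 := ((hγ m hm).continuousOn.congr (heq m hm)) s ⟨hs.1, hsm.le⟩
  refine h1.mono_of_mem_nhdsWithin ?_
  filter_upwards [self_mem_nhdsWithin, mem_nhdsWithin_of_mem_nhds (Iio_mem_nhds hsm)] with y hy hym
  exact ⟨hy.1, le_of_lt hym⟩

/-- A path lifts along a local homeomorphism if its partial lifts have endpoints. -/
theorem exists_apply_eq_one [T2Space K] (hf : IsLocalHomeomorph f) (hc : Continuous c) {p : S}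
    (hp : f p = c 0)
    (hend : ∀ x, 0 < x → ∀ γ : ℝ → S, IsLiftOn f c (Ico 0 x) γ →
      ∃ p', Filter.Tendsto γ (𝓝[<] x) (𝓝 p')) : ∃ p', f p' = c 1 := by
  set T : Set ℝ := {t | ∃ γ, IsLiftOn f c (Icc 0 t) γ ∧ γ 0 = p} with hT
  have hdown : ∀ s t, s ≤ t → t ∈ T → s ∈ T := by
    rintro s t hst ⟨γ, hγ, h0⟩
    exact ⟨γ, hγ.mono (Icc_subset_Icc_right hst), h0⟩
  have h0T : (0 : ℝ) ∈ T := ⟨fun _ => p, ⟨continuousOn_const, fun s hs => by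
    obtain rfl : s = 0 := le_antisymm hs.2 hs.1
    exact hp⟩, rfl⟩
  -- Below a limit point x all partial lifts exist. They glue to a lift on [0,x), which `hend`
  -- completes by its endpoint.
  have hclosed : IsClosed (T ∩ Icc 0 1) := by
    refine isClosed_of_closure_subset fun x hx => ?_
    have hxI : x ∈ Icc (0 : ℝ) 1 := isClosed_Icc.closure_subset_iff.2 inter_subset_right hx
    refine ⟨?_, hxI⟩
    by_contra hxT
    have hx0 : 0 < x := hxI.1.lt_of_ne (by rintro rfl; exact hxT h0T)
    have hlt : ∀ s ∈ Ico 0 x, s ∈ T := by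
      intro s hs
      obtain ⟨y, hy, hyT, -⟩ := mem_closure_iff.1 hx (Ioi s) isOpen_Ioi hs.2
      exact hdown s y (le_of_lt hy) hyT
    obtain ⟨γ, hγ, hγ0⟩ := exists_isLiftOn_Ico hf hlt hx0
    obtain ⟨p', hp'⟩ := hend x hx0 γ hγ
    have hIco : 𝓝[<] x = 𝓝[Ico 0 x] x := (nhdsWithin_Ico_eq_nhdsLT hx0).symm
    have hne : (𝓝[Ico 0 x] x).NeBot := by rw [← hIco]; infer_instance
    have hsd : Icc 0 x \ {x} = Ico 0 x := by ext; simp [lt_iff_le_and_ne]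
    refine hxT ⟨Function.update γ x p', ⟨?_, ?_⟩, ?_⟩
    · rw [continuousOn_update_iff, hsd]
      exact ⟨hγ.continuousOn, fun _ => hIco ▸ hp'⟩
    · intro s hs
      rcases hs.2.eq_or_lt with rfl | h
      · rw [Function.update_self]
        rw [hIco] at hp'
        refine tendsto_nhds_unique_of_eventuallyEq ((hf.continuous.tendsto p').comp hp')
          ((hc.tendsto s).mono_left nhdsWithin_le_nhds) ?_
        filter_upwards [self_mem_nhdsWithin] with r hr using hγ.lifts r hr
      · rw [Function.update_of_ne h.ne]
        exact hγ.lifts s ⟨hs.1, h⟩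
    · rw [Function.update_of_ne hx0.ne, hγ0]
  have hall := hclosed.Icc_subset_of_forall_exists_gt h0T (by
    rintro x ⟨⟨γ, hγ, h0⟩, hx⟩ y hy
    obtain ⟨t', ht', γ', hγ', h0'⟩ := hγ.extend hf hc hx.1 hy
    exact ⟨t', ⟨γ', hγ', h0'.trans h0⟩, ht'⟩)
  obtain ⟨γ, hγ, -⟩ := hall (right_mem_Icc.2 zero_le_one)
  exact ⟨γ 1, hγ.lifts 1 (right_mem_Icc.2 zero_le_one)⟩

end PathLifting

section Surjectivity

open Set

variable {G : Type*} [TopologicalSpace G] [ChartedSpace E3 G] [Group G] [LieGroup 𝓘(ℝ, E3) ∞ G]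
  {D : DiagonalMetric G} {S : Type*} [TopologicalSpace S] [T2Space S] [ChartedSpace E2 S]
  [IsManifold 𝓘(ℝ, E2) ∞ S]
  {K : Type*} [TopologicalSpace K] [T2Space K] [ChartedSpace E2 K]

omit [T2Space S] [IsManifold 𝓘(ℝ, E2) ∞ S] [T2Space K] in
theorem IsLiftOn.smoothAt {f : S → K} (hf : IsLocalDiffeomorph 𝓘(ℝ, E2) 𝓘(ℝ, E2) ∞ f) {c : ℝ → K}
    (hc : ∀ t, ModelSmoothAt ℝ E2 ∞ c t) {J : Set ℝ} {γ : ℝ → S} (h : IsLiftOn f c J γ) {s : ℝ}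
    (hs : J ∈ 𝓝 s) : ModelSmoothAt ℝ E2 ∞ γ s := by
  obtain ⟨e, he, hfe⟩ := hf (γ s)
  have hcs : c s = e (γ s) := by rw [← h.lifts s (mem_of_mem_nhds hs), hfe he]
  have h1 : ModelSmoothAt E2 E2 ∞ e.symm (c s) := by
    rw [hcs]
    exact e.symm.contMDiffOn_toFun.contMDiffAt (e.open_target.mem_nhds (e.map_source he))
  refine (ModelSmoothAt.compose (g := e.symm) (f := c) h1 (hc s)).congr_of_eventuallyEq ?_
  filter_upwards [hs, (h.continuousOn.continuousAt hs) (e.open_source.mem_nhds he)] with t ht hte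
  rw [← h.lifts t ht, hfe hte]
  exact (e.left_inv hte).symm

omit [IsManifold 𝓘(ℝ, E2) ∞ S] in
/-- A path of constant logarithmic derivative lifts to a complete surface. -/
theorem ImmersedSurface.IsCompleteFor.exists_apply_eq_one {φ : ImmersedSurface D S} {q : E3 → ℝ}
    (hq : φ.IsCompleteFor q) {f : S → K} (hf : IsLocalDiffeomorph 𝓘(ℝ, E2) 𝓘(ℝ, E2) ∞ f)
    {ι : K → G} {g : G} (hφ : ∀ p, φ.toFun p = g * ι (f p)) {c : ℝ → K}
    (hc : ∀ t, ModelSmoothAt ℝ E2 ∞ c t) (hιc : ∀ t, ModelDiffAt ℝ E3 (fun t => ι (c t)) t) {V : E3}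
    (hV : ∀ t, leftDeriv ℝ E3 (fun t => ι (c t)) t 1 = V) {p : S} (hp : f p = c 0) :
    ∃ p', f p' = c 1 := by
  have hcc : Continuous c := continuous_iff_continuousAt.2 fun t => (hc t).continuousAt
  refine _root_.exists_apply_eq_one hf.isLocalHomeomorph hcc hp fun x hx γ hγ => ?_
  -- Completeness concerns curves on (0,1), so the partial lift on [0,x) is rescaled.
  have hmap : ∀ t ∈ Ioo (0 : ℝ) 1, x * t ∈ Ioo 0 x := fun t ht =>
    ⟨mul_pos hx ht.1, by simpa using mul_lt_mul_of_pos_left ht.2 hx⟩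
  have hlin : ∀ t, HasDerivAt (fun t : ℝ => x * t) x t := fun t => by
    simpa using (hasDerivAt_id t).const_mul x
  have hγs : ∀ t ∈ Ioo (0 : ℝ) 1, ModelSmoothAt ℝ E2 ∞ (fun t => γ (x * t)) t := by
    intro t ht
    refine ModelSmoothAt.compose (g := γ) (f := fun t : ℝ => x * t) ?_
      (contDiff_const.mul contDiff_id).contDiffAt.contMDiffAt
    exact hγ.smoothAt hf hc (Filter.mem_of_superset (Ioo_mem_nhds (hmap t ht).1 (hmap t ht).2)
      Ioo_subset_Ico_self)
  -- The left-translated velocity of the lift is the constant xV. Its length element is therefore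
  -- constant, hence integrable, whatever q is.
  have hpush : ∀ t ∈ Ioo (0 : ℝ) 1, φ.push (γ (x * t))
      (mfderiv 𝓘(ℝ, ℝ) 𝓘(ℝ, E2) (fun t => γ (x * t)) t (1 : ℝ)) = x • V := by
    intro t ht
    have h1 := leftDeriv_comp (f := φ.toFun) (u := fun t => γ (x * t)) (x := t)
      ((φ.smooth _).mdifferentiableAt (by simp)) ((hγs t ht).mdifferentiableAt (by simp))
    have h2 : leftDeriv ℝ E3 (fun t => φ.toFun (γ (x * t))) t
        = leftDeriv ℝ E3 (fun t => g * ι (c (x * t))) t := by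
      refine leftDeriv_congr ?_
      filter_upwards [Ioo_mem_nhds ht.1 ht.2] with s hs
      rw [hφ, hγ.lifts _ (Ioo_subset_Ico_self (hmap s hs))]
    have h3 : leftDeriv ℝ E3 (fun t => ι (c (x * t))) t 1 = x • V := by
      rw [leftDeriv_comp (f := fun t => ι (c t)) (u := fun t : ℝ => x * t) (hιc _)
        (hlin t).differentiableAt.mdifferentiableAt, ContinuousLinearMap.comp_apply,
        modelDeriv_eq_fderiv, fderiv_apply_one_eq_deriv, (hlin t).deriv, ← hV (x * t)]
      rw [← map_smul, smul_eq_mul, mul_one]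
    rw [leftDeriv_const_mul, h1] at h2
    rw [← h3, ← h2]
    rfl
  obtain ⟨p', hp'⟩ := hq (fun t => γ (x * t))
    (fun t ht => ((hγs t ht).of_le (by simp)).contMDiffWithinAt) (by
      refine (MeasureTheory.integrableOn_congr_fun (fun t ht => ?_) measurableSet_Ioo).2
        (MeasureTheory.integrableOn_const (C := √(q (x • V))) (by simp))
      exact congrArg (fun w => √(q w)) (hpush t ht))
  refine ⟨p', ?_⟩
  have hdiv : Filter.Tendsto (fun t => x⁻¹ * t) (𝓝[<] x) (𝓝[<] 1) := by
    refine tendsto_nhdsWithin_iff.2 ⟨?_, ?_⟩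
    · have : Filter.Tendsto (fun t => x⁻¹ * t) (𝓝 x) (𝓝 (x⁻¹ * x)) :=
        (continuous_const.mul continuous_id).tendsto x
      rw [inv_mul_cancel₀ hx.ne'] at this
      exact this.mono_left nhdsWithin_le_nhds
    · filter_upwards [self_mem_nhdsWithin] with t ht
      rw [mem_Iio, inv_mul_lt_iff₀ hx, mul_one]
      exact ht
  have := hp'.comp hdiv
  refine this.congr fun t => ?_
  simp [mul_inv_cancel_left₀ hx.ne']

end Surjectivity
end

noncomputable section

/-! ### Surfaces with constant angle functions: completeness and covering. -/

section ConstantAngle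

/-- A binary form without nonzero null vectors has PR - Q² > 0. Completing the square in P·q and in
R·q then bounds b² and a² by |q|. -/
theorem exists_binaryForm_bound {P Q R : ℝ}
    (h : ∀ a b : ℝ, P * a ^ 2 + 2 * Q * (a * b) + R * b ^ 2 = 0 → a = 0 ∧ b = 0) :
    ∃ C, ∀ a b : ℝ, |a| + |b| ≤ C * √|P * a ^ 2 + 2 * Q * (a * b) + R * b ^ 2| := by
  have hP : P ≠ 0 := fun hP => one_ne_zero (h 1 0 (by simp [hP])).1
  have hΔ : 0 < P * R - Q ^ 2 := by
    by_contra hle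
    have hs := Real.sq_sqrt (show 0 ≤ Q ^ 2 - P * R by linarith)
    -- If the discriminant were nonnegative, this root of the form would be a null vector with
    -- second entry P ≠ 0.
    exact hP (h (-Q + √(Q ^ 2 - P * R)) P (by linear_combination P * hs)).2
  refine ⟨√(|P| / (P * R - Q ^ 2)) + √(|R| / (P * R - Q ^ 2)), fun a b => ?_⟩
  have key : ∀ x A : ℝ, x ^ 2 * (P * R - Q ^ 2)
      ≤ |A * (P * a ^ 2 + 2 * Q * (a * b) + R * b ^ 2)| →
      |x| ≤ √(|A| / (P * R - Q ^ 2)) * √|P * a ^ 2 + 2 * Q * (a * b) + R * b ^ 2| := by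
    intro x A hx
    rw [← Real.sqrt_mul (by positivity)]
    apply Real.abs_le_sqrt
    rw [div_mul_eq_mul_div, le_div_iff₀ hΔ, ← abs_mul]
    exact hx
  have hb := key b P (le_trans (by nlinarith [sq_nonneg (P * a + Q * b)]) (le_abs_self _))
  have ha := key a R (le_trans (by nlinarith [sq_nonneg (R * b + Q * a)]) (le_abs_self _))
  linarith

variable {G : Type*} [TopologicalSpace G] [ChartedSpace E3 G] [Group G] [LieGroup 𝓘(ℝ, E3) ∞ G]
  {D : DiagonalMetric G}

/-- The immersed surface with a given constant normal. -/
def ImmersedSurface.ofConstantAngles {K : Type*} [TopologicalSpace K] [ChartedSpace E2 K]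
    {ι : K → G} (hs : ∀ k, ModelSmoothAt E2 E3 ∞ ι k)
    (hinj : ∀ k, Function.Injective (leftDeriv E2 E3 ι k)) {ν : Fin 3 → ℝ} {δ : ℝ}
    (hδ : δ = 1 ∨ δ = -1) (hν : ∑ i, D.ε i * ν i ^ 2 = δ)
    (htan : ∀ k v, ∑ i, ν i * D.crd i (leftDeriv E2 E3 ι k v) = 0) : ImmersedSurface D K where
  toFun := ι
  gauss _ := D.vec fun i => D.ε i * ν i
  sgn := δ
  smooth := hs
  immersive k := (injective_iff_map_eq_zero (modelDeriv E2 E3 ι k)).2 fun v hv =>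
    (injective_iff_map_eq_zero _).1 (hinj k) v
      ((modelDeriv_apply_eq_zero_iff ((hs k).mdifferentiableAt (by simp)) v).1 hv)
  gauss_smooth _ := contMDiff_const
  sgn_sign := hδ
  gauss_unit _ := by
    refine (D.metric_eq _ _).trans ((Finset.sum_congr rfl fun i _ => ?_).trans hν)
    rw [D.crd_vec]
    linear_combination D.ε i * ν i ^ 2 * D.eps_sq i
  gauss_normal k v := by
    refine (D.metric_eq _ _).trans ((Finset.sum_congr rfl fun i _ => ?_).trans (htan k v))
    rw [D.crd_vec, ← mul_assoc, D.eps_sq, one_mul]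
    rfl

variable {l : ℝ} {X Y Z : E3} {Φ : E2 → G} {K : Type*} [TopologicalSpace K] [ChartedSpace E2 K]
  [Group K] [LieGroup 𝓘(ℝ, E2) ∞ K] {π : E2 → K} {ι : K →* G}

omit [LieGroup 𝓘(ℝ, E2) ∞ K] in
theorem PlaneCover.exists_leftDeriv_eq (hK : PlaneCover l Φ π ι) (h : IsPlaneMap l X Y Φ)
    (a b : ℝ) : ∃ k v, leftDeriv E2 E3 ι k v = a • X + b • Y := by
  refine ⟨π 0, modelDeriv E2 E2 π 0 !₂[a, b], ?_⟩
  rw [← ContinuousLinearMap.comp_apply, hK.leftDeriv_ι_comp h, h.leftDeriv_apply]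
  simp

theorem PlaneCover.isCompleteFor (hK : PlaneCover l Φ π ι) (h : IsPlaneMap l X Y Φ)
    (hB : Function.Bijective (frameMap Z X Y)) {F : ImmersedSurface D K} (hF : F.toFun = ι)
    {q : E3 → ℝ} {C : ℝ} (hC : ∀ a b : ℝ, |a| + |b| ≤ C * √(q (a • X + b • Y))) :
    F.IsCompleteFor q := by
  intro γ hγ hi
  refine hK.exists_tendsto h hB
    (fun t ht => (hγ t ht).contMDiffAt (Ioo_mem_nhds ht.1 ht.2)) hC ?_
  rw [← hF]
  exact hi

/-- In either branch the relevant form has no nonzero null vector on the span of X and Y. In the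
definite case this is the hypothesis, since each vector of the plane occurs as a tangent vector;
otherwise the form is Euclidean. The resulting bound on coordinates is what `exists_tendsto` needs.
-/
theorem PlaneCover.isComplete (hK : PlaneCover l Φ π ι) (h : IsPlaneMap l X Y Φ)
    (hB : Function.Bijective (frameMap Z X Y)) {F : ImmersedSurface D K} (hF : F.toFun = ι) :
    F.IsComplete := by
  have hXY : ∀ a b : ℝ, a • X + b • Y = 0 → a = 0 ∧ b = 0 := by
    intro a b hab
    have := @hB.1 (0, !₂[a, b]) 0 (by simpa [frameMap_apply] using hab)
    have h2 := congrArg Prod.snd this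
    exact ⟨congrArg (fun w : E2 => w 0) h2, congrArg (fun w : E2 => w 1) h2⟩
  have hcrd : ∀ (a b : ℝ) i, D.crd i (a • X + b • Y) = a * D.crd i X + b * D.crd i Y :=
    fun a b i => by simp
  unfold ImmersedSurface.IsComplete
  split_ifs with hdef
  · have hq : ∀ a b : ℝ, D.metric (a • X + b • Y : E3) (a • X + b • Y : E3)
        = (∑ i, D.ε i * D.crd i X ^ 2) * a ^ 2
          + 2 * (∑ i, D.ε i * (D.crd i X * D.crd i Y)) * (a * b)
          + (∑ i, D.ε i * D.crd i Y ^ 2) * b ^ 2 := by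
      intro a b
      refine (D.metric_eq _ _).trans ?_
      simp only [Fin.sum_univ_three, hcrd]
      ring
    obtain ⟨C, hC⟩ := exists_binaryForm_bound (P := ∑ i, D.ε i * D.crd i X ^ 2)
      (Q := ∑ i, D.ε i * (D.crd i X * D.crd i Y)) (R := ∑ i, D.ε i * D.crd i Y ^ 2) (by
        intro a b hab
        rw [← hq] at hab
        obtain ⟨k, v, hkv⟩ := hK.exists_leftDeriv_eq h a b
        by_contra hne
        have hv : v ≠ 0 := by
          rintro rfl
          rw [_root_.map_zero] at hkv
          exact hne (hXY a b hkv.symm)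
        refine hdef k v hv ?_
        have : F.push k v = (a • X + b • Y : E3) := by
          rw [← hkv, ← hF]; rfl
        rw [this]
        exact hab)
    refine hK.isCompleteFor h hB hF (C := C) fun a b => ?_
    have := hC a b
    rwa [← hq] at this
  · have hq : ∀ a b : ℝ, ∑ i, D.crd i (a • X + b • Y) ^ 2
        = (∑ i, D.crd i X ^ 2) * a ^ 2
          + 2 * (∑ i, D.crd i X * D.crd i Y) * (a * b) + (∑ i, D.crd i Y ^ 2) * b ^ 2 := by
      intro a b
      simp only [Fin.sum_univ_three, hcrd]
      ring
    obtain ⟨C, hC⟩ := exists_binaryForm_bound (P := ∑ i, D.crd i X ^ 2)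
      (Q := ∑ i, D.crd i X * D.crd i Y) (R := ∑ i, D.crd i Y ^ 2) (by
        intro a b hab
        rw [← hq] at hab
        refine hXY a b (D.crd_ext fun i => ?_)
        rw [Finset.sum_eq_zero_iff_of_nonneg fun i _ => sq_nonneg _] at hab
        rw [_root_.map_zero]
        exact pow_eq_zero_iff two_ne_zero |>.1 (hab i (Finset.mem_univ i)))
    refine hK.isCompleteFor h hB hF (C := C) fun a b => ?_
    have := hC a b
    rw [← hq, abs_of_nonneg (Finset.sum_nonneg fun i _ => sq_nonneg (D.crd i _))] at this
    exact this

variable {S : Type*} [TopologicalSpace S] [ChartedSpace E2 S] [IsManifold 𝓘(ℝ, E2) ∞ S]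

/-- The injective differential of φ factors through that of ψ, and both manifolds have dimension 2.
-/
theorem PlaneCover.isLocalDiffeomorph_of_lift (hK : PlaneCover l Φ π ι) (h : IsPlaneMap l X Y Φ)
    {φ : ImmersedSurface D S} {ψ : S → K} (hψ : ∀ p, ModelSmoothAt E2 E2 ∞ ψ p) {g : G}
    (hφ : ∀ p, φ.toFun p = g * ι (ψ p)) : IsLocalDiffeomorph 𝓘(ℝ, E2) 𝓘(ℝ, E2) ∞ ψ := by
  have hfun : φ.toFun = fun p => g * ι (ψ p) := funext hφ
  refine isLocalDiffeomorph_of_injective hψ fun p => ?_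
  have h1 : leftDeriv E2 E3 φ.toFun p
      = (leftDeriv E2 E3 ι (ψ p)).comp (modelDeriv E2 E2 ψ p) := by
    rw [← leftDeriv_comp (f := ι) (u := ψ) ((hK.smooth_ι h _).mdifferentiableAt (by simp))
      ((hψ p).mdifferentiableAt (by simp)), hfun, leftDeriv_const_mul]
  have h2 := φ.leftDeriv_injective p
  rw [h1, ContinuousLinearMap.coe_comp] at h2
  exact h2.of_comp

-- Any two points of K are joined by a one-parameter curve in the direction X followed by one in the
-- direction Y, and each of them lifts to a complete surface. Which quadratic form defines
-- completeness plays no role.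
omit [IsManifold 𝓘(ℝ, E2) ∞ S] in
theorem PlaneCover.surjective_of_isComplete [T2Space S] [T2Space K] [Nonempty S]
    (hK : PlaneCover l Φ π ι) (h : IsPlaneMap l X Y Φ) {φ : ImmersedSurface D S} {ψ : S → K}
    (hψ : IsLocalDiffeomorph 𝓘(ℝ, E2) 𝓘(ℝ, E2) ∞ ψ) {g : G} (hφ : ∀ p, φ.toFun p = g * ι (ψ p))
    (hc : φ.IsComplete) : Function.Surjective ψ := by
  obtain ⟨q, hq⟩ : ∃ q : E3 → ℝ, φ.IsCompleteFor q := by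
    unfold ImmersedSurface.IsComplete at hc
    split_ifs at hc
    exacts [⟨_, hc⟩, ⟨_, hc⟩]
  have hlin : ∀ r t : ℝ, HasDerivAt (fun t => t * r) r t := fun r t => by
    simpa using (hasDerivAt_id t).mul_const r
  have hsm : ∀ (k : K) (w : ℝ → E2), ContDiff ℝ ∞ w →
      ∀ t, ModelSmoothAt ℝ E2 ∞ (fun t => k * π (w t)) t := fun k w hw t =>
    ModelSmoothAt.const_mul le_rfl _
      (ModelSmoothAt.compose (g := π) (f := w) (hK.smooth _) hw.contDiffAt.contMDiffAt)
  have hcd : ∀ u v : ℝ, ContDiff ℝ ∞ fun t : ℝ => (!₂[t * u, t * v] : E2) := by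
    intro u v
    rw [contDiff_euclidean]
    intro i
    fin_cases i
    · exact contDiff_id.mul contDiff_const
    · exact contDiff_id.mul contDiff_const
  -- With one of u, v zero the term l·(tv)·u disappears, so the straight segment has constant
  -- logarithmic derivative.
  have hstep : ∀ (u v : ℝ), (u = 0 ∨ v = 0) → ∀ p : S,
      ∃ p', ψ p' = ψ p * π !₂[u, v] := by
    intro u v huv p
    have hι : ∀ t : ℝ, ModelDiffAt ℝ E3 (fun t => Φ !₂[t * u, t * v]) t ∧
        leftDeriv ℝ E3 (fun t => Φ !₂[t * u, t * v]) t 1 = u • X + v • Y := by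
      intro t
      obtain ⟨h1, h2⟩ := h.leftDeriv_curve (hlin u t) (hlin v t)
      refine ⟨h1, h2.trans ?_⟩
      rcases huv with rfl | rfl <;> simp
    have hfun : (fun t : ℝ => ι (ψ p * π !₂[t * u, t * v]))
        = fun t => ι (ψ p) * Φ !₂[t * u, t * v] := funext fun t => by
      rw [_root_.map_mul, hK.comp]
    obtain ⟨p', hp'⟩ := hq.exists_apply_eq_one (p := p) hψ hφ
      (c := fun t : ℝ => ψ p * π !₂[t * u, t * v]) (V := u • X + v • Y)
      (hsm _ _ (hcd u v))
      (fun t => by rw [hfun]; exact (hι t).1.const_mul _)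
      (fun t => by rw [hfun, leftDeriv_const_mul]; exact (hι t).2) (by
        have : (!₂[(0 : ℝ) * u, 0 * v] : E2) = 0 := AffPlane.plane_ext (by simp) (by simp)
        simp only [this, hK.map_zero, mul_one])
    exact ⟨p', by simpa using hp'⟩
  intro k
  obtain ⟨p₀⟩ := ‹Nonempty S›
  obtain ⟨x, hx⟩ := hK.surjective ((ψ p₀)⁻¹ * k)
  obtain ⟨p₁, h₁⟩ := hstep (x 0) 0 (Or.inr rfl) p₀
  obtain ⟨p₂, h₂⟩ := hstep 0 (x 1) (Or.inl rfl) p₁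
  refine ⟨p₂, ?_⟩
  have : AffPlane.mulMap l !₂[x 0, 0] !₂[0, x 1] = x := AffPlane.plane_ext (by simp) (by simp)
  rw [h₂, h₁, mul_assoc, ← hK.map_mul, this, hx, mul_inv_cancel_left]

end ConstantAngle

section Existence

variable {G : Type*} [TopologicalSpace G] [T2Space G] [ChartedSpace E3 G] [Group G]
  [LieGroup 𝓘(ℝ, E3) ∞ G] (D : DiagonalMetric G)

omit [T2Space G] [LieGroup 𝓘(ℝ, E3) ∞ G] in
theorem DiagonalMetric.ne_zero_of_sum {ν : Fin 3 → ℝ} {δ : ℝ} (hδ : δ = 1 ∨ δ = -1)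
    (hν : ∑ i, D.ε i * ν i ^ 2 = δ) : ν ≠ 0 := by
  rintro rfl
  rcases hδ with rfl | rfl <;> simp at hν

/-- Connected two-dimensional subgroups with a given normal. -/
theorem DiagonalMetric.exists_planeCover {ν : Fin 3 → ℝ} (hν : ν ≠ 0)
    (hc : ∑ i, D.c i * ν i ^ 2 = 0) :
    ∃ (l : ℝ) (X Y Z : E3) (Φ : E2 → G) (K : Type) (_ : TopologicalSpace K) (_ : T2Space K)
      (_ : SecondCountableTopology K) (_ : ConnectedSpace K) (_ : ChartedSpace E2 K) (_ : Group K)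
      (_ : LieGroup 𝓘(ℝ, E2) ∞ K) (π : E2 → K) (ι : K →* G),
      IsPlaneMap l X Y Φ ∧ PlaneCover l Φ π ι ∧ Function.Bijective (frameMap Z X Y) ∧
      ∀ V, V ∈ Submodule.span ℝ {X, Y} ↔ ∑ i, ν i * D.crd i V = 0 := by
  obtain ⟨l, X, Y, Z, hl, hB, hV⟩ := D.exists_frame hν hc
  obtain ⟨Φ, hΦ⟩ := exists_isPlaneMap (G := G) l X Y hl
  obtain ⟨K, i1, i2, i3, i4, i5, i6, i7, π, ι, hK⟩ := hΦ.exists_planeCover hB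
  exact ⟨l, X, Y, Z, Φ, K, i1, i2, i3, i4, i5, i6, i7, π, ι, hΦ, hK, hB, hV⟩

theorem exists_complete_surface {ν : Fin 3 → ℝ} {δ : ℝ} (hδ : δ = 1 ∨ δ = -1)
    (hν : ∑ i, D.ε i * ν i ^ 2 = δ) (hc : ∑ i, D.c i * ν i ^ 2 = 0) :
    ∃ (S₀ : Type) (_ : TopologicalSpace S₀) (_ : T2Space S₀) (_ : SecondCountableTopology S₀)
      (_ : ConnectedSpace S₀) (_ : ChartedSpace E2 S₀) (_ : IsManifold 𝓘(ℝ, E2) ∞ S₀)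
      (F : ImmersedSurface D S₀),
      F.IsComplete ∧ Function.Injective F.toFun ∧ (∀ i p, F.angle i p = ν i) ∧
      ∀ (S : Type v) [TopologicalSpace S] [T2Space S] [ConnectedSpace S] [ChartedSpace E2 S]
        [IsManifold 𝓘(ℝ, E2) ∞ S] (φ : ImmersedSurface D S),
        (∀ i p, φ.angle i p = ν i) →
        ∃ (g : G) (ψ : S → S₀), IsLocalDiffeomorph 𝓘(ℝ, E2) 𝓘(ℝ, E2) ∞ ψ ∧
          (∀ p, φ.toFun p = g * F.toFun (ψ p)) ∧
          (φ.IsComplete → Function.Surjective ψ) := by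
  obtain ⟨l, X, Y, Z, Φ, K, i1, i2, i3, i4, i5, i6, i7, π, ι, hΦ, hK, hB, hV⟩ :=
    D.exists_planeCover (D.ne_zero_of_sum hδ hν) hc
  refine ⟨K, i1, i2, i3, i4, i5, inferInstance,
    ImmersedSurface.ofConstantAngles (hK.smooth_ι hΦ) (hK.leftDeriv_ι_injective hΦ hB) hδ hν
      fun k v => (hV _).1 (hK.leftDeriv_ι_mem hΦ k v),
    hK.isComplete hΦ hB rfl, hK.injective, fun i p => ?_, ?_⟩
  · rw [ImmersedSurface.angle_eq]
    change D.ε i * D.crd i (D.vec fun i => D.ε i * ν i) = ν i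
    rw [D.crd_vec, ← mul_assoc, D.eps_sq, one_mul]
  · intro S _ _ _ _ _ φ hφ
    obtain ⟨p₀⟩ : Nonempty S := inferInstance
    obtain ⟨ψ, hψ, hψφ⟩ := hK.exists_lift (F := E2) hΦ hB (φ := φ.toFun) φ.smooth (fun p v => by
      rw [hV]
      simpa only [hφ] using φ.sum_angle_mul_crd p v) p₀
    have hloc := hK.isLocalDiffeomorph_of_lift hΦ hψ hψφ
    exact ⟨φ.toFun p₀, ψ, hloc, hψφ, fun hcomp =>
      hK.surjective_of_isComplete hΦ hloc hψφ hcomp⟩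

end Existence
end

noncomputable section

/-! ### Surfaces inside a coset are tangent to it: Hausdorff dimension. -/

section Dimension

variable {F : Type*} [NormedAddCommGroup F] [NormedSpace ℝ F] [FiniteDimensional ℝ F]
  {M : Type*} [TopologicalSpace M] [ChartedSpace F M] [IsManifold 𝓘(ℝ, F) ∞ M]

/-- The Hausdorff dimension of a smooth image of a second countable manifold. -/
theorem dimH_image_le_finrank [SecondCountableTopology M] {E' : Type*} [NormedAddCommGroup E']
    [NormedSpace ℝ E'] {f : M → E'} {O : Set M} (hf : ∀ q ∈ O, ModelSmoothAt F E' ∞ f q) :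
    dimH (f '' O) ≤ Module.finrank ℝ F := by
  have hloc : ∀ q ∈ O, ∃ U ∈ 𝓝 q, dimH (f '' U) ≤ Module.finrank ℝ F := by
    intro q hq
    have hs := mem_extChartAt_source (I := 𝓘(ℝ, F)) q
    have ht := mem_extChartAt_target (I := 𝓘(ℝ, F)) q
    have h1 : ModelSmoothAt F E' ∞ (fun y => f (chartFrom F q y)) (chartTo F q q) := by
      refine ModelSmoothAt.compose (g := f) (f := chartFrom F q) ?_ (smoothAt_chartFrom ht)
      rw [chartFrom_chartTo hs]
      exact hf q hq
    have h2 : ContDiffAt ℝ 1 (fun y => f (chartFrom F q y)) (chartTo F q q) :=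
      (contMDiffAt_iff_contDiffAt.1 h1).of_le (by simp)
    obtain ⟨u, hu, hfu⟩ := h2.contDiffOn le_rfl (by simp)
    obtain ⟨r, hr, hru⟩ := Metric.mem_nhds_iff.1 hu
    refine ⟨(extChartAt 𝓘(ℝ, F) q).source ∩ chartTo F q ⁻¹' Metric.ball (chartTo F q q) r,
      Filter.inter_mem (extChartAt_source_mem_nhds q)
        ((continuousAt_extChartAt q).preimage_mem_nhds (Metric.ball_mem_nhds _ hr)), ?_⟩
    calc dimH (f '' _) ≤ dimH ((fun y => f (chartFrom F q y)) '' Metric.ball (chartTo F q q) r) := by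
          apply dimH_mono
          rintro _ ⟨q', ⟨hq', hq''⟩, rfl⟩
          exact ⟨chartTo F q q', hq'', congrArg f (chartFrom_chartTo hq')⟩
      _ ≤ dimH (Metric.ball (chartTo F q q) r) :=
          (hfu.mono hru).dimH_image_le (convex_ball _ _) subset_rfl
      _ ≤ Module.finrank ℝ F := by
          rw [← Real.dimH_univ_eq_finrank F]
          exact dimH_mono (Set.subset_univ _)
  -- Second countability allows countably many of these neighbourhoods to cover, and Hausdorff
  -- dimension of a countable union is the supremum.
  choose! U hU hUd using hloc
  obtain ⟨t, htO, htc, hcov⟩ :=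
    TopologicalSpace.countable_cover_nhdsWithin fun q hq => mem_nhdsWithin_of_mem_nhds (hU q hq)
  calc dimH (f '' O) ≤ dimH (⋃ q ∈ t, f '' U q) := by
        apply dimH_mono
        rw [← Set.image_iUnion₂]
        exact Set.image_mono hcov
    _ = ⨆ q ∈ t, dimH (f '' U q) := dimH_bUnion htc _
    _ ≤ Module.finrank ℝ F := iSup₂_le fun q hq => hUd q (htO hq)

end Dimension

section Tangency

variable {G : Type*} [TopologicalSpace G] [ChartedSpace E3 G] [Group G] [LieGroup 𝓘(ℝ, E3) ∞ G]
  {S : Type*} [TopologicalSpace S] [ChartedSpace E2 S] [IsManifold 𝓘(ℝ, E2) ∞ S]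
  {K : Type*} [TopologicalSpace K] [ChartedSpace E2 K] [Group K] [LieGroup 𝓘(ℝ, E2) ∞ K]

theorem surjective_coprod_of_notMem_range {A B : E2 →L[ℝ] E3} (hB : Function.Injective B) {v : E2}
    (hv : A v ∉ LinearMap.range B.toLinearMap) : Function.Surjective fun w : E2 × E2 => A w.1 + B w.2 := by
  have hlt : LinearMap.range B.toLinearMap
      < LinearMap.range A.toLinearMap ⊔ LinearMap.range B.toLinearMap :=
    lt_of_le_of_ne le_sup_right fun h => hv (h ▸ Submodule.mem_sup_left ⟨v, rfl⟩)
  have h2 : Module.finrank ℝ (LinearMap.range B.toLinearMap) = 2 := by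
    rw [LinearMap.finrank_range_of_inj (f := B.toLinearMap) hB]; simp
  have h3 := Submodule.finrank_lt_finrank_of_lt hlt
  have htop : LinearMap.range A.toLinearMap ⊔ LinearMap.range B.toLinearMap = ⊤ := by
    apply Submodule.eq_top_of_finrank_eq
    have := Submodule.finrank_le (LinearMap.range A.toLinearMap ⊔ LinearMap.range B.toLinearMap)
    simp only [finrank_euclideanSpace, Fintype.card_fin] at this ⊢
    omega
  intro y
  have hy : y ∈ LinearMap.range A.toLinearMap ⊔ LinearMap.range B.toLinearMap := by
    rw [htop]; trivial
  obtain ⟨_, ⟨a, rfl⟩, _, ⟨b, rfl⟩, h⟩ := Submodule.mem_sup.1 hy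
  exact ⟨(a, b), h⟩

/-- A surface contained in a left coset of an immersed subgroup is tangent to it. -/
theorem leftDeriv_mem_range_of_subset_coset [SecondCountableTopology K] {ι : K →* G}
    (hι : ∀ k, ModelSmoothAt E2 E3 ∞ ι k) (hinj : Function.Injective (leftDeriv E2 E3 ι 1))
    {φ : S → G} (hφ : ∀ p, ModelSmoothAt E2 E3 ∞ φ p) {g : G} (hsub : ∀ p, ∃ k, φ p = g * ι k)
    (p : S) (v : E2) :
    leftDeriv E2 E3 φ p v ∈ LinearMap.range (leftDeriv E2 E3 ι 1).toLinearMap := by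
  by_contra hv
  have hsp := mem_extChartAt_source (I := 𝓘(ℝ, E2)) p
  have htp := mem_extChartAt_target (I := 𝓘(ℝ, E2)) p
  have hs1 := mem_extChartAt_source (I := 𝓘(ℝ, E2)) (1 : K)
  have ht1 := mem_extChartAt_target (I := 𝓘(ℝ, E2)) (1 : K)
  have hsG := mem_extChartAt_source (I := 𝓘(ℝ, E3)) (1 : G)
  set x₀ := chartTo E2 p p
  set y₀ := chartTo E2 (1 : K) 1
  set a : E2 → G := fun x => (φ p)⁻¹ * φ (chartFrom E2 p x) with ha
  set b : E2 → G := fun y => ι (chartFrom E2 (1 : K) y) with hb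
  have ha0 : a x₀ = 1 := by rw [ha]; simp only; rw [chartFrom_chartTo hsp, inv_mul_cancel]
  have hb0 : b y₀ = 1 := by rw [hb]; simp only; rw [chartFrom_chartTo hs1, map_one]
  have has : ModelSmoothAt E2 E3 ∞ a x₀ :=
    ModelSmoothAt.const_mul le_rfl _
      (ModelSmoothAt.compose (g := φ) (f := chartFrom E2 p) (hφ _) (smoothAt_chartFrom htp))
  have hbs : ModelSmoothAt E2 E3 ∞ b y₀ :=
    ModelSmoothAt.compose (g := ι) (f := chartFrom E2 (1 : K)) (hι _) (smoothAt_chartFrom ht1)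
  have had : leftDeriv E2 E3 a x₀ = leftDeriv E2 E3 φ p := by
    rw [ha, leftDeriv_const_mul, leftDeriv_comp (f := φ) (u := chartFrom E2 p)
      ((hφ _).mdifferentiableAt (by simp)) (diffAt_chartFrom htp), modelDeriv_chartFrom_self,
      chartFrom_chartTo hsp, ContinuousLinearMap.comp_id]
  have hbd : leftDeriv E2 E3 b y₀ = leftDeriv E2 E3 ι 1 := by
    rw [hb, leftDeriv_comp (f := ι) (u := chartFrom E2 (1 : K))
      ((hι _).mdifferentiableAt (by simp)) (diffAt_chartFrom ht1), modelDeriv_chartFrom_self,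
      chartFrom_chartTo hs1, ContinuousLinearMap.comp_id]
  have hfst : ModelSmoothAt (E2 × E2) E2 ∞ (fun z : E2 × E2 => z.1) (x₀, y₀) :=
    contDiffAt_fst.contMDiffAt
  have hsnd : ModelSmoothAt (E2 × E2) E2 ∞ (fun z : E2 × E2 => z.2) (x₀, y₀) :=
    contDiffAt_snd.contMDiffAt
  have ha' : ModelSmoothAt (E2 × E2) E3 ∞ (fun z : E2 × E2 => a z.1) (x₀, y₀) :=
    ModelSmoothAt.compose (g := a) (f := fun z : E2 × E2 => z.1) has hfst
  have hb' : ModelSmoothAt (E2 × E2) E3 ∞ (fun z : E2 × E2 => b z.2) (x₀, y₀) :=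
    ModelSmoothAt.compose (g := b) (f := fun z : E2 × E2 => z.2) hbs hsnd
  -- Multiplying the surface by the subgroup: the differential of f at the base point is the sum of
  -- the two differentials, which is onto if the tangent vector is transverse.
  set f : E2 × E2 → G := fun z => a z.1 * b z.2 with hf
  have hf0 : f (x₀, y₀) = 1 := by simp [hf, ha0, hb0]
  have hfs : ModelSmoothAt (E2 × E2) E3 ∞ f (x₀, y₀) := ModelSmoothAt.group_mul le_rfl ha' hb'
  have hfd : ∀ w, leftDeriv (E2 × E2) E3 f (x₀, y₀) w
      = leftDeriv E2 E3 φ p w.1 + leftDeriv E2 E3 ι 1 w.2 := by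
    intro w
    have h1 := leftDeriv_mul (f := fun z : E2 × E2 => a z.1) (g := fun z : E2 × E2 => b z.2)
      (ha'.mdifferentiableAt (by simp)) (hb'.mdifferentiableAt (by simp))
    have h2 := leftDeriv_comp (f := a) (u := fun z : E2 × E2 => z.1) (x := (x₀, y₀))
      (has.mdifferentiableAt (by simp)) (hfst.mdifferentiableAt (by simp))
    have h3 := leftDeriv_comp (f := b) (u := fun z : E2 × E2 => z.2) (x := (x₀, y₀))
      (hbs.mdifferentiableAt (by simp)) (hsnd.mdifferentiableAt (by simp))
    rw [modelDeriv_eq_fderiv, fderiv_fst] at h2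
    rw [modelDeriv_eq_fderiv, fderiv_snd] at h3
    rw [hf, h1, h2, h3, had, hbd, hb0, inv_one, adj_one]
    rfl
  have hfsrc : f (x₀, y₀) ∈ (extChartAt 𝓘(ℝ, E3) (1 : G)).source := by rw [hf0]; exact hsG
  have hsm : ContDiffAt ℝ ∞ (fun z => chartTo E3 (1 : G) (f z)) (x₀, y₀) := by
    rw [← contMDiffAt_iff_contDiffAt]
    exact ModelSmoothAt.compose (g := chartTo E3 (1 : G)) (f := f) (smoothAt_chartTo hfsrc) hfs
  have hder : fderiv ℝ (fun z => chartTo E3 (1 : G) (f z)) (x₀, y₀)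
      = leftDeriv (E2 × E2) E3 f (x₀, y₀) := by
    rw [fderiv_chartTo_comp (hfs.mdifferentiableAt (by simp)) hfsrc, hf0, invField_one,
      ContinuousLinearMap.id_comp]
  have hsurj : LinearMap.range (fderiv ℝ (fun z => chartTo E3 (1 : G) (f z)) (x₀, y₀)).toLinearMap
      = ⊤ := by
    rw [hder, LinearMap.range_eq_top]
    intro y
    obtain ⟨w, hw⟩ := surjective_coprod_of_notMem_range hinj hv y
    exact ⟨w, (hfd w).trans hw⟩
  have hopen := (hsm.hasStrictFDerivAt (by simp)).map_nhds_eq_of_surj hsurj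
  set O : Set K := {k | ι k ∈ (extChartAt 𝓘(ℝ, E3) (1 : G)).source} with hO
  -- The submersion f is open at the base point and takes values in ι(K), because both points of the
  -- surface lie in the same coset gι(K).
  have hmem : (fun k => chartTo E3 (1 : G) (ι k)) '' O ∈ 𝓝 (chartTo E3 (1 : G) (f (x₀, y₀))) := by
    rw [← hopen]
    have h1 : ∀ᶠ z in 𝓝 (x₀, y₀), f z ∈ (extChartAt 𝓘(ℝ, E3) (1 : G)).source :=
      hfs.continuousAt ((isOpen_extChartAt_source (1 : G)).mem_nhds hfsrc)
    rw [Filter.mem_map]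
    filter_upwards [h1] with z hz
    obtain ⟨k₁, hk₁⟩ := hsub p
    obtain ⟨k₂, hk₂⟩ := hsub (chartFrom E2 p z.1)
    have hfz : f z = ι (k₁⁻¹ * k₂ * chartFrom E2 (1 : K) z.2) := by
      simp only [hf, ha, hb, hk₁, hk₂, map_mul, map_inv]
      group
    exact ⟨_, by rw [hO, Set.mem_ofPred_eq, ← hfz]; exact hz,
      congrArg (chartTo E3 (1 : G)) hfz.symm⟩
  -- A neighbourhood in E3 has dimension 3, while the smooth image of a second countable surface has
  -- dimension at most 2.
  have hdim := Real.dimH_of_mem_nhds hmem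
  have hle : dimH ((fun k => chartTo E3 (1 : G) (ι k)) '' O) ≤ Module.finrank ℝ E2 :=
    dimH_image_le_finrank (F := E2) fun k hk =>
      ModelSmoothAt.compose (g := chartTo E3 (1 : G)) (f := ι) (smoothAt_chartTo hk) (hι k)
  rw [hdim] at hle
  simp only [finrank_euclideanSpace, Fintype.card_fin] at hle
  norm_num at hle

end Tangency

/-! ### Constant tangent plane implies constant normal. -/

section ConstantNormal

variable {G : Type*} [TopologicalSpace G] [ChartedSpace E3 G] [Group G] [LieGroup 𝓘(ℝ, E3) ∞ G]
  {D : DiagonalMetric G} {S : Type*} [TopologicalSpace S] [ChartedSpace E2 S]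
  [IsManifold 𝓘(ℝ, E2) ∞ S]

omit [LieGroup 𝓘(ℝ, E3) ∞ G] [IsManifold 𝓘(ℝ, E2) ∞ S] in
theorem ImmersedSurface.angle_smooth (φ : ImmersedSurface D S) (i : Fin 3) (p : S) :
    ModelSmoothAt E2 ℝ ∞ (φ.angle i) p := by
  have h : φ.angle i = fun p => D.ε i * D.E.repr (φ.gauss p) i := funext fun p => φ.angle_eq i p
  rw [h]
  exact contMDiffAt_const.mul (φ.gauss_smooth i p)

omit [IsManifold 𝓘(ℝ, E2) ∞ S] in
/-- A connected surface whose tangent planes are left translates of one plane has constant angle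
functions. -/
theorem ImmersedSurface.exists_angle_eq_of_mem_range [ConnectedSpace S] (φ : ImmersedSurface D S)
    {B : E2 →L[ℝ] E3}
    (hφ : ∀ p v, leftDeriv E2 E3 φ.toFun p v ∈ LinearMap.range B.toLinearMap) :
    ∃ k : Fin 3 → ℝ, ∀ i p, φ.angle i p = k i := by
  have hperp : ∀ p w, ∑ i, φ.angle i p * D.crd i (B w) = 0 := by
    intro p w
    have hle : LinearMap.range (leftDeriv E2 E3 φ.toFun p).toLinearMap
        ≤ LinearMap.range B.toLinearMap := by
      rintro _ ⟨v, rfl⟩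
      exact hφ p v
    have heq := Submodule.eq_of_le_of_finrank_le hle (by
      rw [LinearMap.finrank_range_of_inj (f := (leftDeriv E2 E3 φ.toFun p).toLinearMap)
        (φ.leftDeriv_injective p)]
      exact LinearMap.finrank_range_le _)
    have hw : B w ∈ LinearMap.range (leftDeriv E2 E3 φ.toFun p).toLinearMap := by
      rw [heq]; exact ⟨w, rfl⟩
    obtain ⟨v, hv⟩ := hw
    rw [← hv]
    exact φ.sum_angle_mul_crd p v
  obtain ⟨p₀⟩ : Nonempty S := inferInstance
  have hδ := φ.sgn_ne
  -- This is the unit normal at p₀. Its pairing with the covector at p₀ is the nonzero sign, so it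
  -- complements the tangent plane also in Lorentzian signature.
  set n₀ : E3 := D.vec fun i => D.ε i * φ.angle i p₀ with hn₀
  -- the covector with components the angle functions at `p`
  set f : S → E3 →ₗ[ℝ] ℝ := fun p => ∑ i, φ.angle i p • (D.crd i).toLinearMap with hf
  have hfa : ∀ p V, f p V = ∑ i, φ.angle i p * D.crd i V := fun p V => by simp [hf]
  have hfn : f p₀ n₀ = φ.sgn := by
    rw [hfa, ← φ.sum_angle_sq p₀]
    refine Finset.sum_congr rfl fun i _ => ?_
    rw [hn₀, D.crd_vec]; ring
  have hker : LinearMap.range B.toLinearMap = LinearMap.ker (f p₀) := by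
    refine Submodule.eq_of_le_of_finrank_le ?_ ?_
    · rintro _ ⟨w, rfl⟩
      exact (hfa _ _).trans (hperp p₀ w)
    · have h1 : LinearMap.ker (f p₀) ≠ ⊤ := fun h => hδ (by
        rw [← hfn]
        exact LinearMap.mem_ker.1 (h ▸ Submodule.mem_top))
      have h2 := Submodule.finrank_lt h1
      have h3 := LinearMap.finrank_range_of_inj (f := (leftDeriv E2 E3 φ.toFun p₀).toLinearMap)
        (φ.leftDeriv_injective p₀)
      have h4 : Module.finrank ℝ (LinearMap.range (leftDeriv E2 E3 φ.toFun p₀).toLinearMap)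
          ≤ Module.finrank ℝ (LinearMap.range B.toLinearMap) := by
        apply Submodule.finrank_mono
        rintro _ ⟨v, rfl⟩
        exact hφ p₀ v
      simp only [finrank_euclideanSpace, Fintype.card_fin] at h2 h3
      omega
  set A : S → ℝ := fun p => f p n₀ / φ.sgn with hA
  have hprop : ∀ p i, φ.angle i p = A p * φ.angle i p₀ := by
    intro p i
    set V : E3 := D.vec (Pi.single i 1) with hV
    have hfV : ∀ p, f p V = φ.angle i p := fun p => by
      rw [hfa]
      simp only [hV, D.crd_vec]
      simp [Pi.single_apply]
    have hmem : V - (f p₀ V / φ.sgn) • n₀ ∈ LinearMap.range B.toLinearMap := by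
      rw [hker, LinearMap.mem_ker, map_sub, map_smul, hfn]
      simp [hδ]
    obtain ⟨w, hw⟩ := hmem
    have h0 : f p (B w) = 0 := (hfa _ _).trans (hperp p w)
    rw [show B w = _ from hw, map_sub, map_smul, hfV, hfV, sub_eq_zero] at h0
    rw [h0, hA, smul_eq_mul]
    ring
  -- The covectors at p and p₀ are proportional and have the same normalization, so the factor is
  -- ±1, and continuity fixes the sign.
  have hAsq : ∀ p, A p ^ 2 = 1 := by
    intro p
    have h1 := φ.sum_angle_sq p
    simp only [hprop p, mul_pow] at h1
    have h2 : A p ^ 2 * ∑ i, D.ε i * φ.angle i p₀ ^ 2 = φ.sgn := by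
      rw [← h1, Finset.mul_sum]
      exact Finset.sum_congr rfl fun i _ => by ring
    rw [φ.sum_angle_sq p₀] at h2
    exact mul_right_cancel₀ hδ (h2.trans (one_mul _).symm)
  have hAc : Continuous A := by
    simp only [hA, hfa]
    refine Continuous.div_const (continuous_finsetSum _ fun i _ => Continuous.mul ?_
      continuous_const) _
    exact continuous_iff_continuousAt.2 fun p => (φ.angle_smooth i p).continuousAt
  rcases isPreconnected_univ.eq_or_eq_neg_of_sq_eq (f := A) (g := fun _ => (1 : ℝ))
    hAc.continuousOn continuousOn_const (fun p _ => by simpa using hAsq p)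
    (fun _ => one_ne_zero) with h | h
  · exact ⟨fun i => φ.angle i p₀, fun i p => by
      rw [hprop p i, h (Set.mem_univ p), one_mul]⟩
  · exact ⟨fun i => -φ.angle i p₀, fun i p => by
      rw [hprop p i, h (Set.mem_univ p)]; simp⟩

end ConstantNormal
end

noncomputable section

/-! ### The derivative of the angle functions. -/

section StructureEquation

variable {G : Type*} [TopologicalSpace G] [ChartedSpace E3 G] [Group G] [LieGroup 𝓘(ℝ, E3) ∞ G]
  {D : DiagonalMetric G} {S : Type*} [TopologicalSpace S] [ChartedSpace E2 S]
  [IsManifold 𝓘(ℝ, E2) ∞ S]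

namespace ImmersedSurface

variable (φ : ImmersedSurface D S)

omit [LieGroup 𝓘(ℝ, E3) ∞ G] [IsManifold 𝓘(ℝ, E2) ∞ S] in
theorem angle_diffAt (i : Fin 3) (p : S) : ModelDiffAt E2 ℝ (φ.angle i) p :=
  (φ.angle_smooth i p).mdifferentiableAt (by simp)

/-- The differential of an angle function. -/
abbrev dAngle (i : Fin 3) (p : S) : E2 →L[ℝ] ℝ := modelDeriv E2 ℝ (φ.angle i) p

/-- The antisymmetric part of the derivative of the angle functions, from the Maurer–Cartan
equation. -/
theorem dAngle_sub (p : S) (u v : E2) :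
    ∑ i, (φ.dAngle i p u * D.crd i (leftDeriv E2 E3 φ.toFun p v)
      - φ.dAngle i p v * D.crd i (leftDeriv E2 E3 φ.toFun p u))
    = ∑ i, φ.angle i p * D.crd i (lieBr E3 G (leftDeriv E2 E3 φ.toFun p u)
        (leftDeriv E2 E3 φ.toFun p v)) := by
  have hs := mem_extChartAt_source (I := 𝓘(ℝ, E2)) p
  have ht := mem_extChartAt_target (I := 𝓘(ℝ, E2)) p
  set x₀ := chartTo E2 p p with hx₀
  set f : E2 → G := fun x => φ.toFun (chartFrom E2 p x) with hf
  set θ : E2 → E2 →L[ℝ] E3 := leftDeriv E2 E3 f with hθ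
  set a : Fin 3 → E2 → ℝ := fun i x => φ.angle i (chartFrom E2 p x) with ha
  have htgt : ∀ᶠ x in 𝓝 x₀, x ∈ (extChartAt 𝓘(ℝ, E2) p).target :=
    (isOpen_extChartAt_target p).mem_nhds ht
  have hfs : ∀ᶠ x in 𝓝 x₀, ModelSmoothAt E2 E3 ∞ f x := by
    filter_upwards [htgt] with x hx using
      ModelSmoothAt.compose (g := φ.toFun) (f := chartFrom E2 p) (φ.smooth _)
        (smoothAt_chartFrom hx)
  have hθe : ∀ x ∈ (extChartAt 𝓘(ℝ, E2) p).target, θ x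
      = (leftDeriv E2 E3 φ.toFun (chartFrom E2 p x)).comp (modelDeriv E2 E2 (chartFrom E2 p) x) :=
    fun x hx => leftDeriv_comp (f := φ.toFun) (u := chartFrom E2 p)
      ((φ.smooth _).mdifferentiableAt (by simp)) (diffAt_chartFrom hx)
  have hθ0 : θ x₀ = leftDeriv E2 E3 φ.toFun p := by
    rw [hθe _ ht, modelDeriv_chartFrom_self, chartFrom_chartTo hs, ContinuousLinearMap.comp_id]
  have hθd : HasFDerivAt θ (fderiv ℝ θ x₀) x₀ :=
    ((contDiffAt_leftDeriv (n := ∞) (m := 1) le_rfl ((one_add_one_eq_two (R := ℕ∞ω)).le.trans ENat.LEInfty.out) hfs).differentiableAt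
      (by simp)).hasFDerivAt
  have had : ∀ i, HasFDerivAt (a i) (φ.dAngle i p) x₀ := by
    intro i
    have h1 : ModelDiffAt E2 ℝ (φ.angle i) (chartFrom E2 p x₀) := φ.angle_diffAt i _
    have h2 := ModelDiffAt.compose (g := φ.angle i) (f := chartFrom E2 p) h1 (diffAt_chartFrom ht)
    have h3 := modelDeriv_comp (g := φ.angle i) (f := chartFrom E2 p) h1 (diffAt_chartFrom ht)
    rw [modelDeriv_chartFrom_self, ContinuousLinearMap.comp_id, chartFrom_chartTo hs,
      modelDeriv_eq_fderiv] at h3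
    rw [dAngle, ← h3]
    exact h2.differentiableAt.hasFDerivAt
  have ha0 : ∀ i, a i x₀ = φ.angle i p := fun i => by
    rw [ha]; simp only; rw [chartFrom_chartTo hs]
  -- The relation Σ νᵢθᵢ(v) = 0, with v constant in the chart, is differentiated in the direction u.
  -- Antisymmetrizing in u and v leaves only dθ, which is a bracket.
  have key : ∀ u v : E2, ∑ i, (φ.angle i p * D.crd i (fderiv ℝ θ x₀ u v)
      + φ.dAngle i p u * D.crd i (leftDeriv E2 E3 φ.toFun p v)) = 0 := by
    intro u v
    have h1 : ∀ i, HasFDerivAt (fun x => a i x * D.crd i (θ x v))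
        (a i x₀ • (D.crd i).comp ((ContinuousLinearMap.apply ℝ E3 v).comp (fderiv ℝ θ x₀))
          + D.crd i (θ x₀ v) • φ.dAngle i p) x₀ := fun i =>
      (had i).mul ((D.crd i).hasFDerivAt.comp x₀ ((ContinuousLinearMap.apply ℝ E3 v).hasFDerivAt.comp x₀ hθd))
    have h2 := HasFDerivAt.fun_sum (u := Finset.univ) fun i _ => h1 i
    have h3 : (fun x => ∑ i, a i x * D.crd i (θ x v)) =ᶠ[𝓝 x₀] fun _ => 0 := by
      filter_upwards [htgt] with x hx
      rw [hθe x hx]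
      exact φ.sum_angle_mul_crd _ _
    have h4 := (h2.congr_of_eventuallyEq h3.symm).unique (hasFDerivAt_const (0 : ℝ) x₀)
    have h5 := congrArg (fun A : E2 →L[ℝ] ℝ => A u) h4
    simp only [sum_apply, add_apply, smul_apply, ContinuousLinearMap.comp_apply,
      ContinuousLinearMap.apply_apply, zero_apply, smul_eq_mul, ha0, hθ0] at h5
    rw [← h5]
    exact Finset.sum_congr rfl fun i _ => by ring
  have hMC := maurerCartan (n := ∞) le_rfl (by exact ENat.LEInfty.out) hfs u v
  rw [← hθ, hθ0] at hMC
  have h6 : lieBr E3 G (leftDeriv E2 E3 φ.toFun p u) (leftDeriv E2 E3 φ.toFun p v)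
      = fderiv ℝ θ x₀ v u - fderiv ℝ θ x₀ u v := by
    rw [← neg_sub, hMC, neg_neg]
  rw [h6, ← sub_eq_zero, ← Finset.sum_sub_distrib]
  calc _ = ∑ i, (φ.angle i p * D.crd i (fderiv ℝ θ x₀ u v)
      + φ.dAngle i p u * D.crd i (leftDeriv E2 E3 φ.toFun p v))
      - ∑ i, (φ.angle i p * D.crd i (fderiv ℝ θ x₀ v u)
      + φ.dAngle i p v * D.crd i (leftDeriv E2 E3 φ.toFun p u)) := by
        rw [← Finset.sum_sub_distrib]
        refine Finset.sum_congr rfl fun i _ => ?_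
        rw [map_sub]; ring
    _ = 0 := by rw [key, key, sub_zero]

-- Used with the weights ε, c and εc², which give ⟨N,N⟩, ζ and the squared length of the vector with
-- coordinates cᵢνᵢ.
omit [LieGroup 𝓘(ℝ, E3) ∞ G] [IsManifold 𝓘(ℝ, E2) ∞ S] in
theorem hasMFDerivAt_sum_mul_angle_sq (w : Fin 3 → ℝ) (p : S) :
    HasMFDerivAt 𝓘(ℝ, E2) 𝓘(ℝ, ℝ) (fun p => ∑ i, w i * φ.angle i p ^ 2) p
      (∑ i, (2 * w i * φ.angle i p) • φ.dAngle i p) := by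
  have h : ∀ i, HasMFDerivAt 𝓘(ℝ, E2) 𝓘(ℝ, ℝ) (φ.angle i) p (φ.dAngle i p) :=
    fun i => (φ.angle_diffAt i p).hasMFDerivAt
  have hs := HasMFDerivAt.sum (t := Finset.univ) fun i _ => ((h i).mul (h i)).const_smul (w i)
  have hfun : (∑ i, w i • (φ.angle i * φ.angle i)) = fun p => ∑ i, w i * φ.angle i p ^ 2 := by
    ext q
    simp [Finset.sum_apply, pow_two]
  rw [hfun] at hs
  refine hs.congr_mfderiv (Finset.sum_congr rfl fun i _ => ?_)
  refine ContinuousLinearMap.ext fun v => ?_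
  change w i * (φ.angle i p * φ.dAngle i p v + φ.angle i p * φ.dAngle i p v)
    = 2 * w i * φ.angle i p * φ.dAngle i p v
  ring

omit [LieGroup 𝓘(ℝ, E3) ∞ G] [IsManifold 𝓘(ℝ, E2) ∞ S] in
theorem sum_mul_angle_dAngle_eq_zero {w : Fin 3 → ℝ} {k : ℝ}
    (h : ∀ p, ∑ i, w i * φ.angle i p ^ 2 = k) (p : S) (v : E2) :
    ∑ i, w i * φ.angle i p * φ.dAngle i p v = 0 := by
  have h1 := φ.hasMFDerivAt_sum_mul_angle_sq w p
  rw [funext h] at h1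
  have h2 := hasMFDerivAt_unique h1 (hasMFDerivAt_const k p)
  have h3 := congrArg (fun A : E2 →L[ℝ] ℝ => A v) h2
  have h4 : ∑ i, 2 * w i * φ.angle i p * φ.dAngle i p v = 0 := by
    refine Eq.trans ?_ h3
    change _ = (∑ i, (2 * w i * φ.angle i p) • φ.dAngle i p : E2 →L[ℝ] ℝ) v
    simp only [sum_apply, smul_apply, smul_eq_mul]
  rw [← mul_eq_zero_iff_left (two_ne_zero (α := ℝ)), Finset.mul_sum, ← h4]
  exact Finset.sum_congr rfl fun i _ => by ring

end ImmersedSurface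

end StructureEquation
end

noncomputable section

/-! ### Connection and curvature in coordinates. -/

section Curvature

namespace DiagonalMetric

variable {G : Type*} [TopologicalSpace G] [ChartedSpace E3 G] [Group G] [LieGroup 𝓘(ℝ, E3) ∞ G]
  (D : DiagonalMetric G)

/-- The Levi-Civita connection on the space of coordinate vectors. -/
def nab (x y : Fin 3 → ℝ) : Fin 3 → ℝ :=
  ![D.ε 0 / 2 * ((D.ε 0 * D.c 0 - D.ε 1 * D.c 1 + D.ε 2 * D.c 2) * (x 1 * y 2)
      - (D.ε 0 * D.c 0 + D.ε 1 * D.c 1 - D.ε 2 * D.c 2) * (x 2 * y 1)),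
    D.ε 1 / 2 * ((D.ε 1 * D.c 1 - D.ε 2 * D.c 2 + D.ε 0 * D.c 0) * (x 2 * y 0)
      - (D.ε 1 * D.c 1 + D.ε 2 * D.c 2 - D.ε 0 * D.c 0) * (x 0 * y 2)),
    D.ε 2 / 2 * ((D.ε 2 * D.c 2 - D.ε 0 * D.c 0 + D.ε 1 * D.c 1) * (x 0 * y 1)
      - (D.ε 2 * D.c 2 + D.ε 0 * D.c 0 - D.ε 1 * D.c 1) * (x 1 * y 0))]

omit [LieGroup 𝓘(ℝ, E3) ∞ G] in
theorem crd_E (i j : Fin 3) : D.crd i (D.E j) = if j = i then 1 else 0 := by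
  rw [← D.repr_eq, D.E.repr_self, Finsupp.single_apply]

theorem crd_lie (X Y : GroupLieAlgebra 𝓘(ℝ, E3) G) (i : Fin 3) :
    D.crd i (⁅X, Y⁆ : GroupLieAlgebra 𝓘(ℝ, E3) G)
      = D.brk (fun i => D.crd i X) (fun i => D.crd i Y) i :=
  (congrArg (D.crd i) (D.lie_eq X Y)).trans (D.crd_vec _ i)

theorem crd_nabla (X Y : GroupLieAlgebra 𝓘(ℝ, E3) G) (k : Fin 3) :
    D.crd k (D.nabla X Y) = D.nab (fun i => D.crd i X) (fun i => D.crd i Y) k := by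
  have h : D.crd k (D.nabla X Y) = _ := D.crd_vec (fun k => D.ε k * ((D.metric ⁅X, Y⁆ (D.E k)
    - D.metric ⁅Y, D.E k⁆ X + D.metric ⁅D.E k, X⁆ Y) / 2)) k
  rw [h]
  simp only [metric_eq, crd_lie, crd_E]
  fin_cases k <;> simp [nab, brk, Fin.sum_univ_three] <;> ring

theorem crd_curvature (X Y Z : GroupLieAlgebra 𝓘(ℝ, E3) G) (k : Fin 3) :
    D.crd k (D.curvature X Y Z) =
      D.nab (fun i => D.crd i X) (D.nab (fun i => D.crd i Y) (fun i => D.crd i Z)) k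
      - D.nab (fun i => D.crd i Y) (D.nab (fun i => D.crd i X) (fun i => D.crd i Z)) k
      - D.nab (D.brk (fun i => D.crd i X) (fun i => D.crd i Y)) (fun i => D.crd i Z) k := by
  have h : D.crd k (D.curvature X Y Z) = D.crd k (D.nabla X (D.nabla Y Z))
      - D.crd k (D.nabla Y (D.nabla X Z)) - D.crd k (D.nabla ⁅X, Y⁆ Z) := by
    have hsub : ∀ a b c : E3, D.crd k (a - b - c) = D.crd k a - D.crd k b - D.crd k c :=
      fun a b c => by rw [map_sub, map_sub]
    exact hsub _ _ _
  rw [h]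
  simp only [crd_nabla, crd_lie]

theorem hasConstantSectionalCurvature_of_flat
    (h : ∀ x y z k, D.nab x (D.nab y z) k - D.nab y (D.nab x z) k - D.nab (D.brk x y) z k = 0) :
    D.HasConstantSectionalCurvature := by
  refine ⟨0, fun X Y _ => ?_⟩
  have h0 : D.metric (D.curvature X Y Y) X = 0 := by
    rw [metric_eq]
    refine Finset.sum_eq_zero fun k _ => ?_
    rw [crd_curvature, h]
    ring
  rw [h0, zero_div]

/-- When two of the numbers εᵢcᵢ agree and the third structure constant is zero, the metric is flat.
This lemma and the next two are the only places where the curvature is computed. -/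
theorem hasConstantSectionalCurvature_two (h : D.ε 0 * D.c 0 = D.ε 1 * D.c 1) (h2 : D.c 2 = 0) :
    D.HasConstantSectionalCurvature := by
  refine D.hasConstantSectionalCurvature_of_flat fun x y z k => ?_
  fin_cases k <;> simp [nab, brk, h, h2] <;> ring

theorem hasConstantSectionalCurvature_zero (h : D.ε 1 * D.c 1 = D.ε 2 * D.c 2) (h2 : D.c 0 = 0) :
    D.HasConstantSectionalCurvature := by
  refine D.hasConstantSectionalCurvature_of_flat fun x y z k => ?_
  fin_cases k <;> simp [nab, brk, h, h2] <;> ring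

theorem hasConstantSectionalCurvature_one (h : D.ε 0 * D.c 0 = D.ε 2 * D.c 2) (h2 : D.c 1 = 0) :
    D.HasConstantSectionalCurvature := by
  refine D.hasConstantSectionalCurvature_of_flat fun x y z k => ?_
  fin_cases k <;> simp [nab, brk, h, h2] <;> ring

/-- The metric on coordinate vectors. -/
def form (x y : Fin 3 → ℝ) : ℝ := ∑ i, D.ε i * x i * y i

-- This is the tangential trace of X ↦ ∇_X N for a left-invariant N normal to the span of x and y,
-- multiplied by the Gram determinant. The full trace is a divergence, zero by unimodularity, and
-- the normal contribution ⟨∇_N N, N⟩ vanishes as well.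
omit [LieGroup 𝓘(ℝ, E3) ∞ G] in
theorem sum_adjugate_nab {x y ν : Fin 3 → ℝ} {s : ℝ} (h0 : ν 0 = s * (x 1 * y 2 - x 2 * y 1))
    (h1 : ν 1 = s * (x 2 * y 0 - x 0 * y 2)) (h2 : ν 2 = s * (x 0 * y 1 - x 1 * y 0)) :
    D.form y y * D.form x (D.nab x fun i => D.ε i * ν i)
      - D.form x y * (D.form y (D.nab x fun i => D.ε i * ν i)
        + D.form x (D.nab y fun i => D.ε i * ν i))
      + D.form x x * D.form y (D.nab y fun i => D.ε i * ν i) = 0 := by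
  simp only [form, nab, Fin.sum_univ_three, h0, h1, h2, Matrix.cons_val]
  rcases D.ε_sign 0 with e0 | e0 <;> rcases D.ε_sign 1 with e1 | e1 <;>
    rcases D.ε_sign 2 with e2 | e2 <;> rw [e0, e1, e2] <;> ring

-- The Lagrange identity in any signature. It makes the first fundamental form nondegenerate once
-- the cross product is proportional to the unit normal covector.
omit [LieGroup 𝓘(ℝ, E3) ∞ G] in
theorem form_det (x y : Fin 3 → ℝ) :
    D.form x x * D.form y y - D.form x y ^ 2 = D.ε 0 * D.ε 1 * D.ε 2 *
      (D.ε 0 * (x 1 * y 2 - x 2 * y 1) ^ 2 + D.ε 1 * (x 2 * y 0 - x 0 * y 2) ^ 2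
        + D.ε 2 * (x 0 * y 1 - x 1 * y 0) ^ 2) := by
  simp only [form, Fin.sum_univ_three]
  rcases D.ε_sign 0 with e0 | e0 <;> rcases D.ε_sign 1 with e1 | e1 <;>
    rcases D.ε_sign 2 with e2 | e2 <;> rw [e0, e1, e2] <;> ring

end DiagonalMetric

end Curvature

/-! ### Linear algebra at a point. -/

section PointwiseAlgebra

theorem exists_smul_cross {x y ν : Fin 3 → ℝ} (hx : ν 0 * x 0 + ν 1 * x 1 + ν 2 * x 2 = 0)
    (hy : ν 0 * y 0 + ν 1 * y 1 + ν 2 * y 2 = 0)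
    (hw : ∀ a b : ℝ, (∀ i, a * x i + b * y i = 0) → a = 0 ∧ b = 0) :
    ∃ s, ν 0 = s * (x 1 * y 2 - x 2 * y 1) ∧ ν 1 = s * (x 2 * y 0 - x 0 * y 2) ∧
      ν 2 = s * (x 0 * y 1 - x 1 * y 0) ∧
      0 < (x 1 * y 2 - x 2 * y 1) ^ 2 + (x 2 * y 0 - x 0 * y 2) ^ 2
        + (x 0 * y 1 - x 1 * y 0) ^ 2 := by
  have hpos : 0 < (x 1 * y 2 - x 2 * y 1) ^ 2 + (x 2 * y 0 - x 0 * y 2) ^ 2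
        + (x 0 * y 1 - x 1 * y 0) ^ 2 := by
    by_contra hle
    have q0 := sq_nonneg (x 1 * y 2 - x 2 * y 1)
    have q1 := sq_nonneg (x 2 * y 0 - x 0 * y 2)
    have q2 := sq_nonneg (x 0 * y 1 - x 1 * y 0)
    have h0 : x 1 * y 2 - x 2 * y 1 = 0 := (pow_eq_zero_iff two_ne_zero).1 (by linarith)
    have h1 : x 2 * y 0 - x 0 * y 2 = 0 := (pow_eq_zero_iff two_ne_zero).1 (by linarith)
    have h2 : x 0 * y 1 - x 1 * y 0 = 0 := (pow_eq_zero_iff two_ne_zero).1 (by linarith)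
    have hxi : ∀ i, x i = 0 := by
      intro i
      refine neg_eq_zero.1 (hw (y i) (-x i) fun j => ?_).2
      fin_cases i <;> fin_cases j <;> simp <;> linarith
    exact one_ne_zero (hw 1 0 fun i => by simp [hxi]).1
  refine ⟨(ν 0 * (x 1 * y 2 - x 2 * y 1) + ν 1 * (x 2 * y 0 - x 0 * y 2)
    + ν 2 * (x 0 * y 1 - x 1 * y 0)) / ((x 1 * y 2 - x 2 * y 1) ^ 2 + (x 2 * y 0 - x 0 * y 2) ^ 2
        + (x 0 * y 1 - x 1 * y 0) ^ 2), ?_, ?_, ?_, hpos⟩ <;>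
  rw [div_mul_eq_mul_div, eq_div_iff hpos.ne']
  · linear_combination ((x 0 * y 1 - x 1 * y 0) * y 1 - (x 2 * y 0 - x 0 * y 2) * y 2) * hx
      - ((x 0 * y 1 - x 1 * y 0) * x 1 - (x 2 * y 0 - x 0 * y 2) * x 2) * hy
  · linear_combination ((x 1 * y 2 - x 2 * y 1) * y 2 - (x 0 * y 1 - x 1 * y 0) * y 0) * hx
      - ((x 1 * y 2 - x 2 * y 1) * x 2 - (x 0 * y 1 - x 1 * y 0) * x 0) * hy
  · linear_combination ((x 2 * y 0 - x 0 * y 2) * y 0 - (x 1 * y 2 - x 2 * y 1) * y 1) * hx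
      - ((x 2 * y 0 - x 0 * y 2) * x 0 - (x 1 * y 2 - x 2 * y 1) * x 1) * hy

/-- Cramer's rule for the three independent covectors x, y, n. -/
theorem eq_zero_of_dot_eq_zero {x y n p : Fin 3 → ℝ}
    (hd : (x 1 * y 2 - x 2 * y 1) * n 0 + (x 2 * y 0 - x 0 * y 2) * n 1
      + (x 0 * y 1 - x 1 * y 0) * n 2 ≠ 0) (hx : x 0 * p 0 + x 1 * p 1 + x 2 * p 2 = 0)
    (hy : y 0 * p 0 + y 1 * p 1 + y 2 * p 2 = 0) (hn : n 0 * p 0 + n 1 * p 1 + n 2 * p 2 = 0)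
    (i : Fin 3) : p i = 0 := by
  refine (mul_eq_zero_iff_left hd).1 ?_
  fin_cases i
  · simp only [Fin.zero_eta]
    linear_combination (y 1 * n 2 - y 2 * n 1) * hx + (n 1 * x 2 - n 2 * x 1) * hy
      + (x 1 * y 2 - x 2 * y 1) * hn
  · simp only [Fin.mk_one]
    linear_combination (y 2 * n 0 - y 0 * n 2) * hx + (n 2 * x 0 - n 0 * x 2) * hy
      + (x 2 * y 0 - x 0 * y 2) * hn
  · simp only [Fin.reduceFinMk]
    linear_combination (y 0 * n 1 - y 1 * n 0) * hx + (n 0 * x 1 - n 1 * x 0) * hy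
      + (x 0 * y 1 - x 1 * y 0) * hn

/-- A symmetric bilinear form on a plane with a nonisotropic null vector vanishes if it is
trace-free. -/
theorem symmetric_eq_zero {a b I₀ I₁ I₂ M₀ M₁ M₂ : ℝ} (h0 : a * M₀ + b * M₁ = 0)
    (h1 : a * M₁ + b * M₂ = 0) (ht : I₂ * M₀ - 2 * I₁ * M₁ + I₀ * M₂ = 0)
    (hu : a ^ 2 * I₀ + 2 * a * b * I₁ + b ^ 2 * I₂ ≠ 0) : M₀ = 0 ∧ M₁ = 0 ∧ M₂ = 0 := by
  refine ⟨(mul_eq_zero_iff_left hu).1 ?_, (mul_eq_zero_iff_left hu).1 ?_,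
    (mul_eq_zero_iff_left hu).1 ?_⟩
  · linear_combination (a * I₀ + 2 * b * I₁) * h0 - b * I₀ * h1 + b ^ 2 * ht
  · linear_combination a * I₀ * h1 + b * I₂ * h0 - a * b * ht
  · linear_combination (b * I₂ + 2 * a * I₁) * h1 - a * I₂ * h0 + a ^ 2 * ht

end PointwiseAlgebra
end

noncomputable section

section NullVector

theorem eq_zero_of_sum_sq_eq_zero {a b c : ℝ} (h : a ^ 2 + b ^ 2 + c ^ 2 = 0) :
    a = 0 ∧ b = 0 ∧ c = 0 := by
  have ha := sq_nonneg a
  have hb := sq_nonneg b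
  have hc := sq_nonneg c
  exact ⟨(pow_eq_zero_iff two_ne_zero).1 (by linarith),
    (pow_eq_zero_iff two_ne_zero).1 (by linarith), (pow_eq_zero_iff two_ne_zero).1 (by linarith)⟩

/-- Here p and q stand for the derivatives of ν along the tangent basis x, y. The form with entries
x·p, y·p = x·q, y·q is symmetric, trace-free and kills the nonisotropic tangent vector U, so it
vanishes. Then p and q are also annihilated by (εᵢνᵢ), which is transverse to x and y because δ ≠ 0.
-/
theorem eq_zero_of_null_vector {ε x y ν p q U : Fin 3 → ℝ} {s δ : ℝ} (hδ : δ ≠ 0)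
    (h0 : ν 0 = s * (x 1 * y 2 - x 2 * y 1)) (h1 : ν 1 = s * (x 2 * y 0 - x 0 * y 2))
    (h2 : ν 2 = s * (x 0 * y 1 - x 1 * y 0)) (hν : ∑ i, ε i * ν i ^ 2 = δ)
    (hp : ∑ i, ε i * ν i * p i = 0) (hq : ∑ i, ε i * ν i * q i = 0)
    (hsym : ∑ i, y i * p i = ∑ i, x i * q i)
    (htr : (∑ i, ε i * y i * y i) * (∑ i, x i * p i)
      - (∑ i, ε i * x i * y i) * (∑ i, y i * p i + ∑ i, x i * q i)
      + (∑ i, ε i * x i * x i) * (∑ i, y i * q i) = 0)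
    (hU : ∑ i, ν i * U i = 0) (hUp : ∑ i, U i * p i = 0) (hUq : ∑ i, U i * q i = 0)
    (hUU : ∑ i, ε i * U i ^ 2 ≠ 0) (i : Fin 3) : p i = 0 ∧ q i = 0 := by
  simp only [Fin.sum_univ_three] at *
  set w0 := x 1 * y 2 - x 2 * y 1 with hw0
  set w1 := x 2 * y 0 - x 0 * y 2 with hw1
  set w2 := x 0 * y 1 - x 1 * y 0 with hw2
  have hsd : s * (w0 * (ε 0 * ν 0) + w1 * (ε 1 * ν 1) + w2 * (ε 2 * ν 2)) = δ := by
    rw [← hν]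
    linear_combination -(ε 0 * ν 0) * h0 - ε 1 * ν 1 * h1 - ε 2 * ν 2 * h2
  have hs : s ≠ 0 := by
    rintro rfl
    exact hδ (by rw [← hsd, zero_mul])
  have hd : w0 * (ε 0 * ν 0) + w1 * (ε 1 * ν 1) + w2 * (ε 2 * ν 2) ≠ 0 := by
    intro h
    exact hδ (by rw [← hsd, h, mul_zero])
  have hUw : U 0 * w0 + U 1 * w1 + U 2 * w2 = 0 := by
    have : s * (U 0 * w0 + U 1 * w1 + U 2 * w2) = 0 := by
      linear_combination hU - U 0 * h0 - U 1 * h1 - U 2 * h2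
    exact (mul_eq_zero.1 this).resolve_left hs
  have hW : w0 ^ 2 + w1 ^ 2 + w2 ^ 2 ≠ 0 := by
    intro h
    obtain ⟨e0, e1, e2⟩ := eq_zero_of_sum_sq_eq_zero h
    exact hd (by rw [e0, e1, e2]; ring)
  -- Since U is orthogonal to w = x × y, it lies in the span of x and y; a and b are the triple
  -- products (U × y)·w and (x × U)·w, with |w|²U = ax + by.
  set a := (U 1 * y 2 - U 2 * y 1) * w0 + (U 2 * y 0 - U 0 * y 2) * w1
    + (U 0 * y 1 - U 1 * y 0) * w2 with ha
  set b := (x 1 * U 2 - x 2 * U 1) * w0 + (x 2 * U 0 - x 0 * U 2) * w1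
    + (x 0 * U 1 - x 1 * U 0) * w2 with hb
  have hd0 : (w0 ^ 2 + w1 ^ 2 + w2 ^ 2) * U 0 = a * x 0 + b * y 0 := by
    linear_combination w0 * hUw
  have hd1 : (w0 ^ 2 + w1 ^ 2 + w2 ^ 2) * U 1 = a * x 1 + b * y 1 := by
    linear_combination w1 * hUw
  have hd2 : (w0 ^ 2 + w1 ^ 2 + w2 ^ 2) * U 2 = a * x 2 + b * y 2 := by
    linear_combination w2 * hUw
  clear_value a b
  obtain ⟨m0, m1, m2⟩ := symmetric_eq_zero (a := a) (b := b)
    (I₀ := ε 0 * x 0 * x 0 + ε 1 * x 1 * x 1 + ε 2 * x 2 * x 2)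
    (I₁ := ε 0 * x 0 * y 0 + ε 1 * x 1 * y 1 + ε 2 * x 2 * y 2)
    (I₂ := ε 0 * y 0 * y 0 + ε 1 * y 1 * y 1 + ε 2 * y 2 * y 2)
    (M₀ := x 0 * p 0 + x 1 * p 1 + x 2 * p 2) (M₁ := y 0 * p 0 + y 1 * p 1 + y 2 * p 2)
    (M₂ := y 0 * q 0 + y 1 * q 1 + y 2 * q 2)
    (by linear_combination (w0 ^ 2 + w1 ^ 2 + w2 ^ 2) * hUp - p 0 * hd0 - p 1 * hd1 - p 2 * hd2)
    (by linear_combination (w0 ^ 2 + w1 ^ 2 + w2 ^ 2) * hUq - q 0 * hd0 - q 1 * hd1 - q 2 * hd2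
          + a * hsym)
    (by linear_combination htr - (ε 0 * x 0 * y 0 + ε 1 * x 1 * y 1 + ε 2 * x 2 * y 2) * hsym)
    (by
      have : a ^ 2 * (ε 0 * x 0 * x 0 + ε 1 * x 1 * x 1 + ε 2 * x 2 * x 2)
          + 2 * a * b * (ε 0 * x 0 * y 0 + ε 1 * x 1 * y 1 + ε 2 * x 2 * y 2)
          + b ^ 2 * (ε 0 * y 0 * y 0 + ε 1 * y 1 * y 1 + ε 2 * y 2 * y 2)
          = (w0 ^ 2 + w1 ^ 2 + w2 ^ 2) ^ 2 * (ε 0 * U 0 ^ 2 + ε 1 * U 1 ^ 2 + ε 2 * U 2 ^ 2) := by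
        calc _ = ε 0 * (a * x 0 + b * y 0) ^ 2 + ε 1 * (a * x 1 + b * y 1) ^ 2
              + ε 2 * (a * x 2 + b * y 2) ^ 2 := by ring
          _ = _ := by rw [← hd0, ← hd1, ← hd2]; ring
      rw [this]
      exact mul_ne_zero (pow_ne_zero 2 hW) hUU)
  exact ⟨eq_zero_of_dot_eq_zero (n := fun i => ε i * ν i) hd m0 m1 hp i,
    eq_zero_of_dot_eq_zero (n := fun i => ε i * ν i) hd (hsym ▸ m1) m2 hq i⟩

end NullVector

/-! ### Mean curvature and ζ as trace and antisymmetric part of one form. -/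

section MeanCurvature

variable {G : Type*} [TopologicalSpace G] [ChartedSpace E3 G] [Group G] [LieGroup 𝓘(ℝ, E3) ∞ G]
  {D : DiagonalMetric G} {S : Type*} [TopologicalSpace S] [ChartedSpace E2 S]
  [IsManifold 𝓘(ℝ, E2) ∞ S]

namespace ImmersedSurface

variable (φ : ImmersedSurface D S) (p : S)

/-- The coordinates of a vector of the coordinate basis of the tangent plane. -/
def tang (a : Fin 2) (i : Fin 3) : ℝ :=
  D.crd i (leftDeriv E2 E3 φ.toFun p (EuclideanSpace.single a (1 : ℝ)))

/-- The derivatives of the angle functions along the coordinate basis. -/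
def dang (a : Fin 2) (i : Fin 3) : ℝ := φ.dAngle i p (EuclideanSpace.single a (1 : ℝ))

omit [IsManifold 𝓘(ℝ, E2) ∞ S] in
theorem crd_nablaNormal (v : TangentSpace 𝓘(ℝ, E2) p) (i : Fin 3) :
    D.crd i (φ.nablaNormal p v) = D.ε i * φ.dAngle i p v
      + D.nab (fun i => D.crd i (leftDeriv E2 E3 φ.toFun p v)) (fun i => D.ε i * φ.angle i p) i := by
  have h : D.crd i (φ.nablaNormal p v) = D.crd i (D.vec fun i => D.ε i * φ.angleDeriv i p v)
      + D.crd i (D.nabla (φ.push p v) (φ.gauss p)) := (D.crd i).map_add _ _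
  rw [h, D.crd_vec, D.crd_nabla]
  simp only [crd_gauss]
  rfl

omit [LieGroup 𝓘(ℝ, E3) ∞ G] [IsManifold 𝓘(ℝ, E2) ∞ S] in
theorem firstForm_apply (a b : Fin 2) :
    φ.firstForm p a b = D.form (φ.tang p a) (φ.tang p b) := rfl

omit [IsManifold 𝓘(ℝ, E2) ∞ S] in
theorem secondForm_apply (a b : Fin 2) :
    φ.secondForm p a b = -(∑ i, φ.tang p a i * φ.dang p b i
      + D.form (φ.tang p a) (D.nab (φ.tang p b) fun i => D.ε i * φ.angle i p)) := by
  have h : φ.secondForm p a b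
      = -∑ i, D.ε i * φ.tang p a i * D.crd i (φ.nablaNormal p (coordVec p b)) := rfl
  rw [h, neg_inj, DiagonalMetric.form, ← Finset.sum_add_distrib]
  refine Finset.sum_congr rfl fun i _ => ?_
  rw [crd_nablaNormal]
  change D.ε i * φ.tang p a i * (D.ε i * φ.dang p b i
    + D.nab (φ.tang p b) (fun i => D.ε i * φ.angle i p) i) = _
  linear_combination φ.tang p a i * φ.dang p b i * D.eps_sq i

/-- The trace of the derivative of the angle functions, times the determinant of the first
fundamental form. -/
def traceNumerator : ℝ :=
  D.form (φ.tang p 1) (φ.tang p 1) * (∑ i, φ.tang p 0 i * φ.dang p 0 i)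
    - D.form (φ.tang p 0) (φ.tang p 1) * (∑ i, φ.tang p 1 i * φ.dang p 0 i
      + ∑ i, φ.tang p 0 i * φ.dang p 1 i)
    + D.form (φ.tang p 0) (φ.tang p 0) * (∑ i, φ.tang p 1 i * φ.dang p 1 i)

omit [LieGroup 𝓘(ℝ, E3) ∞ G] [IsManifold 𝓘(ℝ, E2) ∞ S] in
theorem sum_angle_tang (a : Fin 2) :
    φ.angle 0 p * φ.tang p a 0 + φ.angle 1 p * φ.tang p a 1 + φ.angle 2 p * φ.tang p a 2 = 0 := by
  have := φ.sum_angle_mul_crd p (EuclideanSpace.single a (1 : ℝ))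
  rwa [Fin.sum_univ_three] at this

omit [IsManifold 𝓘(ℝ, E2) ∞ S] in
theorem tang_independent (a b : ℝ) (h : ∀ i, a * φ.tang p 0 i + b * φ.tang p 1 i = 0) :
    a = 0 ∧ b = 0 := by
  have h1 : leftDeriv E2 E3 φ.toFun p
      (a • EuclideanSpace.single 0 (1 : ℝ) + b • EuclideanSpace.single 1 (1 : ℝ)) = 0 := by
    refine D.crd_ext fun i => ?_
    simp only [map_add, map_smul, map_zero, smul_eq_mul]
    exact h i
  have h2 := (injective_iff_map_eq_zero _).1 (φ.leftDeriv_injective p) _ h1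
  exact ⟨by simpa using congrArg (fun w : E2 => w 0) h2,
    by simpa using congrArg (fun w : E2 => w 1) h2⟩

omit [IsManifold 𝓘(ℝ, E2) ∞ S] in
theorem exists_angle_eq_cross : ∃ s, s ≠ 0 ∧
    φ.angle 0 p = s * (φ.tang p 0 1 * φ.tang p 1 2 - φ.tang p 0 2 * φ.tang p 1 1) ∧
    φ.angle 1 p = s * (φ.tang p 0 2 * φ.tang p 1 0 - φ.tang p 0 0 * φ.tang p 1 2) ∧
    φ.angle 2 p = s * (φ.tang p 0 0 * φ.tang p 1 1 - φ.tang p 0 1 * φ.tang p 1 0) := by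
  obtain ⟨s, h0, h1, h2, -⟩ := exists_smul_cross (ν := fun i => φ.angle i p)
    (φ.sum_angle_tang p 0) (φ.sum_angle_tang p 1) (φ.tang_independent p)
  refine ⟨s, ?_, h0, h1, h2⟩
  rintro rfl
  refine φ.sgn_ne ?_
  rw [← φ.sum_angle_sq p, Fin.sum_univ_three, h0, h1, h2]
  ring

-- Writing the inverse of the first fundamental form by its adjugate, the connection part of the
-- second form cancels by `sum_adjugate_nab`, and only derivatives of the angle functions survive.
omit [IsManifold 𝓘(ℝ, E2) ∞ S] in
theorem meanCurvature_eq : φ.meanCurvature p = -(φ.sgn / 2 *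
    (Ring.inverse (D.form (φ.tang p 0) (φ.tang p 0) * D.form (φ.tang p 1) (φ.tang p 1)
      - D.form (φ.tang p 0) (φ.tang p 1) ^ 2) * φ.traceNumerator p)) := by
  obtain ⟨s, -, h0, h1, h2⟩ := φ.exists_angle_eq_cross p
  have hnab := D.sum_adjugate_nab (ν := fun i => φ.angle i p) h0 h1 h2
  have hcomm : D.form (φ.tang p 1) (φ.tang p 0) = D.form (φ.tang p 0) (φ.tang p 1) :=
    Finset.sum_congr rfl fun i _ => by ring
  rw [meanCurvature, shapeMatrix, Matrix.inv_def, Matrix.smul_mul, Matrix.trace_smul,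
    Matrix.det_fin_two, Matrix.adjugate_fin_two, smul_eq_mul, ← mul_neg, ← mul_neg]
  congr 2
  · simp only [firstForm_apply, hcomm, sq]
  · simp only [Matrix.trace_fin_two, Matrix.mul_apply, Fin.sum_univ_two, Matrix.of_apply,
      Matrix.cons_val', Matrix.cons_val_zero, Matrix.cons_val_one, Matrix.cons_val_fin_one,
      firstForm_apply, secondForm_apply, hcomm, traceNumerator]
    linear_combination -hnab

omit [IsManifold 𝓘(ℝ, E2) ∞ S] in
theorem traceNumerator_eq_zero_of_meanCurvature (h : φ.meanCurvature p = 0) :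
    φ.traceNumerator p = 0 := by
  obtain ⟨s, hs, h0, h1, h2⟩ := φ.exists_angle_eq_cross p
  have hdet : D.form (φ.tang p 0) (φ.tang p 0) * D.form (φ.tang p 1) (φ.tang p 1)
      - D.form (φ.tang p 0) (φ.tang p 1) ^ 2 ≠ 0 := by
    intro hd
    rw [D.form_det] at hd
    have h3 := (mul_eq_zero_iff_left (mul_ne_zero (mul_ne_zero (D.eps_ne 0) (D.eps_ne 1))
      (D.eps_ne 2))).1 hd
    refine φ.sgn_ne ?_
    rw [← φ.sum_angle_sq p, Fin.sum_univ_three, h0, h1, h2]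
    linear_combination s ^ 2 * h3
  rw [meanCurvature_eq, neg_eq_zero, Ring.inverse_eq_inv'] at h
  have h3 := (mul_eq_zero.1 h).resolve_left (div_ne_zero φ.sgn_ne two_ne_zero)
  exact (mul_eq_zero.1 h3).resolve_left (inv_ne_zero hdet)

/-- The Maurer–Cartan equation in terms of the function `ζ`. -/
theorem exists_zeta_eq : ∃ s, s ≠ 0 ∧ φ.zeta p
    = s * (∑ i, φ.tang p 1 i * φ.dang p 0 i - ∑ i, φ.tang p 0 i * φ.dang p 1 i) := by
  obtain ⟨s, hs, h0, h1, h2⟩ := φ.exists_angle_eq_cross p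
  refine ⟨s, hs, ?_⟩
  have h := φ.dAngle_sub p (EuclideanSpace.single 0 (1 : ℝ)) (EuclideanSpace.single 1 (1 : ℝ))
  rw [D.lieBr_eq_vec] at h
  simp only [D.crd_vec] at h
  have h3 : ∑ i, φ.tang p 1 i * φ.dang p 0 i - ∑ i, φ.tang p 0 i * φ.dang p 1 i
      = ∑ i, φ.angle i p * D.brk (φ.tang p 0) (φ.tang p 1) i := by
    rw [← Finset.sum_sub_distrib]
    refine Eq.trans ?_ h
    exact Finset.sum_congr rfl fun i _ => by
      change φ.tang p 1 i * φ.dang p 0 i - φ.tang p 0 i * φ.dang p 1 i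
        = φ.dang p 0 i * φ.tang p 1 i - φ.dang p 1 i * φ.tang p 0 i
      ring
  rw [h3, zeta]
  simp only [Fin.sum_univ_three, DiagonalMetric.brk, Matrix.cons_val]
  linear_combination D.c 0 * φ.angle 0 p * h0 + D.c 1 * φ.angle 1 p * h1
    + D.c 2 * φ.angle 2 p * h2

omit [LieGroup 𝓘(ℝ, E3) ∞ G] [IsManifold 𝓘(ℝ, E2) ∞ S] in
theorem dAngle_eq_zero_of_dang (h : ∀ a i, φ.dang p a i = 0) (i : Fin 3) : φ.dAngle i p = 0 := by
  refine ContinuousLinearMap.ext fun v => ?_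
  have hv : v = v 0 • EuclideanSpace.single 0 (1 : ℝ) + v 1 • EuclideanSpace.single 1 (1 : ℝ) :=
    AffPlane.plane_ext (by simp) (by simp)
  have h0 : φ.dAngle i p (EuclideanSpace.single 0 (1 : ℝ)) = 0 := h 0 i
  have h1 : φ.dAngle i p (EuclideanSpace.single 1 (1 : ℝ)) = 0 := h 1 i
  rw [hv, map_add, map_smul, map_smul, h0, h1]
  simp

variable {φ p}

/-- At a point of a minimal surface with `ζ = 0`, the differentials of the angle functions vanish
if they have a common nonisotropic tangent null vector. -/
theorem dAngle_eq_zero_of_null (hH : φ.meanCurvature p = 0) (hζ : φ.zeta p = 0) {U : Fin 3 → ℝ}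
    (hU : ∑ i, φ.angle i p * U i = 0) (hUd : ∀ v, ∑ i, U i * φ.dAngle i p v = 0)
    (hUU : ∑ i, D.ε i * U i ^ 2 ≠ 0) (i : Fin 3) : φ.dAngle i p = 0 := by
  obtain ⟨s, hs, h0, h1, h2⟩ := φ.exists_angle_eq_cross p
  obtain ⟨s', hs', hz⟩ := φ.exists_zeta_eq p
  rw [hζ, zero_eq_mul, or_iff_right hs', sub_eq_zero] at hz
  have hT := φ.traceNumerator_eq_zero_of_meanCurvature p hH
  have hε : ∀ a, ∑ i, D.ε i * φ.angle i p * φ.dang p a i = 0 := fun a =>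
    φ.sum_mul_angle_dAngle_eq_zero φ.sum_angle_sq p _
  have h := eq_zero_of_null_vector (ν := fun i => φ.angle i p) φ.sgn_ne h0 h1 h2
    (φ.sum_angle_sq p) (hε 0) (hε 1) hz hT hU (hUd _) (hUd _) hUU
  refine φ.dAngle_eq_zero_of_dang p (fun a i => ?_) i
  fin_cases a
  exacts [(h i).1, (h i).2]

end ImmersedSurface

end MeanCurvature
end

noncomputable section

/-! ### The equivalences. -/

section Equivalence

theorem exists_eq_of_sq_eq {S : Type*} [TopologicalSpace S] [ConnectedSpace S] {f : S → ℝ}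
    (hf : Continuous f) {k : ℝ} (h : ∀ p, f p ^ 2 = k) : ∃ k', ∀ p, f p = k' := by
  obtain ⟨p₀⟩ : Nonempty S := inferInstance
  by_cases h0 : f p₀ = 0
  · refine ⟨0, fun p => (pow_eq_zero_iff two_ne_zero).1 ?_⟩
    rw [h, ← h p₀, h0]
    simp
  · rcases isPreconnected_univ.eq_or_eq_neg_of_sq_eq (f := f) (g := fun _ => f p₀)
      hf.continuousOn continuousOn_const (fun p _ => by simp [h])
      (fun _ => h0) with h1 | h1
    · exact ⟨f p₀, fun p => h1 (Set.mem_univ p)⟩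
    · exact ⟨-f p₀, fun p => h1 (Set.mem_univ p)⟩

variable {G : Type*} [TopologicalSpace G] [ChartedSpace E3 G] [Group G] [LieGroup 𝓘(ℝ, E3) ∞ G]
  {D : DiagonalMetric G} {S : Type*} [TopologicalSpace S] [ConnectedSpace S] [ChartedSpace E2 S]
  [IsManifold 𝓘(ℝ, E2) ∞ S]

namespace ImmersedSurface

variable (φ : ImmersedSurface D S)

omit [LieGroup 𝓘(ℝ, E3) ∞ G] in
theorem exists_angle_eq_of_dAngle (h : ∀ p i, φ.dAngle i p = 0) :
    ∃ k : Fin 3 → ℝ, ∀ i p, φ.angle i p = k i := by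
  obtain ⟨p₀⟩ : Nonempty S := inferInstance
  exact ⟨fun i => φ.angle i p₀, fun i p => eq_of_modelDeriv_eq_zero (F := E2) (F' := ℝ) isOpen_univ
    isPreconnected_univ (fun p _ => φ.angle_diffAt i p) (fun p _ => h p i) (Set.mem_univ p)
    (Set.mem_univ p₀)⟩

-- Both quantities are linear in the derivatives of the angle functions.
omit [ConnectedSpace S] in
theorem meanCurvature_zeta_eq_zero {k : Fin 3 → ℝ} (h : ∀ i p, φ.angle i p = k i) (p : S) :
    φ.meanCurvature p = 0 ∧ φ.zeta p = 0 := by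
  have hd : ∀ a i, φ.dang p a i = 0 := by
    intro a i
    have : φ.dAngle i p = 0 := by
      rw [dAngle, show φ.angle i = fun _ => k i from funext (h i), modelDeriv_const]
    rw [dang, this]
    rfl
  constructor
  · rw [meanCurvature_eq, traceNumerator]
    simp [hd]
  · obtain ⟨s, -, hz⟩ := φ.exists_zeta_eq p
    rw [hz]
    simp [hd]

/-- The square of the length of the tangent vector `∑ c i (ν i) E i` is constant on minimal surfaces
with `ζ = 0`, and the angle functions are constant where it does not vanish. -/
theorem exists_angle_eq_of_sum_ne (h : ∀ p, φ.meanCurvature p = 0 ∧ φ.zeta p = 0) {p₀ : S}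
    (hp₀ : ∑ i, D.ε i * D.c i ^ 2 * φ.angle i p₀ ^ 2 ≠ 0) :
    ∃ k : Fin 3 → ℝ, ∀ i p, φ.angle i p = k i := by
  set P : S → ℝ := fun p => ∑ i, D.ε i * D.c i ^ 2 * φ.angle i p ^ 2 with hP
  have hne : ∀ p, P p ≠ 0 → ∀ i, φ.dAngle i p = 0 := by
    intro p hp
    refine dAngle_eq_zero_of_null (h p).1 (h p).2 (U := fun i => D.c i * φ.angle i p) ?_ ?_ ?_
    · rw [← (h p).2, zeta]
      exact Finset.sum_congr rfl fun i _ => by ring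
    · intro v
      exact φ.sum_mul_angle_dAngle_eq_zero (fun p => (h p).2) p v
    · convert hp using 1
      exact Finset.sum_congr rfl fun i _ => by ring
  -- The derivative of P is only known to vanish where P ≠ 0. That of P² is 2P dP, which vanishes
  -- everywhere, so P² is constant and P has no zeros once it is nonzero somewhere.
  have hder : ∀ p, HasMFDerivAt 𝓘(ℝ, E2) 𝓘(ℝ, ℝ) (P * P) p (0 : E2 →L[ℝ] ℝ) := by
    intro p
    have h1 := φ.hasMFDerivAt_sum_mul_angle_sq (fun i => D.ε i * D.c i ^ 2) p
    have hA : ∀ A : E2 →L[ℝ] ℝ, (P p ≠ 0 → A = 0) → P p • A + P p • A = 0 := by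
      intro A hA
      by_cases hp : P p = 0
      · rw [hp, zero_smul, add_zero]
      · rw [hA hp, smul_zero, add_zero]
    exact (h1.mul h1).congr_mfderiv (hA _ fun hp =>
      Finset.sum_eq_zero fun i _ => by rw [hne p hp i]; exact smul_zero _)
  refine φ.exists_angle_eq_of_dAngle fun p => hne p fun hp => hp₀ ?_
  have hc := eq_of_modelDeriv_eq_zero (F := E2) (F' := ℝ) (f := P * P) isOpen_univ
    isPreconnected_univ (fun p _ => (hder p).mdifferentiableAt) (fun p _ => (hder p).mfderiv)
    (Set.mem_univ p₀) (Set.mem_univ p)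
  simp only [Pi.mul_apply, hp, mul_zero] at hc
  exact mul_self_eq_zero.1 hc

/-- The Heisenberg case. -/
theorem exists_angle_eq_of_angle_eq_zero (h : ∀ p, φ.meanCurvature p = 0 ∧ φ.zeta p = 0) {k : Fin 3}
    (hk : ∀ p, φ.angle k p = 0) : ∃ k : Fin 3 → ℝ, ∀ i p, φ.angle i p = k i := by
  -- With νₖ identically zero, Eₖ is tangent and nonisotropic, and it pairs with the derivatives to
  -- dνₖ = 0, so it serves as the kernel vector.
  refine φ.exists_angle_eq_of_dAngle fun p =>
    dAngle_eq_zero_of_null (h p).1 (h p).2 (U := Pi.single k 1) ?_ ?_ ?_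
  · simp [Pi.single_apply, hk]
  · intro v
    have : φ.dAngle k p = 0 := by
      rw [dAngle, show φ.angle k = fun _ => (0 : ℝ) from funext hk, modelDeriv_const]
    simp [Pi.single_apply, this]
  · have := D.eps_ne k
    simpa [Pi.single_apply] using this

/-- When the vector (cᵢνᵢ) is isotropic everywhere, the yᵢ = εᵢνᵢ² have prescribed moments δ, 0, 0
with respect to the nodes dᵢ = εᵢcᵢ. Constant curvature is excluded to rule out two equal nodes with
the third zero. -/
theorem exists_angle_eq_of_minimal (hD : ¬ D.HasConstantSectionalCurvature)
    (h : ∀ p, φ.meanCurvature p = 0 ∧ φ.zeta p = 0) :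
    ∃ k : Fin 3 → ℝ, ∀ i p, φ.angle i p = k i := by
  by_cases hP : ∃ p₀, ∑ i, D.ε i * D.c i ^ 2 * φ.angle i p₀ ^ 2 ≠ 0
  · obtain ⟨p₀, hp₀⟩ := hP
    exact φ.exists_angle_eq_of_sum_ne h hp₀
  push Not at hP
  have hδ := φ.sgn_ne
  set y : Fin 3 → S → ℝ := fun i p => D.ε i * φ.angle i p ^ 2 with hy
  set d : Fin 3 → ℝ := fun i => D.ε i * D.c i with hd
  have e1 : ∀ p, y 0 p + y 1 p + y 2 p = φ.sgn := fun p => by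
    rw [← φ.sum_angle_sq p, Fin.sum_univ_three]
  have e2 : ∀ p, d 0 * y 0 p + d 1 * y 1 p + d 2 * y 2 p = 0 := fun p => by
    rw [← (h p).2, zeta, Fin.sum_univ_three]
    linear_combination D.c 0 * φ.angle 0 p ^ 2 * D.eps_sq 0
      + D.c 1 * φ.angle 1 p ^ 2 * D.eps_sq 1 + D.c 2 * φ.angle 2 p ^ 2 * D.eps_sq 2
  have e3 : ∀ p, d 0 ^ 2 * y 0 p + d 1 ^ 2 * y 1 p + d 2 ^ 2 * y 2 p = 0 := fun p => by
    rw [← hP p, Fin.sum_univ_three]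
    linear_combination D.ε 0 * D.c 0 ^ 2 * φ.angle 0 p ^ 2 * D.eps_sq 0
      + D.ε 1 * D.c 1 ^ 2 * φ.angle 1 p ^ 2 * D.eps_sq 1
      + D.ε 2 * D.c 2 ^ 2 * φ.angle 2 p ^ 2 * D.eps_sq 2
  -- Lagrange interpolation: the moments are tested against the polynomial (t - d₁)(t - d₂), whose
  -- constant term alone survives on the right.
  have f0 : ∀ p, y 0 p * ((d 0 - d 1) * (d 0 - d 2)) = φ.sgn * (d 1 * d 2) := fun p => by
    linear_combination e3 p - (d 1 + d 2) * e2 p + d 1 * d 2 * e1 p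
  have f1 : ∀ p, y 1 p * ((d 1 - d 2) * (d 1 - d 0)) = φ.sgn * (d 2 * d 0) := fun p => by
    linear_combination e3 p - (d 2 + d 0) * e2 p + d 2 * d 0 * e1 p
  have f2 : ∀ p, y 2 p * ((d 2 - d 0) * (d 2 - d 1)) = φ.sgn * (d 0 * d 1) := fun p => by
    linear_combination e3 p - (d 0 + d 1) * e2 p + d 0 * d 1 * e1 p
  have hyz : ∀ i p, y i p = 0 → φ.angle i p = 0 := fun i p hi =>
    (pow_eq_zero_iff two_ne_zero).1 ((mul_eq_zero.1 hi).resolve_left (D.eps_ne i))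
  have hdc : ∀ i, d i = 0 → D.c i = 0 := fun i hi => (mul_eq_zero.1 hi).resolve_left (D.eps_ne i)
  obtain ⟨p₀⟩ : Nonempty S := inferInstance
  by_cases h01 : d 0 = d 1
  · by_cases hd2 : d 2 = 0
    · exact absurd (D.hasConstantSectionalCurvature_two h01 (hdc 2 hd2)) hD
    -- With two equal nodes the left side of `f0` vanishes, so d₁d₂ = 0. As d₂ ≠ 0, the double node
    -- is 0, and `f2` then forces the remaining angle function to vanish: the Heisenberg case.
    have hd1 : d 1 = 0 := by
      have := f0 p₀
      rw [h01, sub_self, zero_mul, mul_zero] at this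
      simpa [hδ, hd2] using this.symm
    refine φ.exists_angle_eq_of_angle_eq_zero h (k := 2) fun p => hyz 2 p ?_
    have := f2 p
    rw [h01, hd1] at this
    simpa [hd2] using this
  by_cases h12 : d 1 = d 2
  · by_cases hd0 : d 0 = 0
    · exact absurd (D.hasConstantSectionalCurvature_zero h12 (hdc 0 hd0)) hD
    have hd2 : d 2 = 0 := by
      have := f1 p₀
      rw [h12, sub_self, zero_mul, mul_zero] at this
      simpa [hδ, hd0] using this.symm
    refine φ.exists_angle_eq_of_angle_eq_zero h (k := 0) fun p => hyz 0 p ?_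
    have := f0 p
    rw [h12, hd2] at this
    simpa [hd0] using this
  by_cases h02 : d 0 = d 2
  · by_cases hd1 : d 1 = 0
    · exact absurd (D.hasConstantSectionalCurvature_one h02 (hdc 1 hd1)) hD
    have hd2 : d 2 = 0 := by
      have := f2 p₀
      rw [h02, sub_self, zero_mul, mul_zero] at this
      simpa [hδ, hd1] using this.symm
    refine φ.exists_angle_eq_of_angle_eq_zero h (k := 1) fun p => hyz 1 p ?_
    have := f1 p
    rw [h02, hd2] at this
    simpa [hd1] using this
  have hconst : ∀ i, ∃ k, ∀ p, y i p = k := by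
    intro i
    have key : ∀ {f : S → ℝ} {A B : ℝ}, A ≠ 0 → (∀ p, f p * A = B) → ∃ k, ∀ p, f p = k :=
      fun {f A B} hA hf => ⟨B / A, fun p => eq_div_of_mul_eq hA (hf p)⟩
    have g01 := sub_ne_zero.2 h01
    have g12 := sub_ne_zero.2 h12
    have g02 := sub_ne_zero.2 h02
    have g10 := sub_ne_zero.2 (Ne.symm h01)
    have g21 := sub_ne_zero.2 (Ne.symm h12)
    have g20 := sub_ne_zero.2 (Ne.symm h02)
    fin_cases i
    exacts [key (mul_ne_zero g01 g02) f0, key (mul_ne_zero g12 g10) f1,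
      key (mul_ne_zero g20 g21) f2]
  have hang : ∀ i, ∃ k, ∀ p, φ.angle i p = k := by
    intro i
    obtain ⟨k, hk⟩ := hconst i
    -- Only the squares of the angle functions are determined so far; connectedness fixes the signs.
    refine exists_eq_of_sq_eq
      (continuous_iff_continuousAt.2 fun p => (φ.angle_smooth i p).continuousAt)
      (k := D.ε i * k) fun p => ?_
    rw [← hk p]
    linear_combination -φ.angle i p ^ 2 * D.eps_sq i
  choose k hk using hang
  exact ⟨k, hk⟩

theorem exists_coset_of_angle_eq [T2Space G] {k : Fin 3 → ℝ} (h : ∀ i p, φ.angle i p = k i) :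
    ∃ (H : Subgroup G) (g : G), IsLieSubgroupOfDimTwo H ∧
      Set.range φ.toFun ⊆ (fun h => g * h) '' (H : Set G) := by
  obtain ⟨p₀⟩ : Nonempty S := inferInstance
  have hs : ∑ i, D.ε i * k i ^ 2 = φ.sgn := by
    rw [← φ.sum_angle_sq p₀]
    simp only [h]
  have hc : ∑ i, D.c i * k i ^ 2 = 0 := by
    rw [← (φ.meanCurvature_zeta_eq_zero h p₀).2, zeta]
    simp only [h]
  obtain ⟨l, X, Y, Z, Φ, K, i1, i2, i3, i4, i5, i6, i7, π, ι, hΦ, hK, hB, hV⟩ :=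
    D.exists_planeCover (D.ne_zero_of_sum φ.sgn_sign hs) hc
  obtain ⟨ψ, hψ, hψφ⟩ := hK.exists_lift (F := E2) hΦ hB (φ := φ.toFun) φ.smooth (fun p v => by
    rw [hV]
    simpa only [h] using φ.sum_angle_mul_crd p v) p₀
  refine ⟨ι.range, φ.toFun p₀, ⟨K, i1, i2, i3, i5, i6, i7, ι, hK.smooth_ι hΦ, hK.injective,
    fun q => ?_, rfl⟩, ?_⟩
  · refine (injective_iff_map_eq_zero (modelDeriv E2 E3 ι q)).2 fun v hv => ?_
    exact (injective_iff_map_eq_zero _).1 (hK.leftDeriv_ι_injective hΦ hB q) v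
      ((modelDeriv_apply_eq_zero_iff ((hK.smooth_ι hΦ q).mdifferentiableAt (by simp)) v).1 hv)
  · rintro _ ⟨p, rfl⟩
    exact ⟨ι (ψ p), ⟨ψ p, rfl⟩, (hψφ p).symm⟩

theorem exists_angle_eq_of_subset_coset {H : Subgroup G} {g : G} (hH : IsLieSubgroupOfDimTwo H)
    (h : Set.range φ.toFun ⊆ (fun h => g * h) '' (H : Set G)) :
    ∃ k : Fin 3 → ℝ, ∀ i p, φ.angle i p = k i := by
  obtain ⟨K, _, _, _, _, _, _, ι, hι, -, hinj, rfl⟩ := hH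
  refine φ.exists_angle_eq_of_mem_range
    (leftDeriv_mem_range_of_subset_coset (ι := ι) (g := g) hι ?_ φ.smooth fun p => ?_)
  · refine (injective_iff_map_eq_zero _).2 fun v hv => ?_
    exact (injective_iff_map_eq_zero (modelDeriv E2 E3 ι 1)).1 (hinj 1) v
      ((modelDeriv_apply_eq_zero_iff ((hι 1).mdifferentiableAt (by simp)) v).2 hv)
  · obtain ⟨_, ⟨q, rfl⟩, hq⟩ := h ⟨p, rfl⟩
    exact ⟨q, hq.symm⟩

theorem tfae_constant_angles [T2Space G] (hD : ¬ D.HasConstantSectionalCurvature) :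
    List.TFAE [
      ∀ p, φ.meanCurvature p = 0 ∧ φ.zeta p = 0,
      ∃ k : Fin 3 → ℝ, ∀ i p, φ.angle i p = k i,
      ∃ (H : Subgroup G) (g : G), IsLieSubgroupOfDimTwo H ∧
        Set.range φ.toFun ⊆ (fun h => g * h) '' (H : Set G)] := by
  tfae_have 1 → 2 := φ.exists_angle_eq_of_minimal hD
  tfae_have 2 → 1 := fun ⟨_, hk⟩ => φ.meanCurvature_zeta_eq_zero hk
  tfae_have 2 → 3 := fun ⟨_, hk⟩ => φ.exists_coset_of_angle_eq hk
  tfae_have 3 → 2 := fun ⟨_, _, hH, hg⟩ => φ.exists_angle_eq_of_subset_coset hH hg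
  tfae_finish

end ImmersedSurface

end Equivalence
end

theorem proposition3p14 {G : Type u} [TopologicalSpace G] [T2Space G] [ChartedSpace E3 G]
    [Group G] [LieGroup 𝓘(ℝ, E3) ∞ G] (D : DiagonalMetric G)
    (hD : ¬ D.HasConstantSectionalCurvature) :
    (∀ (S : Type v) [TopologicalSpace S] [T2Space S] [ConnectedSpace S] [ChartedSpace E2 S]
        [IsManifold 𝓘(ℝ, E2) ∞ S] (φ : ImmersedSurface D S),
      List.TFAE [
        ∀ p, φ.meanCurvature p = 0 ∧ φ.zeta p = 0,
        ∃ k : Fin 3 → ℝ, ∀ i p, φ.angle i p = k i,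
        ∃ (H : Subgroup G) (g : G), IsLieSubgroupOfDimTwo H ∧
          Set.range φ.toFun ⊆ (fun h => g * h) '' (H : Set G)]) ∧
    (∀ (ν : Fin 3 → ℝ) (δ : ℝ), (δ = 1 ∨ δ = -1) →
      ∑ i, D.ε i * ν i ^ 2 = δ → ∑ i, D.c i * ν i ^ 2 = 0 →
      ∃ (S₀ : Type) (_ : TopologicalSpace S₀) (_ : T2Space S₀) (_ : SecondCountableTopology S₀)
        (_ : ConnectedSpace S₀) (_ : ChartedSpace E2 S₀) (_ : IsManifold 𝓘(ℝ, E2) ∞ S₀)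
        (F : ImmersedSurface D S₀),
        F.IsComplete ∧ Function.Injective F.toFun ∧ (∀ i p, F.angle i p = ν i) ∧
        ∀ (S : Type v) [TopologicalSpace S] [T2Space S] [ConnectedSpace S] [ChartedSpace E2 S]
          [IsManifold 𝓘(ℝ, E2) ∞ S] (φ : ImmersedSurface D S),
          (∀ i p, φ.angle i p = ν i) →
          ∃ (g : G) (ψ : S → S₀), IsLocalDiffeomorph 𝓘(ℝ, E2) 𝓘(ℝ, E2) ∞ ψ ∧
            (∀ p, φ.toFun p = g * F.toFun (ψ p)) ∧
            (φ.IsComplete → Function.Surjective ψ)) :=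
  ⟨fun _ _ _ _ _ _ φ => φ.tfae_constant_angles hD,
    fun _ _ hδ hν hc => exists_complete_surface D hδ hν hc⟩
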